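/- **Notation.** For $N\ge 1$ let $U(N)$ be the group of unitary $N\times N$ matrices with normalized Haar measure $\mu_N$, embedded in $U(N+1)$ by $U\mapsto\begin{bmatrix}U&0\\0&1\end{bmatrix}$. Let $U(\infty)=\bigcup_N U(N)$ with the inductive limit topology, $G=U(\infty)\times U(\infty)$, $G(N)=U(N)\times U(N)$, $K=\operatorname{diag}U(\infty)\subset G$. For $U=\begin{bmatrix}A&B\\C&D\end{bmatrix}\in U(N)$ with $D=U_{NN}$, put $p_N(U)=A-B(1+D)^{-1}C$ if $D\ne-1$ and $p_N(U)=A$ if $D=-1$; then $p_N$ maps $U(N)$ to $U(N-1)$ for $N\ge2$. The space of virtual unitary matrices is the set $\mathfrak U=\varprojlim U(N)$ of sequences $x=(x_N)_{N\ge1}$, $x_N\in U(N)$, with $p_N(x_N)=x_{N-1}$; write $\pi_N(x)=x_N$, and give $\mathfrak U$ the $\sigma$-algebra generated by the $\pi_N$. The group $G$ acts on $\mathfrak U$ on the right by $\pi_N(x.g)=U_2^{-1}\pi_N(x)U_1$ for $g=(U_1,U_2)\in G$ and all sufficiently large $N$. For $z,w\in\mathbb C$ let $f_{z,w|N}(U)=\det\big((1+U)^z(1+U^{-1})^w\big)=\prod_{k=1}^N(1+u_k)^z(1+\bar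 u_k)^w$ (principal powers; $u_1,\dots,u_N$ are the eigenvalues of $U\in U(N)$ with multiplicities) if no $u_k$ equals $-1$, and $f_{z,w|N}(U)=0$ otherwise. For $g\in G$ and $x\in\mathfrak U$ let $C_{z,w}(x,g)$ be the stable value, for large $N$, of $f_{z,w|N}(\pi_N(x.g))/f_{z,w|N}(\pi_N(x))$. (It exists whenever none of the matrices $x_N$, $\pi_N(x.g)$ has eigenvalue $-1$; elsewhere its value is immaterial.) For $s\in\mathbb C$ with $\Re s>-\frac12$ let $\mu^{(s)}_N$ be the measure on $U(N)$ $$\mu^{(s)}_N(dU)=\Big(\prod_{k=1}^N\frac{\Gamma(k)\Gamma(k+s+\bar s)}{\Gamma(k+s)\Gamma(k+\bar s)}\Big)^{-1}\,|\det((1+U)^s)|^2\,\mu_N(dU),\qquad \det((1+U)^s)=f_{s,0|N}(U).$$ For $\Re(z+w)>-\frac12$ the representation $T_{z,w}$ is defined as follows. Let $H_N=L^2(U(N),\mu_N)$, with the unitary representation $(\mathrm{Reg}_N(g)f)(U)=f(U_2^{-1}UU_1)$ of $G(N)$, $g=(U_1,U_2)$. Let $\nu_N$ be the image of $\mu_N$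 under $U\mapsto U_{NN}$, let $v_{z,w}(D)=(1+D)^z(1+\bar D)^w$, and let $v'_{z,w|N}=v_{z,w}/\|v_{z,w}\|_{L^2(\nu_N)}$. The maps $L_{z,w|N}:H_{N-1}\to H_N$, $(L_{z,w|N}f)(U)=f(p_N(U))\,v'_{z,w|N}(U_{NN})$, $N\ge2$, are isometric and commute with $G(N-1)$; $H=\varinjlim H_N$ is the Hilbert space inductive limit and $T_{z,w}=\varinjlim\mathrm{Reg}_N$ acts in it. The distinguished vector $\xi_{z,w}\in H$ is the common image in $H$ of the vectors $f'_{z,w|N}=f_{z,w|N}/\|f_{z,w|N}\|\in H_N$, $N\ge1$. **Theorem.** Let $s,z,w\in\mathbb C$ with $\Re s>-\frac12$ and $z+\bar w=s$. (0) There is exactly one measure $\mu^{(s)}$ on $\mathfrak U$ (the projective limit of the $\mu_N^{(s)}$) whose image under $\pi_N$ is $\mu^{(s)}_N$ for every $N$; it is a probability measure. (1) The formula $$(\underline T_{z,w}(g)f)(x)=f(x.g)\,C_{z,w}(x,g),\qquad g\in G,\ f\in\underline H,$$ for $\mu^{(s)}$-almost all $x$, is well defined (the class of the right-hand side does not depend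 on the representative of $f$) and defines a unitary representation $\underline T_{z,w}$ of $G$ in the Hilbert space $\underline H=L^2(\mathfrak U,\mu^{(s)})$, i.e. a strongly continuous homomorphism from $G$ to the unitary operators of $\underline H$. (2) The constant function $\mathbf 1\in\underline H$ is a unit $K$-invariant vector of $\underline T_{z,w}$. (3) The functions $f_{z,w|N}$ lie in $H_N$, and there is a surjective linear isometry $\underline H\to H$ which intertwines $\underline T_{z,w}$ and $T_{z,w}$ and takes $\mathbf 1$ to $\xi_{z,w}$. -/

import Mathlib

open Matrix MeasureTheory Filter Topology
open scoped ComplexConjugate ENNReal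

noncomputable section

namespace VirtUnitary

/-! ### Unitary groups, block embeddings and the infinite-dimensional unitary group -/

/-- The compact group `U(N)` of unitary `N × N` matrices. -/
abbrev UN (N : ℕ) : Type := Matrix.unitaryGroup (Fin N) ℂ

/-- The matrix `[U 0; 0 1]`. -/
def embMat {N : ℕ} (U : Matrix (Fin N) (Fin N) ℂ) : Matrix (Fin (N + 1)) (Fin (N + 1)) ℂ :=
  Matrix.of fun i j =>
    Fin.lastCases (Fin.lastCases (1 : ℂ) (fun _ => 0) j)
      (fun i' => Fin.lastCases (0 : ℂ) (fun j' => U i' j') j) i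

@[simp] lemma embMat_cc {N : ℕ} (U : Matrix (Fin N) (Fin N) ℂ) (i j : Fin N) :
    embMat U i.castSucc j.castSucc = U i j := by simp [embMat]

@[simp] lemma embMat_cl {N : ℕ} (U : Matrix (Fin N) (Fin N) ℂ) (i : Fin N) :
    embMat U i.castSucc (Fin.last N) = 0 := by simp [embMat]

@[simp] lemma embMat_lc {N : ℕ} (U : Matrix (Fin N) (Fin N) ℂ) (j : Fin N) :
    embMat U (Fin.last N) j.castSucc = 0 := by simp [embMat]

@[simp] lemma embMat_ll {N : ℕ} (U : Matrix (Fin N) (Fin N) ℂ) :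
    embMat U (Fin.last N) (Fin.last N) = 1 := by simp [embMat]

lemma embMat_one (N : ℕ) : embMat (1 : Matrix (Fin N) (Fin N) ℂ) = 1 := by
  ext i j
  refine Fin.lastCases ?_ (fun i => ?_) i <;> refine Fin.lastCases ?_ (fun j => ?_) j
  · simp
  · simp [(Fin.castSucc_lt_last j).ne']
  · simp [(Fin.castSucc_lt_last i).ne]
  · simp [Matrix.one_apply]

lemma embMat_mul {N : ℕ} (U V : Matrix (Fin N) (Fin N) ℂ) :
    embMat (U * V) = embMat U * embMat V := by
  ext i j
  refine Fin.lastCases ?_ (fun i => ?_) i <;> refine Fin.lastCases ?_ (fun j => ?_) j <;>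
    simp [Matrix.mul_apply, Fin.sum_univ_castSucc]

lemma embMat_star {N : ℕ} (U : Matrix (Fin N) (Fin N) ℂ) :
    star (embMat U) = embMat (star U) := by
  ext i j
  refine Fin.lastCases ?_ (fun i => ?_) i <;> refine Fin.lastCases ?_ (fun j => ?_) j <;>
    simp [Matrix.star_apply]

/-- The embedding `U(N) → U(N+1)`, `U ↦ [U 0; 0 1]`. -/
def emb (N : ℕ) : UN N →* UN (N + 1) where
  toFun U := ⟨embMat U.1, by
    rw [Matrix.mem_unitaryGroup_iff, embMat_star, ← embMat_mul,
      Matrix.mem_unitaryGroup_iff.1 U.2, embMat_one]⟩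
  map_one' := Subtype.ext (embMat_one N)
  map_mul' U V := Subtype.ext (embMat_mul U.1 V.1)

/-- The iterated embedding `U(N) → U(M)` for `N ≤ M`. -/
def embLE {N M : ℕ} (h : N ≤ M) : UN N →* UN M :=
  Nat.leRecOn h (fun {k} f => (emb k).comp f) (MonoidHom.id _)

@[simp] lemma embLE_self {N : ℕ} : embLE (le_refl N) = MonoidHom.id _ := Nat.leRecOn_self _

lemma embLE_succ {N M : ℕ} (h : N ≤ M) :
    embLE (Nat.le_succ_of_le h) = (emb M).comp (embLE h) := Nat.leRecOn_succ h _

lemma embLE_trans {N M K : ℕ} (h : N ≤ M) (h' : M ≤ K) :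
    embLE (h.trans h') = (embLE h').comp (embLE h) := by
  induction K, h' using Nat.le_induction with
  | base => simp
  | succ K h' ih =>
    have := embLE_succ (h.trans h')
    rw [this, ih, embLE_succ h', MonoidHom.comp_assoc]

instance : DirectedSystem UN (fun _ _ h => embLE h) where
  map_self _ _ := by simp
  map_map _ _ _ h h' x := by rw [embLE_trans h h']; rfl

/-- The infinite-dimensional unitary group `U(∞) = ⋃ U(N)`. -/
def Uinf : Type := DirectLimit UN (fun _ _ h => embLE h)

instance : Group Uinf := inferInstanceAs (Group (DirectLimit UN (fun _ _ h => embLE h)))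

/-- The inclusion `U(N) ⊂ U(∞)`. -/
def ofUN (N : ℕ) : UN N →* Uinf where
  toFun U := (⟦⟨N, U⟩⟧ : DirectLimit UN (fun _ _ h => embLE h))
  map_one' := (DirectLimit.one_def (f := fun _ _ h => embLE h) N).symm
  map_mul' U V := (DirectLimit.mul_def (f := fun _ _ h => embLE h) N U V).symm

/-- The inductive limit topology on `U(∞)`. -/
instance : TopologicalSpace Uinf := ⨆ N, TopologicalSpace.coinduced (ofUN N) inferInstance

/-- The group `G = U(∞) × U(∞)`. -/
abbrev Ginf : Type := Uinf × Uinf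

/-! ### The canonical projections and virtual unitary matrices -/

/-- The matrix `A - B (1 + D)⁻¹ C`, or `A` if `D = -1`, where `X = [A B; C D]` with `D` of
size one. -/
def projMat {N : ℕ} (X : Matrix (Fin (N + 1)) (Fin (N + 1)) ℂ) : Matrix (Fin N) (Fin N) ℂ :=
  Matrix.of fun i j =>
    if X (Fin.last N) (Fin.last N) = -1 then X i.castSucc j.castSucc
    else X i.castSucc j.castSucc -
      X i.castSucc (Fin.last N) * (1 + X (Fin.last N) (Fin.last N))⁻¹ * X (Fin.last N) j.castSucc

lemma projMat_apply {N : ℕ} (X : Matrix (Fin (N + 1)) (Fin (N + 1)) ℂ) (i j : Fin N) :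
    projMat X i j = X i.castSucc j.castSucc -
      X i.castSucc (Fin.last N) * (1 + X (Fin.last N) (Fin.last N))⁻¹ *
        X (Fin.last N) j.castSucc := by
  by_cases h : X (Fin.last N) (Fin.last N) = -1 <;> simp [projMat, h]

lemma projMat_mem {N : ℕ} (X : UN (N + 1)) : projMat X.1 ∈ Matrix.unitaryGroup (Fin N) ℂ := by
  rw [Matrix.mem_unitaryGroup_iff]
  obtain ⟨X, hX⟩ := X
  have h1 := Matrix.mem_unitaryGroup_iff.1 hX
  have h2 := Matrix.mem_unitaryGroup_iff'.1 hX
  have e1 : ∀ i j, ∑ k : Fin N, X i k.castSucc * conj (X j k.castSucc) +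
      X i (Fin.last N) * conj (X j (Fin.last N)) = (1 : Matrix _ _ ℂ) i j := by
    intro i j
    have := congrFun (congrFun h1 i) j
    simpa [Matrix.mul_apply, Fin.sum_univ_castSucc, Matrix.star_apply] using this
  have e2 := congrFun (congrFun h2 (Fin.last N)) (Fin.last N)
  simp only [Matrix.mul_apply, Fin.sum_univ_castSucc, Matrix.star_apply, RCLike.star_def,
    Matrix.one_apply_eq] at e2
  ext i j
  set D := X (Fin.last N) (Fin.last N) with hD
  set c := (1 + D)⁻¹ with hc
  have key : (projMat X * star (projMat X)) i j =
      ∑ k : Fin N, X i.castSucc k.castSucc * conj (X j.castSucc k.castSucc)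
      - conj (X j.castSucc (Fin.last N)) * conj c *
        ∑ k : Fin N, X i.castSucc k.castSucc * conj (X (Fin.last N) k.castSucc)
      - X i.castSucc (Fin.last N) * c *
        ∑ k : Fin N, X (Fin.last N) k.castSucc * conj (X j.castSucc k.castSucc)
      + X i.castSucc (Fin.last N) * c * (conj (X j.castSucc (Fin.last N)) * conj c) *
        ∑ k : Fin N, X (Fin.last N) k.castSucc * conj (X (Fin.last N) k.castSucc) := by
    simp only [Matrix.mul_apply, Matrix.star_apply, RCLike.star_def, projMat_apply,
      Finset.mul_sum, ← Finset.sum_sub_distrib, ← Finset.sum_add_distrib]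
    refine Finset.sum_congr rfl fun k _ => ?_
    simp only [map_sub, map_mul, ← hD, ← hc]
    ring
  have a1 := e1 i.castSucc j.castSucc
  have a2 := e1 i.castSucc (Fin.last N)
  have a3 := e1 (Fin.last N) j.castSucc
  have a4 := e1 (Fin.last N) (Fin.last N)
  rw [Matrix.one_apply_ne (Fin.castSucc_lt_last i).ne] at a2
  rw [Matrix.one_apply_ne (Fin.castSucc_lt_last j).ne'] at a3
  rw [Matrix.one_apply_eq] at a4
  have a1' : (1 : Matrix (Fin (N + 1)) (Fin (N + 1)) ℂ) i.castSucc j.castSucc =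
      (1 : Matrix (Fin N) (Fin N) ℂ) i j := by simp [Matrix.one_apply]
  rw [a1'] at a1
  rw [key, eq_sub_of_add_eq a1, eq_sub_of_add_eq a2, eq_sub_of_add_eq a3, eq_sub_of_add_eq a4,
    ← hD]
  by_cases hD1 : 1 + D = 0
  · have hDD : D = -1 := by linear_combination hD1
    have hB : ∀ i : Fin N, X i.castSucc (Fin.last N) = 0 := by
      have : ∑ k : Fin N, conj (X k.castSucc (Fin.last N)) * X k.castSucc (Fin.last N) = 0 := by
        rw [hDD] at e2
        simpa using e2
      have h3 : ∑ k : Fin N, ‖X k.castSucc (Fin.last N)‖ ^ 2 = 0 := by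
        have h4 : ((∑ k : Fin N, ‖X k.castSucc (Fin.last N)‖ ^ 2 : ℝ) : ℂ) = 0 := by
          rw [← this]
          push_cast
          exact Finset.sum_congr rfl fun k _ => (Complex.conj_mul' _).symm
        exact_mod_cast h4
      intro i
      have := (Finset.sum_eq_zero_iff_of_nonneg (fun k _ => by positivity)).1 h3 i
        (Finset.mem_univ i)
      simpa using this
    simp [hB]
  · have hD2 : 1 + conj D ≠ 0 := by
      intro h
      apply hD1
      have := congrArg conj h
      simpa using this
    have hc' : conj c = (1 + conj D)⁻¹ := by simp [hc]
    rw [hc', hc]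
    field_simp
    ring

/-- The canonical projection `p_{N+1} : U(N+1) → U(N)`. -/
def proj (N : ℕ) (X : UN (N + 1)) : UN N := ⟨projMat X.1, projMat_mem X⟩

lemma proj_mul_emb {N : ℕ} (V W : UN N) (X : UN (N + 1)) :
    proj N (emb N V * X * emb N W) = V * proj N X * W := by
  apply Subtype.ext
  ext i j
  change projMat (embMat V.1 * X.1 * embMat W.1) i j = (V.1 * projMat X.1 * W.1) i j
  have hll : (embMat V.1 * X.1 * embMat W.1) (Fin.last N) (Fin.last N) =
      X.1 (Fin.last N) (Fin.last N) := by
    simp [Matrix.mul_apply, Fin.sum_univ_castSucc]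
  rw [projMat_apply, hll]
  simp only [Matrix.mul_apply, Fin.sum_univ_castSucc, embMat_cc, embMat_cl, embMat_lc, embMat_ll,
    projMat_apply, mul_zero, zero_mul, Finset.sum_const_zero, zero_add, add_zero, mul_one, one_mul]
  simp only [mul_sub, sub_mul, Finset.sum_sub_distrib, Finset.sum_mul, Finset.mul_sum]
  congr 1
  refine Finset.sum_congr rfl fun k _ => Finset.sum_congr rfl fun l _ => ?_
  ring

/-- The iterated projection `U(M) → U(N)` for `N ≤ M`. -/
def projLE {N M : ℕ} (h : N ≤ M) : UN M → UN N :=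
  Nat.leRecOn (C := fun k => UN k → UN N) h (fun {k} f => f ∘ proj k) id

@[simp] lemma projLE_self {N : ℕ} : projLE (le_refl N) = id := Nat.leRecOn_self _

lemma projLE_succ {N M : ℕ} (h : N ≤ M) :
    projLE (Nat.le_succ_of_le h) = projLE h ∘ proj M := Nat.leRecOn_succ h _

lemma projLE_trans {N M K : ℕ} (h : N ≤ M) (h' : M ≤ K) (X : UN K) :
    projLE (h.trans h') X = projLE h (projLE h' X) := by
  induction K, h' using Nat.le_induction with
  | base => simp
  | succ K h' ih =>
    have := projLE_succ (h.trans h')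
    rw [this, projLE_succ h']
    exact ih _

lemma projLE_step {N : ℕ} : projLE (Nat.le_succ N) = proj N := by
  have := projLE_succ (le_refl N)
  rw [this]; simp

lemma projLE_mul_emb {N M : ℕ} (h : N ≤ M) (V W : UN N) (X : UN M) :
    projLE h (embLE h V * X * embLE h W) = V * projLE h X * W := by
  induction M, h using Nat.le_induction with
  | base => simp
  | succ M h ih =>
    rw [embLE_succ h, projLE_succ h]
    simp only [MonoidHom.comp_apply, Function.comp_apply, proj_mul_emb]
    exact ih _

/-- The space `𝔘 = lim U(N)` of virtual unitary matrices. (The one-point group `U(0)` is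
included; it carries no information.) -/
def VirtualUnitary : Type := {x : ∀ N, UN N // ∀ N, proj N (x (N + 1)) = x N}

/-- The projection `π_N : 𝔘 → U(N)`. -/
def piN (N : ℕ) (x : VirtualUnitary) : UN N := x.1 N

lemma projLE_piN {N M : ℕ} (h : N ≤ M) (x : VirtualUnitary) : projLE h (piN M x) = piN N x := by
  induction M, h using Nat.le_induction with
  | base => simp
  | succ M h ih =>
    rw [projLE_succ h, Function.comp_apply, ← ih]
    exact congrArg _ (x.2 M)

/-- The element `U₂⁻¹ x U₁` of `𝔘`, for `U₁, U₂ ∈ U(M)`: its `N`-th component is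
`U₂⁻¹ x_N U₁` if `N ≥ M`, and the projection of `U₂⁻¹ x_M U₁` to `U(N)` if `N ≤ M`. -/
def shiftN (M : ℕ) (U₁ U₂ : UN M) (x : VirtualUnitary) : VirtualUnitary :=
  ⟨fun N => projLE (le_max_left N M) ((embLE (le_max_right N M) U₂)⁻¹ *
      piN (max N M) x * embLE (le_max_right N M) U₁), by
    have aux : ∀ (N K : ℕ) (h : N ≤ K) (h' : M ≤ K),
        projLE (le_max_left N M) ((embLE (le_max_right N M) U₂)⁻¹ *
          piN (max N M) x * embLE (le_max_right N M) U₁) =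
        projLE h ((embLE h' U₂)⁻¹ * piN K x * embLE h' U₁) := by
      intro N K h h'
      have h'' : max N M ≤ K := max_le h h'
      have t1 := projLE_trans (le_max_left N M) h'' ((embLE h' U₂)⁻¹ * piN K x * embLE h' U₁)
      have t2 := embLE_trans (le_max_right N M) h''
      rw [t1, t2]
      simp only [MonoidHom.comp_apply, ← map_inv]
      rw [projLE_mul_emb, projLE_piN]
    intro N
    beta_reduce
    rw [aux N (max (N + 1) M) (by omega) (by omega), ← projLE_step, ← projLE_trans]⟩

lemma piN_shiftN {M N : ℕ} (h : M ≤ N) (U₁ U₂ : UN M) (x : VirtualUnitary) :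
    piN N (shiftN M U₁ U₂ x) = (embLE h U₂)⁻¹ * piN N x * embLE h U₁ := by
  change projLE (le_max_left N M) ((embLE (le_max_right N M) U₂)⁻¹ *
      piN (max N M) x * embLE (le_max_right N M) U₁) = _
  have e : max N M = N := max_eq_left h
  generalize_proofs p q
  revert p q
  rw [e]
  intro p q
  simp

lemma virtualUnitary_ext {x y : VirtualUnitary} (M : ℕ) (h : ∀ N, M ≤ N → piN N x = piN N y) :
    x = y := by
  apply Subtype.ext
  funext N
  change piN N x = piN N y
  rw [← projLE_piN (le_max_left N M), ← projLE_piN (le_max_left N M) y, h _ (le_max_right N M)]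

/-- The right action `(x, g) ↦ x.g` of `G = U(∞) × U(∞)` on `𝔘`. -/
def act (x : VirtualUnitary) (g : Ginf) : VirtualUnitary :=
  DirectLimit.lift₂ (fun _ _ h => embLE h) (fun _ _ h => embLE h) (fun M U₁ U₂ => shiftN M U₁ U₂ x)
    (fun M K h U₁ U₂ => by
      refine virtualUnitary_ext K fun N hN => ?_
      rw [piN_shiftN (h.trans hN), piN_shiftN hN, embLE_trans h hN]
      rfl) g.1 g.2

/-- `π_N(x.g) = U₂⁻¹ π_N(x) U₁` for `g = (U₁, U₂) ∈ G(M)` and all `N ≥ M`. -/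
lemma piN_act {M N : ℕ} (h : M ≤ N) (U₁ U₂ : UN M) (x : VirtualUnitary) :
    piN N (act x (ofUN M U₁, ofUN M U₂)) = (embLE h U₂)⁻¹ * piN N x * embLE h U₁ := by
  rw [← piN_shiftN h]
  congr 1
  exact DirectLimit.lift₂_def (fun _ _ h => embLE h) (fun _ _ h => embLE h) _ _ M U₁ U₂

/-! ### Haar measures -/

instance (N : ℕ) : MeasurableSpace (UN N) := borel _

instance (N : ℕ) : BorelSpace (UN N) := ⟨rfl⟩

lemma isClosedEmbedding_coe (N : ℕ) :
    IsClosedEmbedding (fun U : UN N => (fun i j => U.1 i j : Fin N → Fin N → ℂ)) := by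
  have h : IsClosed (Matrix.unitaryGroup (Fin N) ℂ : Set (Matrix (Fin N) (Fin N) ℂ)) :=
    isClosed_unitary
  exact h.isClosedEmbedding_subtypeVal

instance (N : ℕ) : CompactSpace (UN N) := by
  have h := isClosedEmbedding_coe N
  refine ⟨h.isInducing.isCompact_iff.2 ?_⟩
  rw [Set.image_univ]
  refine Metric.isCompact_of_isClosed_isBounded h.isClosed_range ?_
  refine (Metric.isBounded_iff_subset_closedBall 0).2 ⟨1, ?_⟩
  rintro _ ⟨U, rfl⟩
  rw [mem_closedBall_zero_iff]
  refine (pi_norm_le_iff_of_nonneg zero_le_one).2 fun i => ?_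
  refine (pi_norm_le_iff_of_nonneg zero_le_one).2 fun j => ?_
  exact entry_norm_bound_of_unitary U.2 i j

lemma measurable_to_UN {α : Type*} [MeasurableSpace α] {N : ℕ} {f : α → UN N}
    (h : ∀ i j, Measurable fun a => (f a).1 i j) : Measurable f := by
  have e := (isClosedEmbedding_coe N).measurableEmbedding
  rw [← e.measurable_comp_iff]
  exact measurable_pi_lambda _ fun i => measurable_pi_lambda _ fun j => h i j

lemma measurable_entry {N : ℕ} (i j : Fin N) : Measurable fun U : UN N => U.1 i j := by
  have e := (isClosedEmbedding_coe N).continuous.measurable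
  exact (measurable_pi_apply j).comp ((measurable_pi_apply i).comp e)

lemma measurable_proj (N : ℕ) : Measurable (proj N) := by
  refine measurable_to_UN fun i j => ?_
  have : (fun U : UN (N + 1) => (proj N U).1 i j) = fun U => U.1 i.castSucc j.castSucc -
      U.1 i.castSucc (Fin.last N) * (1 + U.1 (Fin.last N) (Fin.last N))⁻¹ *
        U.1 (Fin.last N) j.castSucc := funext fun U => projMat_apply _ _ _
  rw [this]
  exact (measurable_entry _ _).sub (((measurable_entry _ _).mul
    ((measurable_entry _ _).const_add 1).inv).mul (measurable_entry _ _))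

/-- The normalized Haar measure on `U(N)`. -/
def haarN (N : ℕ) : Measure (UN N) := Measure.haarMeasure ⊤

instance (N : ℕ) : (haarN N).IsHaarMeasure := inferInstanceAs (Measure.haarMeasure ⊤).IsHaarMeasure

instance (N : ℕ) : IsProbabilityMeasure (haarN N) :=
  ⟨by simpa [haarN] using
    Measure.haarMeasure_self (K₀ := (⊤ : TopologicalSpace.PositiveCompacts (UN N)))⟩

/-- The map `ε_{N+1} : U(N+1) → ℂ` sending a matrix to its lower right entry. -/
def eps (N : ℕ) (U : UN (N + 1)) : ℂ := U.1 (Fin.last N) (Fin.last N)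

lemma measurable_eps (N : ℕ) : Measurable (eps N) := measurable_entry _ _

lemma eps_emb_mul {N : ℕ} (V : UN N) (U : UN (N + 1)) : eps N (emb N V * U) = eps N U := by
  change (embMat V.1 * U.1) _ _ = _
  simp [Matrix.mul_apply, Fin.sum_univ_castSucc, eps]

lemma eps_mul_emb {N : ℕ} (V : UN N) (U : UN (N + 1)) : eps N (U * emb N V) = eps N U := by
  change (U.1 * embMat V.1) _ _ = _
  simp [Matrix.mul_apply, Fin.sum_univ_castSucc, eps]

/-- The image `ν_{N+1}` of the Haar measure under `ε_{N+1}`. -/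
def nuN (N : ℕ) : Measure ℂ := (haarN (N + 1)).map (eps N)

lemma map_proj_withDensity (N : ℕ) {g : ℂ → ℝ≥0∞} (hg : Measurable g)
    (h1 : ∫⁻ U, g (eps N U) ∂(haarN (N + 1)) = 1) :
    ((haarN (N + 1)).withDensity (fun U => g (eps N U))).map (proj N) = haarN N := by
  set ρ := ((haarN (N + 1)).withDensity (fun U => g (eps N U))).map (proj N) with hρ
  have hgm : Measurable fun U => g (eps N U) := hg.comp (measurable_eps N)
  have huniv : ρ Set.univ = 1 := by
    rw [hρ, Measure.map_apply (measurable_proj N) MeasurableSet.univ, Set.preimage_univ,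
      withDensity_apply _ MeasurableSet.univ, Measure.restrict_univ, h1]
  have : IsProbabilityMeasure ρ := ⟨huniv⟩
  have : ρ.IsMulLeftInvariant := by
    refine ⟨fun V => ?_⟩
    ext S hS
    rw [Measure.map_apply (measurable_const_mul V) hS, hρ,
      Measure.map_apply (measurable_proj N) hS,
      Measure.map_apply (measurable_proj N) (measurable_const_mul V hS),
      withDensity_apply _ (measurable_proj N hS),
      withDensity_apply _ (measurable_proj N (measurable_const_mul V hS)),
      ← lintegral_indicator (measurable_proj N hS),
      ← lintegral_indicator (measurable_proj N (measurable_const_mul V hS))]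
    conv_rhs => rw [← lintegral_mul_left_eq_self _ (emb N V)]
    refine lintegral_congr fun U => ?_
    have hp : proj N (emb N V * U) = V * proj N U := by
      simpa using proj_mul_emb V 1 U
    by_cases hU : V * proj N U ∈ S
    · rw [Set.indicator_of_mem (by simpa using hU), Set.indicator_of_mem (by simpa [hp] using hU),
        eps_emb_mul]
    · rw [Set.indicator_of_notMem (by simpa using hU),
        Set.indicator_of_notMem (by simpa [hp] using hU)]
  have := Measure.isMulInvariant_eq_smul_of_compactSpace ρ (haarN N)
  have h2 := congrArg (fun m => m Set.univ) this
  simp only [huniv, Measure.smul_apply, measure_univ, ENNReal.smul_def, smul_eq_mul, mul_one] at h2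
  rw [this]
  have h3 : Measure.haarScalarFactor ρ (haarN N) = 1 := by exact_mod_cast h2.symm
  rw [h3, one_smul]

lemma measurePreserving_proj (N : ℕ) : MeasurePreserving (proj N) (haarN (N + 1)) (haarN N) := by
  refine ⟨measurable_proj N, ?_⟩
  have := map_proj_withDensity N (g := fun _ => 1) measurable_const (by simp)
  simpa using this

/-! ### The functions `f_{z,w|N}` and `v_{z,w|N}` -/

/-- The function `f_{z,w|N}(U) = det((1+U)^z (1+U⁻¹)^w) = ∏ (1+u_k)^z (1+ū_k)^w` on the set
`U(N)'` of unitary matrices without eigenvalue `-1` (`u_k` are the eigenvalues with multiplicities,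
the powers are principal), extended by `0`. -/
def fzw (z w : ℂ) (N : ℕ) (U : UN N) : ℂ :=
  if (-1 : ℂ) ∈ U.1.charpoly.roots then 0
  else (U.1.charpoly.roots.map fun u => (1 + u) ^ z * (1 + conj u) ^ w).prod

/-- The function `v_{z,w}(D) = (1+D)^z (1+D̄)^w` on the unit disk, extended by `0` to `D = -1`. -/
def vzw (z w : ℂ) (D : ℂ) : ℂ := if D = -1 then 0 else (1 + D) ^ z * (1 + conj D) ^ w

lemma measurable_vzw (z w : ℂ) : Measurable (vzw z w) := by
  refine Measurable.ite (measurableSet_singleton _) measurable_const ?_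
  have h : Measurable fun D : ℂ => conj D := Complex.continuous_conj.measurable
  exact ((measurable_id.const_add 1).pow_const z).mul ((h.const_add 1).pow_const w)

lemma norm_vzw_le (z w D : ℂ) (hD : D ≠ -1) :
    ‖vzw z w D‖ ≤ Real.exp (Real.pi * |z.im| + Real.pi * |w.im|) * ‖1 + D‖ ^ (z.re + w.re) := by
  have h1 : 1 + D ≠ 0 := fun h => hD (by linear_combination h)
  have h2 : 1 + conj D ≠ 0 := fun h => h1 (by simpa using congrArg conj h)
  have h3 : ‖1 + conj D‖ = ‖1 + D‖ := by
    rw [← Complex.norm_conj]; simp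
  have aux : ∀ x c : ℂ, x ≠ 0 → ‖x ^ c‖ ≤ Real.exp (Real.pi * |c.im|) * ‖x‖ ^ c.re := by
    intro x c hx
    rw [Complex.norm_cpow_of_ne_zero hx, div_eq_mul_inv, ← Real.exp_neg, mul_comm]
    refine mul_le_mul_of_nonneg_right (Real.exp_le_exp.2 ?_) (by positivity)
    calc -(x.arg * c.im) ≤ |x.arg * c.im| := neg_le_abs _
      _ = |x.arg| * |c.im| := abs_mul _ _
      _ ≤ Real.pi * |c.im| := mul_le_mul_of_nonneg_right (Complex.abs_arg_le_pi x) (abs_nonneg _)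
  rw [vzw, if_neg hD, norm_mul, Real.rpow_add (norm_pos_iff.2 h1), Real.exp_add]
  calc _ ≤ _ := mul_le_mul (aux _ z h1) (aux _ w h2) (norm_nonneg _) (by positivity)
    _ = _ := by rw [h3]; ring

/-- The scalar unitary matrix `e^{iθ}`. -/
def rot (N : ℕ) (θ : ℝ) : UN N :=
  ⟨Complex.exp (θ * Complex.I) • 1, by
    rw [Matrix.mem_unitaryGroup_iff, star_smul, star_one, smul_mul_smul_comm, mul_one]
    have : Complex.exp (θ * Complex.I) * star (Complex.exp (θ * Complex.I)) = 1 := by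
      rw [RCLike.star_def, Complex.mul_conj']
      simp [Complex.norm_exp_ofReal_mul_I]
    rw [this, one_smul]⟩

lemma eps_rot_mul {N : ℕ} (θ : ℝ) (U : UN (N + 1)) :
    eps N (rot (N + 1) θ * U) = Complex.exp (θ * Complex.I) * eps N U := by
  change ((Complex.exp (θ * Complex.I) •
    (1 : Matrix (Fin (N + 1)) (Fin (N + 1)) ℂ)) * U.1) _ _ = _
  simp [eps]

lemma intervalIntegrable_sin {a : ℝ} (ha : -1 < a) (ha0 : a ≤ 0) :
    IntervalIntegrable (fun x => |Real.sin x| ^ a) volume 0 Real.pi := by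
  have hpi := Real.pi_pos
  have h1 : IntervalIntegrable (fun x => |Real.sin x| ^ a) volume 0 (Real.pi / 2) := by
    have hb : IntervalIntegrable (fun x : ℝ => (2 / Real.pi) ^ a * x ^ a) volume 0 (Real.pi / 2) :=
      (intervalIntegral.intervalIntegrable_rpow' ha).const_mul _
    refine hb.mono_fun ?_ ?_
    · exact (Real.continuous_sin.measurable.abs.pow_const a).aestronglyMeasurable
    · refine (ae_restrict_iff' measurableSet_uIoc).2 (Eventually.of_forall fun x hx => ?_)
      rw [Set.uIoc_of_le (by positivity)] at hx
      have hs := Real.mul_le_sin hx.1.le hx.2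
      have hp : 0 < 2 / Real.pi * x := mul_pos (by positivity) hx.1
      beta_reduce
      rw [Real.norm_of_nonneg (by positivity),
        Real.norm_of_nonneg (mul_nonneg (by positivity) (Real.rpow_nonneg hx.1.le _)),
        ← Real.mul_rpow (by positivity) hx.1.le]
      exact Real.rpow_le_rpow_of_nonpos hp (hs.trans (le_abs_self _)) ha0
  refine h1.trans ?_
  have h2 := (h1.comp_sub_left Real.pi).symm
  simp only [Real.sin_pi_sub, sub_zero] at h2
  convert h2 using 1
  ring

lemma abs_sin_le_norm (r ψ : ℝ) : |Real.sin ψ| ≤ ‖1 + r * Complex.exp (ψ * Complex.I)‖ := by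
  have h := Complex.sq_norm (1 + r * Complex.exp (ψ * Complex.I))
  rw [Complex.normSq_apply] at h
  simp only [Complex.add_re, Complex.add_im, Complex.mul_re, Complex.mul_im, Complex.ofReal_re,
    Complex.ofReal_im, Complex.exp_ofReal_mul_I_re, Complex.exp_ofReal_mul_I_im, Complex.one_re,
    Complex.one_im] at h
  refine abs_le_of_sq_le_sq ?_ (norm_nonneg _)
  rw [h]
  nlinarith [Real.sin_sq_add_cos_sq ψ, sq_nonneg (r + Real.cos ψ)]

lemma lintegral_rot_le {z w : ℂ} (h : -(1 / 2 : ℝ) < z.re + w.re) (h0 : z.re + w.re < 0) :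
    ∃ C : ℝ≥0∞, C ≠ ∞ ∧ ∀ D : ℂ, ∫⁻ θ in Set.Ioc 0 Real.pi,
      ‖vzw z w (Complex.exp ((θ : ℝ) * Complex.I) * D)‖ₑ ^ 2 ≤ C := by
  set a := 2 * (z.re + w.re) with ha
  set K := Real.exp (Real.pi * |z.im| + Real.pi * |w.im|) with hK
  have hint0 := intervalIntegrable_sin (a := a) (by linarith) (by linarith)
  have hper : Function.Periodic (fun x => |Real.sin x| ^ a) Real.pi := fun x => by
    simp [Real.sin_add_pi]
  have hpi := Real.pi_pos
  refine ⟨ENNReal.ofReal (K ^ 2 * ∫ x in (0 : ℝ)..Real.pi, |Real.sin x| ^ a), ENNReal.ofReal_ne_top,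
    fun D => ?_⟩
  set φ := D.arg with hφ
  have hint : IntervalIntegrable (fun x => |Real.sin (x + φ)| ^ a) volume 0 Real.pi := by
    have := (hper.intervalIntegrable (t := 0) hpi.ne' (by simpa using hint0) φ (φ + Real.pi))
    have := this.comp_add_right φ
    simpa using this
  have heq : ∫ x in (0 : ℝ)..Real.pi, |Real.sin (x + φ)| ^ a =
      ∫ x in (0 : ℝ)..Real.pi, |Real.sin x| ^ a := by
    rw [intervalIntegral.integral_comp_add_right (fun x => |Real.sin x| ^ a) φ]
    have := hper.intervalIntegral_add_eq φ 0
    rw [zero_add] at this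
    rw [zero_add, add_comm, this]
  have hint' : Integrable (fun x => K ^ 2 * |Real.sin (x + φ)| ^ a)
      (volume.restrict (Set.Ioc 0 Real.pi)) :=
    ((intervalIntegrable_iff_integrableOn_Ioc_of_le hpi.le).1 hint).const_mul _
  rw [← heq, ← intervalIntegral.integral_const_mul, intervalIntegral.integral_of_le hpi.le,
    ofReal_integral_eq_lintegral_ofReal hint' (Eventually.of_forall fun x => by positivity)]
  refine lintegral_mono_ae ?_
  have hc : ∀ᵐ x : ℝ, Real.sin (x + φ) ≠ 0 := by
    have hcount : (Set.range fun n : ℤ => (n : ℝ) * Real.pi - φ).Countable := Set.countable_range _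
    filter_upwards [hcount.ae_notMem volume] with x hx hs
    obtain ⟨n, hn⟩ := Real.sin_eq_zero_iff.1 hs
    exact hx ⟨n, by simp only; linarith⟩
  filter_upwards [ae_restrict_of_ae hc] with θ hθ
  have hrot : Complex.exp ((θ : ℝ) * Complex.I) * D =
      (‖D‖ : ℝ) * Complex.exp (((θ + φ : ℝ) : ℂ) * Complex.I) := by
    conv_lhs => rw [← Complex.norm_mul_exp_arg_mul_I D]
    push_cast
    rw [add_mul, Complex.exp_add]
    ring
  have hle := abs_sin_le_norm ‖D‖ (θ + φ)
  rw [← hrot] at hle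
  have hpos : 0 < |Real.sin (θ + φ)| := abs_pos.2 hθ
  have hne : Complex.exp ((θ : ℝ) * Complex.I) * D ≠ -1 := by
    intro hh
    rw [hh] at hle
    simp at hle
    exact hθ hle
  rw [← ofReal_norm, ← ENNReal.ofReal_pow (norm_nonneg _)]
  refine ENNReal.ofReal_le_ofReal ?_
  calc _ ≤ (K * ‖1 + Complex.exp ((θ : ℝ) * Complex.I) * D‖ ^ (z.re + w.re)) ^ 2 :=
        pow_le_pow_left₀ (norm_nonneg _) (norm_vzw_le z w _ hne) 2
    _ = K ^ 2 * ‖1 + Complex.exp ((θ : ℝ) * Complex.I) * D‖ ^ a := by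
        rw [mul_pow, ha, mul_comm (2 : ℝ), Real.rpow_mul (norm_nonneg _)]
        norm_num
    _ ≤ _ := by
        refine mul_le_mul_of_nonneg_left ?_ (by positivity)
        exact Real.rpow_le_rpow_of_nonpos hpos hle (by linarith)

lemma lintegral_vzw_ne_top (N : ℕ) {z w : ℂ} (h : -(1 / 2 : ℝ) < z.re + w.re) :
    ∫⁻ U, ‖vzw z w (eps N U)‖ₑ ^ 2 ∂(haarN (N + 1)) ≠ ∞ := by
  have hm : Measurable fun D => ‖vzw z w D‖ₑ ^ 2 := (measurable_vzw z w).enorm.pow_const 2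
  by_cases h0 : z.re + w.re < 0
  · obtain ⟨C, hC, hle⟩ := lintegral_rot_le h h0
    set I := ∫⁻ U, ‖vzw z w (eps N U)‖ₑ ^ 2 ∂(haarN (N + 1)) with hI
    have h1 : ∫⁻ θ in Set.Ioc 0 Real.pi, (∫⁻ U,
        ‖vzw z w (Complex.exp ((θ : ℝ) * Complex.I) * eps N U)‖ₑ ^ 2 ∂(haarN (N + 1))) =
        I * ENNReal.ofReal Real.pi := by
      have : ∀ θ : ℝ, ∫⁻ U, ‖vzw z w (Complex.exp ((θ : ℝ) * Complex.I) * eps N U)‖ₑ ^ 2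
          ∂(haarN (N + 1)) = I := by
        intro θ
        rw [hI, ← lintegral_mul_left_eq_self (fun U => ‖vzw z w (eps N U)‖ₑ ^ 2) (rot (N + 1) θ)]
        simp only [eps_rot_mul]
      simp [this]
    rw [lintegral_lintegral_swap] at h1
    · have h2 : I * ENNReal.ofReal Real.pi ≤ C := by
        rw [← h1]
        calc _ ≤ ∫⁻ U, C ∂(haarN (N + 1)) := lintegral_mono fun U => hle _
          _ = C := by simp
      intro htop
      rw [htop, ENNReal.top_mul (by simpa using Real.pi_pos)] at h2
      exact hC (top_le_iff.1 h2)
    · refine (hm.comp ?_).aemeasurable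
      refine Measurable.mul ?_ ((measurable_eps N).comp measurable_snd)
      have : Continuous fun θ : ℝ => Complex.exp (θ * Complex.I) := by fun_prop
      exact this.measurable.comp measurable_fst
  · push Not at h0
    set K := Real.exp (Real.pi * |z.im| + Real.pi * |w.im|) with hK
    refine ne_top_of_le_ne_top (b := ENNReal.ofReal ((K * 2 ^ (z.re + w.re)) ^ 2))
      ENNReal.ofReal_ne_top ?_
    calc _ ≤ ∫⁻ U, ENNReal.ofReal ((K * 2 ^ (z.re + w.re)) ^ 2) ∂(haarN (N + 1)) := by
          refine lintegral_mono fun U => ?_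
          rw [← ofReal_norm, ← ENNReal.ofReal_pow (norm_nonneg _)]
          refine ENNReal.ofReal_le_ofReal (pow_le_pow_left₀ (norm_nonneg _) ?_ 2)
          by_cases hD : eps N U = -1
          · rw [vzw, if_pos hD, norm_zero]; positivity
          · refine (norm_vzw_le z w _ hD).trans (mul_le_mul_of_nonneg_left ?_ (by positivity))
            refine Real.rpow_le_rpow (norm_nonneg _) ?_ h0
            have : ‖eps N U‖ ≤ 1 := entry_norm_bound_of_unitary U.2 _ _
            calc _ ≤ ‖(1 : ℂ)‖ + ‖eps N U‖ := norm_add_le _ _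
              _ ≤ 2 := by rw [norm_one]; linarith
      _ = _ := by simp

lemma lintegral_vzw_ne_zero (N : ℕ) (z w : ℂ) :
    ∫⁻ U, ‖vzw z w (eps N U)‖ₑ ^ 2 ∂(haarN (N + 1)) ≠ 0 := by
  have hm : Measurable fun D => ‖vzw z w D‖ₑ ^ 2 := (measurable_vzw z w).enorm.pow_const 2
  intro h
  have h1 := (lintegral_eq_zero_iff (hm.comp (measurable_eps N))).1 h
  have h' := h
  rw [← lintegral_mul_left_eq_self _ (rot (N + 1) Real.pi)] at h'
  have h2 := (lintegral_eq_zero_iff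
    ((hm.comp (measurable_eps N)).comp (measurable_const_mul (rot (N + 1) Real.pi)))).1 h'
  have aux : ∀ D, ‖vzw z w D‖ₑ ^ 2 = 0 → D = -1 := by
    intro D hD
    by_contra hne
    have h1 : 1 + D ≠ 0 := fun h => hne (by linear_combination h)
    have h2 : 1 + conj D ≠ 0 := fun h => h1 (by simpa using congrArg conj h)
    simp [vzw, hne, h1, h2, Complex.cpow_eq_zero_iff] at hD
  obtain ⟨U, hU1, hU2⟩ := (h1.and h2).exists
  have e1 := aux _ hU1
  have e2 := aux _ hU2
  rw [eps_rot_mul, e1, Complex.exp_pi_mul_I] at e2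
  norm_num at e2

/-- The norm of `v_{z,w|N+1}` in `L²(ν_{N+1})`. -/
def vNorm (z w : ℂ) (N : ℕ) : ℝ := (eLpNorm (vzw z w) 2 (nuN N)).toReal

/-- The normalized function `v'_{z,w|N+1} = v_{z,w|N+1} / ‖v_{z,w|N+1}‖`. -/
def vzwNormalized (z w : ℂ) (N : ℕ) (D : ℂ) : ℂ := vzw z w D / vNorm z w N

lemma lintegral_vzwNormalized (N : ℕ) {z w : ℂ} (h : -(1 / 2 : ℝ) < z.re + w.re) :
    ∫⁻ U, ‖vzwNormalized z w N (eps N U)‖ₑ ^ 2 ∂(haarN (N + 1)) = 1 := by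
  have hm : Measurable fun D => ‖vzw z w D‖ₑ ^ 2 := (measurable_vzw z w).enorm.pow_const 2
  set I := ∫⁻ U, ‖vzw z w (eps N U)‖ₑ ^ 2 ∂(haarN (N + 1)) with hI
  have hI0 : I ≠ 0 := lintegral_vzw_ne_zero N z w
  have hIt : I ≠ ∞ := lintegral_vzw_ne_top N h
  have h1 : eLpNorm (vzw z w) 2 (nuN N) = I ^ (1 / 2 : ℝ) := by
    rw [eLpNorm_eq_lintegral_rpow_enorm_toReal two_ne_zero ENNReal.ofNat_ne_top, nuN]
    simp only [ENNReal.toReal_ofNat, ENNReal.rpow_ofNat]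
    rw [lintegral_map hm (measurable_eps N)]
  have h2 : ENNReal.ofReal (vNorm z w N) ^ 2 = I := by
    rw [vNorm, h1, ENNReal.ofReal_toReal (ENNReal.rpow_ne_top_of_nonneg (by norm_num) hIt),
      ← ENNReal.rpow_natCast, ← ENNReal.rpow_mul]
    norm_num
  have h3 : vNorm z w N ≠ 0 := by
    intro h
    rw [h] at h2
    simp at h2
    exact hI0 h2.symm
  have h4 : ∀ D, ‖vzwNormalized z w N D‖ₑ ^ 2 = ‖vzw z w D‖ₑ ^ 2 * I⁻¹ := by
    intro D
    rw [vzwNormalized, div_eq_mul_inv, enorm_mul, mul_pow, enorm_inv (by simpa using h3), ← h2,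
      ENNReal.inv_pow]
    congr 3
    rw [← ofReal_norm, Complex.norm_real,
      Real.norm_of_nonneg (show 0 ≤ vNorm z w N from ENNReal.toReal_nonneg)]
  simp only [h4]
  rw [lintegral_mul_const (f := fun U => ‖vzw z w (eps N U)‖ₑ ^ 2) _ (hm.comp (measurable_eps N))]
  exact ENNReal.mul_inv_cancel hI0 hIt

/-! ### The Hilbert spaces `H_N` and the biregular representations -/

/-- The Hilbert space `H_N = L²(U(N), μ_N)`. -/
abbrev HN (N : ℕ) : Type := Lp ℂ 2 (haarN N)

instance (N : ℕ) : (haarN N).IsMulRightInvariant := by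
  refine ⟨fun g => ?_⟩
  have hp : IsProbabilityMeasure ((haarN N).map (· * g)) :=
    Measure.isProbabilityMeasure_map (measurable_mul_const g).aemeasurable
  have h := Measure.isMulInvariant_eq_smul_of_compactSpace ((haarN N).map (· * g)) (haarN N)
  have h2 := congrArg (fun m => m Set.univ) h
  simp only [Measure.smul_apply, measure_univ, ENNReal.smul_def, smul_eq_mul, mul_one] at h2
  rw [h]
  have h3 : Measure.haarScalarFactor ((haarN N).map (· * g)) (haarN N) = 1 := by
    exact_mod_cast h2.symm
  rw [h3, one_smul]

lemma measurePreserving_biregular {N : ℕ} (g : UN N × UN N) :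
    MeasurePreserving (fun U => g.2⁻¹ * U * g.1) (haarN N) (haarN N) :=
  (measurePreserving_mul_right (haarN N) g.1).comp (measurePreserving_mul_left (haarN N) g.2⁻¹)

/-- The operator `(Reg_N(g) f)(U) = f(U₂⁻¹ U U₁)`, `g = (U₁, U₂)`. -/
def regIsom {N : ℕ} (g : UN N × UN N) : HN N →ₗᵢ[ℂ] HN N :=
  Lp.compMeasurePreservingₗᵢ ℂ (fun U => g.2⁻¹ * U * g.1) (measurePreserving_biregular g)

lemma coeFn_regIsom {N : ℕ} (g : UN N × UN N) (f : HN N) :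
    regIsom g f =ᵐ[haarN N] fun U => f (g.2⁻¹ * U * g.1) :=
  Lp.coeFn_compMeasurePreserving f (measurePreserving_biregular g)

lemma regIsom_mul {N : ℕ} (g h : UN N × UN N) (f : HN N) :
    regIsom (g * h) f = regIsom g (regIsom h f) := by
  refine Lp.ext ?_
  have h1 := (measurePreserving_biregular g).quasiMeasurePreserving.ae (coeFn_regIsom h f)
  filter_upwards [coeFn_regIsom (g * h) f, coeFn_regIsom g (regIsom h f), h1] with U e1 e2 e3
  rw [e1, e2, e3]
  simp [mul_assoc]

lemma regIsom_one {N : ℕ} (f : HN N) : regIsom 1 f = f := by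
  refine Lp.ext ?_
  filter_upwards [coeFn_regIsom 1 f] with U e
  rw [e]
  simp

/-- The biregular representation `Reg_N` of `G(N) = U(N) × U(N)` in `H_N`. -/
def Reg (N : ℕ) : UN N × UN N →* (HN N ≃ₗᵢ[ℂ] HN N) where
  toFun g :=
    { regIsom g with
      invFun := regIsom g⁻¹
      left_inv := fun f => by
        change regIsom g⁻¹ (regIsom g f) = f
        rw [← regIsom_mul, inv_mul_cancel, regIsom_one]
      right_inv := fun f => by
        change regIsom g (regIsom g⁻¹ f) = f
        rw [← regIsom_mul, mul_inv_cancel, regIsom_one] }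
  map_one' := LinearIsometryEquiv.ext fun f => regIsom_one f
  map_mul' g h := LinearIsometryEquiv.ext fun f => regIsom_mul g h f

lemma Reg_mul_apply {N : ℕ} (g h : UN N × UN N) (f : HN N) :
    Reg N (g * h) f = Reg N g (Reg N h f) := regIsom_mul g h f

lemma coeFn_Reg {N : ℕ} (g : UN N × UN N) (f : HN N) :
    Reg N g f =ᵐ[haarN N] fun U => f (g.2⁻¹ * U * g.1) := coeFn_regIsom g f

/-! ### The isometric embeddings `L_{z,w|N+1} : H_N → H_{N+1}` -/

/-- The function `U ↦ f(p_{N+1}(U)) v'_{z,w|N+1}(U_{N+1,N+1})`, that is, `f ⊗ v'_{z,w|N+1}`. -/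
def tensorFun (z w : ℂ) (N : ℕ) (f : UN N → ℂ) (U : UN (N + 1)) : ℂ :=
  f (proj N U) * vzwNormalized z w N (eps N U)

lemma measurable_vzwNormalized (z w : ℂ) (N : ℕ) : Measurable (vzwNormalized z w N) :=
  (measurable_vzw z w).div_const _

lemma tensorFun_ae {z w : ℂ} {N : ℕ} {f g : UN N → ℂ} (h : f =ᵐ[haarN N] g) :
    tensorFun z w N f =ᵐ[haarN (N + 1)] tensorFun z w N g := by
  filter_upwards [(measurePreserving_proj N).quasiMeasurePreserving.ae h] with U hU
  simp [tensorFun, hU]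

lemma eLpNorm_tensorFun {z w : ℂ} (h : -(1 / 2 : ℝ) < z.re + w.re) {N : ℕ} {f : UN N → ℂ}
    (hf : AEStronglyMeasurable f (haarN N)) :
    eLpNorm (tensorFun z w N f) 2 (haarN (N + 1)) = eLpNorm f 2 (haarN N) := by
  obtain ⟨f', hf', he⟩ := hf
  rw [eLpNorm_congr_ae he, eLpNorm_congr_ae (tensorFun_ae he),
    eLpNorm_eq_lintegral_rpow_enorm_toReal two_ne_zero ENNReal.ofNat_ne_top,
    eLpNorm_eq_lintegral_rpow_enorm_toReal two_ne_zero ENNReal.ofNat_ne_top]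
  simp only [ENNReal.toReal_ofNat, ENNReal.rpow_ofNat]
  congr 1
  have hm : Measurable fun D => ‖vzwNormalized z w N D‖ₑ ^ 2 :=
    (measurable_vzwNormalized z w N).enorm.pow_const 2
  have hfm : Measurable fun U => ‖f' U‖ₑ ^ 2 := hf'.measurable.enorm.pow_const 2
  rw [← map_proj_withDensity N hm (lintegral_vzwNormalized N h),
    lintegral_map hfm (measurable_proj N),
    lintegral_withDensity_eq_lintegral_mul _
      (f := fun U => ‖vzwNormalized z w N (eps N U)‖ₑ ^ 2) (hm.comp (measurable_eps N))
      (g := fun U => ‖f' (proj N U)‖ₑ ^ 2) (hfm.comp (measurable_proj N))]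
  refine lintegral_congr fun U => ?_
  simp only [tensorFun, enorm_mul, mul_pow, Pi.mul_apply]
  rw [mul_comm]

lemma memLp_tensorFun {z w : ℂ} (h : -(1 / 2 : ℝ) < z.re + w.re) {N : ℕ} {f : UN N → ℂ}
    (hf : MemLp f 2 (haarN N)) : MemLp (tensorFun z w N f) 2 (haarN (N + 1)) := by
  refine ⟨?_, ?_⟩
  · exact (hf.1.comp_measurePreserving (measurePreserving_proj N)).mul
      ((measurable_vzwNormalized z w N).comp (measurable_eps N)).aestronglyMeasurable
  · rw [eLpNorm_tensorFun h hf.1]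
    exact hf.2

/-- The isometric embedding `L_{z,w|N+1} : H_N → H_{N+1}`, `f ↦ f ⊗ v'_{z,w|N+1}`. -/
def Lemb (z w : ℂ) (h : -(1 / 2 : ℝ) < z.re + w.re) (N : ℕ) : HN N →ₗᵢ[ℂ] HN (N + 1) where
  toFun f := (memLp_tensorFun h (Lp.memLp f)).toLp _
  map_add' f g := by
    rw [← MemLp.toLp_add]
    refine MemLp.toLp_congr _ _ ?_
    refine (tensorFun_ae (Lp.coeFn_add f g)).trans (Eventually.of_forall fun U => ?_)
    simp [tensorFun, add_mul]
  map_smul' c f := by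
    rw [RingHom.id_apply, ← MemLp.toLp_const_smul]
    refine MemLp.toLp_congr _ _ ?_
    refine (tensorFun_ae (Lp.coeFn_smul c f)).trans (Eventually.of_forall fun U => ?_)
    simp [tensorFun, mul_assoc]
  norm_map' f := by
    change ‖(memLp_tensorFun h (Lp.memLp f)).toLp _‖ = ‖f‖
    rw [Lp.norm_toLp, eLpNorm_tensorFun h (Lp.aestronglyMeasurable f), Lp.norm_def]

lemma coeFn_Lemb (z w : ℂ) (h : -(1 / 2 : ℝ) < z.re + w.re) {N : ℕ} (f : HN N) :
    Lemb z w h N f =ᵐ[haarN (N + 1)] tensorFun z w N f := MemLp.coeFn_toLp (memLp_tensorFun h (Lp.memLp f))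

/-- The embeddings commute with the action of `G(N)`. -/
lemma Lemb_Reg (z w : ℂ) (h : -(1 / 2 : ℝ) < z.re + w.re) {N : ℕ} (g : UN N × UN N) (f : HN N) :
    Lemb z w h N (Reg N g f) = Reg (N + 1) (emb N g.1, emb N g.2) (Lemb z w h N f) := by
  refine Lp.ext ?_
  have h1 := (measurePreserving_biregular (emb N g.1, emb N g.2)).quasiMeasurePreserving.ae
    (coeFn_Lemb z w h f)
  filter_upwards [coeFn_Lemb z w h (Reg N g f), tensorFun_ae (z := z) (w := w) (coeFn_Reg g f),
    coeFn_Reg (emb N g.1, emb N g.2) (Lemb z w h N f), h1] with U e1 e2 e3 e4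
  rw [e1, e2, e3, e4]
  simp only [tensorFun, ← map_inv, proj_mul_emb, eps_mul_emb, eps_emb_mul]

lemma ofUN_embLE {N M : ℕ} (h : N ≤ M) (U : UN N) : ofUN M (embLE h U) = ofUN N U :=
  DirectLimit.mk_apply (f := fun _ _ h => embLE h) N M U h

lemma exists_ofUN₂ (g h : Uinf) : ∃ (n : ℕ) (u v : UN n), g = ofUN n u ∧ h = ofUN n v :=
  DirectLimit.exists_eq_mk₂ (fun _ _ h => embLE h) g h

/-! ### Inductive limits of Hilbert spaces and of unitary representations -/

section Colimit

variable {E : ℕ → Type} [∀ n, NormedAddCommGroup (E n)] [∀ n, InnerProductSpace ℂ (E n)]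

/-- The iterated isometry `E n → E m`, `n ≤ m`. -/
def isomLE (L : ∀ n, E n →ₗᵢ[ℂ] E (n + 1)) {n m : ℕ} (h : n ≤ m) : E n →ₗᵢ[ℂ] E m :=
  Nat.leRecOn h (fun {k} f => (L k).comp f) LinearIsometry.id

lemma isomLE_self (L : ∀ n, E n →ₗᵢ[ℂ] E (n + 1)) {n : ℕ} :
    isomLE L (le_refl n) = LinearIsometry.id := Nat.leRecOn_self _

lemma isomLE_succ (L : ∀ n, E n →ₗᵢ[ℂ] E (n + 1)) {n m : ℕ} (h : n ≤ m) :
    isomLE L (Nat.le_succ_of_le h) = (L m).comp (isomLE L h) := Nat.leRecOn_succ h _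

lemma isomLE_trans (L : ∀ n, E n →ₗᵢ[ℂ] E (n + 1)) {n m k : ℕ} (h : n ≤ m) (h' : m ≤ k) (x : E n) :
    isomLE L (h.trans h') x = isomLE L h' (isomLE L h x) := by
  induction k, h' using Nat.le_induction with
  | base => simp [isomLE_self]
  | succ k h' ih =>
    have := isomLE_succ L (h.trans h')
    rw [this, isomLE_succ L h']
    exact congrArg _ ih

instance directedSystem_isomLE (L : ∀ n, E n →ₗᵢ[ℂ] E (n + 1)) :
    DirectedSystem E (fun _ _ h => isomLE L h) where
  map_self _ _ := by simp [isomLE_self]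
  map_map _ _ _ h h' x := (isomLE_trans L h h' x).symm

/-- The algebraic inductive limit (union) of the spaces `E n`. -/
def PreColim (L : ∀ n, E n →ₗᵢ[ℂ] E (n + 1)) : Type := DirectLimit E (fun _ _ h => isomLE L h)

variable (L : ∀ n, E n →ₗᵢ[ℂ] E (n + 1))

/-- The canonical map from `E n` to the algebraic inductive limit. -/
def preIncl (n : ℕ) (x : E n) : PreColim L :=
  (⟦⟨n, x⟩⟧ : DirectLimit E (fun _ _ h => isomLE L h))

instance : AddCommGroup (PreColim L) :=
  inferInstanceAs (AddCommGroup (DirectLimit E (fun _ _ h => isomLE L h)))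

instance : Module ℂ (PreColim L) :=
  inferInstanceAs (Module ℂ (DirectLimit E (fun _ _ h => isomLE L h)))

lemma preIncl_add (n : ℕ) (x y : E n) : preIncl L n (x + y) = preIncl L n x + preIncl L n y :=
  (DirectLimit.add_def (f := fun _ _ h => isomLE L h) n x y).symm

lemma preIncl_smul (n : ℕ) (c : ℂ) (x : E n) : preIncl L n (c • x) = c • preIncl L n x := rfl

lemma preIncl_isomLE {n m : ℕ} (h : n ≤ m) (x : E n) :
    preIncl L m (isomLE L h x) = preIncl L n x :=
  DirectLimit.mk_apply (f := fun _ _ h => isomLE L h) n m x h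

lemma preColim_ind {P : PreColim L → Prop} (h : ∀ n x, P (preIncl L n x)) (x : PreColim L) : P x :=
  DirectLimit.induction (f := fun _ _ h => isomLE L h) h x

lemma preColim_ind₂ {P : PreColim L → PreColim L → Prop}
    (h : ∀ n x y, P (preIncl L n x) (preIncl L n y)) (x y : PreColim L) : P x y :=
  DirectLimit.induction₂ (fun _ _ h => isomLE L h) h x y

lemma preColim_ind₃ {P : PreColim L → PreColim L → PreColim L → Prop}
    (h : ∀ n x y u, P (preIncl L n x) (preIncl L n y) (preIncl L n u)) (x y u : PreColim L) :
    P x y u :=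
  DirectLimit.induction₃ (fun _ _ h => isomLE L h) h x y u

lemma exists_incl₂ (g : Uinf) (x : PreColim L) :
    ∃ (n : ℕ) (u : UN n) (y : E n), g = ofUN n u ∧ x = preIncl L n y := by
  refine Quotient.inductionOn₂ g x ?_
  rintro ⟨n, u⟩ ⟨m, y⟩
  refine ⟨max n m, embLE (le_max_left n m) u, isomLE L (le_max_right n m) y, ?_, ?_⟩
  · exact (DirectLimit.mk_apply (f := fun _ _ h => embLE h) n _ u (le_max_left n m)).symm
  · exact (preIncl_isomLE L (le_max_right n m) y).symm

lemma exists_incl₃ (g : Uinf) (x y : PreColim L) :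
    ∃ (n : ℕ) (u : UN n) (x' y' : E n), g = ofUN n u ∧ x = preIncl L n x' ∧ y = preIncl L n y' := by
  revert x y
  refine preColim_ind₂ L fun m x y => ?_
  refine Quotient.inductionOn g ?_
  rintro ⟨n, u⟩
  refine ⟨max n m, embLE (le_max_left n m) u, isomLE L (le_max_right n m) x,
    isomLE L (le_max_right n m) y, ?_, ?_, ?_⟩
  · exact (DirectLimit.mk_apply (f := fun _ _ h => embLE h) n _ u (le_max_left n m)).symm
  · exact (preIncl_isomLE L (le_max_right n m) x).symm
  · exact (preIncl_isomLE L (le_max_right n m) y).symm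

/-- The inner product on the algebraic inductive limit. -/
def preInner (x y : PreColim L) : ℂ :=
  DirectLimit.lift₂ (fun _ _ h => isomLE L h) (fun _ _ h => isomLE L h)
    (fun _ x y => inner ℂ x y) (fun _ _ h x y => ((isomLE L h).inner_map_map x y).symm) x y

lemma preInner_incl (n : ℕ) (x y : E n) :
    preInner L (preIncl L n x) (preIncl L n y) = inner ℂ x y :=
  DirectLimit.lift₂_def (fun _ _ h => isomLE L h) (fun _ _ h => isomLE L h) _ _ n x y

/-- The inner product space structure of the algebraic inductive limit. -/
@[reducible]
def preColimCore : InnerProductSpace.Core ℂ (PreColim L) where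
  inner := preInner L
  conj_inner_symm := preColim_ind₂ L fun n x y => by
    rw [preInner_incl, preInner_incl]; exact inner_conj_symm x y
  re_inner_nonneg := preColim_ind L fun n x => by
    rw [preInner_incl]; exact inner_self_nonneg
  add_left := preColim_ind₃ L fun n x y u => by
    rw [← preIncl_add, preInner_incl, preInner_incl, preInner_incl]; exact inner_add_left x y u
  smul_left x y c := by
    revert x y
    refine preColim_ind₂ L fun n x y => ?_
    rw [← preIncl_smul, preInner_incl, preInner_incl]; exact inner_smul_left x y c
  definite := preColim_ind L fun n x h => by
    rw [preInner_incl, inner_self_eq_zero] at h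
    rw [h, ← zero_smul ℂ (0 : E n), preIncl_smul, zero_smul]

instance : NormedAddCommGroup (PreColim L) := (preColimCore L).toNormedAddCommGroup

instance : InnerProductSpace ℂ (PreColim L) :=
  InnerProductSpace.ofCore (preColimCore L).toCore

lemma norm_preIncl (n : ℕ) (x : E n) : ‖preIncl L n x‖ = ‖x‖ := by
  rw [@norm_eq_sqrt_re_inner ℂ, @norm_eq_sqrt_re_inner ℂ _ _ _ _ x]
  congr 2
  exact preInner_incl L n x x

/-- The inductive limit Hilbert space: the completion of the algebraic inductive limit. -/
abbrev HilbertColim : Type := UniformSpace.Completion (PreColim L)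

/-- The canonical isometric embedding of `E n` into the inductive limit Hilbert space. -/
def incl (n : ℕ) : E n →ₗᵢ[ℂ] HilbertColim L :=
  (UniformSpace.Completion.toComplₗᵢ (𝕜 := ℂ) (E := PreColim L)).comp
    ({ toFun := preIncl L n
       map_add' := preIncl_add L n
       map_smul' := preIncl_smul L n
       norm_map' := norm_preIncl L n } : E n →ₗᵢ[ℂ] PreColim L)

lemma incl_apply (n : ℕ) (x : E n) : incl L n x = ((preIncl L n x : PreColim L) : HilbertColim L) :=
  rfl

lemma incl_isomLE {n m : ℕ} (h : n ≤ m) (x : E n) : incl L m (isomLE L h x) = incl L n x := by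
  rw [incl_apply, incl_apply, preIncl_isomLE]

lemma incl_L (n : ℕ) (x : E n) : incl L (n + 1) (L n x) = incl L n x := by
  have h : isomLE L (Nat.le_succ_of_le (le_refl n)) x = L n x := by
    rw [isomLE_succ L (le_refl n), isomLE_self]; rfl
  rw [← h]
  exact incl_isomLE L _ x

/-- The union of the images of the spaces `E n` is dense. -/
lemma colim_induction {P : HilbertColim L → Prop} (hP : IsClosed {x | P x})
    (h : ∀ n x, P (incl L n x)) (x : HilbertColim L) : P x :=
  UniformSpace.Completion.induction_on x hP (preColim_ind L h)

variable {L}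
lemma rep_compat (ρ : ∀ n, UN n →* (E n ≃ₗᵢ[ℂ] E n))
    (hρ : ∀ n g x, L n (ρ n g x) = ρ (n + 1) (emb n g) (L n x))
    {n m : ℕ} (h : n ≤ m) (g : UN n) (x : E n) :
    isomLE L h (ρ n g x) = ρ m (embLE h g) (isomLE L h x) := by
  induction m, h using Nat.le_induction with
  | base => simp [isomLE_self]
  | succ m h ih =>
    rw [isomLE_succ L h, embLE_succ h]
    change L m (isomLE L h (ρ n g x)) = ρ (m + 1) (emb m (embLE h g)) (L m (isomLE L h x))
    rw [ih, hρ]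

/-- The action of `U(∞)` on the algebraic inductive limit. -/
def preRep (ρ : ∀ n, UN n →* (E n ≃ₗᵢ[ℂ] E n))
    (hρ : ∀ n g x, L n (ρ n g x) = ρ (n + 1) (emb n g) (L n x))
    (g : Uinf) (x : PreColim L) : PreColim L :=
  DirectLimit.map₂ (fun _ _ h => embLE h) (fun _ _ h => isomLE L h) (fun _ _ h => isomLE L h)
    (fun n g x => ρ n g x) (fun _ _ h g x => rep_compat ρ hρ h g x) g x

lemma preRep_incl (ρ : ∀ n, UN n →* (E n ≃ₗᵢ[ℂ] E n))
    (hρ : ∀ n g x, L n (ρ n g x) = ρ (n + 1) (emb n g) (L n x))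
    (n : ℕ) (g : UN n) (x : E n) :
    preRep ρ hρ (ofUN n g) (preIncl L n x) = preIncl L n (ρ n g x) :=
  DirectLimit.map₂_def (fun _ _ h => embLE h) (fun _ _ h => isomLE L h) (fun _ _ h => isomLE L h)
    (fun n g x => ρ n g x) _ n g x

/-- The action of `U(∞)` on the algebraic inductive limit, as linear equivalences. -/
def preRepEquiv (ρ : ∀ n, UN n →* (E n ≃ₗᵢ[ℂ] E n))
    (hρ : ∀ n g x, L n (ρ n g x) = ρ (n + 1) (emb n g) (L n x)) (g : Uinf) :
    PreColim L ≃ₗ[ℂ] PreColim L :=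
  have key : ∀ (g : Uinf) (x : PreColim L), preRep ρ hρ g⁻¹ (preRep ρ hρ g x) = x := by
    intro g x
    obtain ⟨n, u, x, rfl, rfl⟩ := exists_incl₂ L g x
    rw [← map_inv, preRep_incl, preRep_incl, map_inv]
    exact congrArg _ ((ρ n u).symm_apply_apply x)
  { toFun := preRep ρ hρ g
    map_add' := fun x y => by
      obtain ⟨n, u, x, y, rfl, rfl, rfl⟩ := exists_incl₃ L g x y
      rw [← preIncl_add, preRep_incl, preRep_incl, preRep_incl, map_add, preIncl_add]
    map_smul' := fun c x => by
      obtain ⟨n, u, x, rfl, rfl⟩ := exists_incl₂ L g x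
      rw [← preIncl_smul, preRep_incl, preRep_incl, map_smul, preIncl_smul, RingHom.id_apply]
    invFun := preRep ρ hρ g⁻¹
    left_inv := key g
    right_inv := fun x => by
      have := key g⁻¹ x
      rwa [inv_inv] at this }

lemma norm_preRepEquiv (ρ : ∀ n, UN n →* (E n ≃ₗᵢ[ℂ] E n))
    (hρ : ∀ n g x, L n (ρ n g x) = ρ (n + 1) (emb n g) (L n x))
    (g : Uinf) (x : PreColim L) :
    ‖(UniformSpace.Completion.toComplₗᵢ (𝕜 := ℂ) (E := PreColim L)).toLinearMap
      (preRepEquiv ρ hρ g x)‖ =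
    ‖(UniformSpace.Completion.toComplₗᵢ (𝕜 := ℂ) (E := PreColim L)).toLinearMap x‖ := by
  obtain ⟨n, u, x, rfl, rfl⟩ := exists_incl₂ L g x
  change ‖((preRep ρ hρ (ofUN n u) (preIncl L n x) : PreColim L) : HilbertColim L)‖ =
    ‖((preIncl L n x : PreColim L) : HilbertColim L)‖
  rw [preRep_incl, UniformSpace.Completion.norm_coe, UniformSpace.Completion.norm_coe,
    norm_preIncl, norm_preIncl, LinearIsometryEquiv.norm_map]

/-- The action of an element of `U(∞)` on the inductive limit Hilbert space. -/
def colimOp (ρ : ∀ n, UN n →* (E n ≃ₗᵢ[ℂ] E n))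
    (hρ : ∀ n g x, L n (ρ n g x) = ρ (n + 1) (emb n g) (L n x))
    (g : Uinf) : HilbertColim L ≃ₗᵢ[ℂ] HilbertColim L :=
  (preRepEquiv ρ hρ g).extendOfIsometry
    (UniformSpace.Completion.toComplₗᵢ (𝕜 := ℂ) (E := PreColim L)).toLinearMap
    (UniformSpace.Completion.toComplₗᵢ (𝕜 := ℂ) (E := PreColim L)).toLinearMap
    UniformSpace.Completion.denseRange_coe UniformSpace.Completion.denseRange_coe
    (norm_preRepEquiv ρ hρ g)

lemma colimOp_incl (ρ : ∀ n, UN n →* (E n ≃ₗᵢ[ℂ] E n))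
    (hρ : ∀ n g x, L n (ρ n g x) = ρ (n + 1) (emb n g) (L n x))
    (n : ℕ) (u : UN n) (x : E n) : colimOp ρ hρ (ofUN n u) (incl L n x) = incl L n (ρ n u x) := by
  refine (LinearEquiv.extendOfIsometry_eq _ _ _ _ _ (norm_preRepEquiv ρ hρ (ofUN n u))
    (preIncl L n x)).trans ?_
  exact congrArg (fun y : PreColim L => (y : HilbertColim L)) (preRep_incl ρ hρ n u x)

lemma colimOp_coe (ρ : ∀ n, UN n →* (E n ≃ₗᵢ[ℂ] E n))
    (hρ : ∀ n g x, L n (ρ n g x) = ρ (n + 1) (emb n g) (L n x))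
    (g : Uinf) (x : PreColim L) :
    colimOp ρ hρ g (x : HilbertColim L) = ((preRep ρ hρ g x : PreColim L) : HilbertColim L) :=
  LinearEquiv.extendOfIsometry_eq _ _ _ _ _ (norm_preRepEquiv ρ hρ g) x

/-- The inductive limit of a compatible family of unitary representations of the groups `U(n)`
in the spaces `E n`: a homomorphism from `U(∞)` to the unitary operators in the inductive limit
Hilbert space. -/
def colimRep (ρ : ∀ n, UN n →* (E n ≃ₗᵢ[ℂ] E n))
    (hρ : ∀ n g x, L n (ρ n g x) = ρ (n + 1) (emb n g) (L n x)) :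
    Uinf →* (HilbertColim L ≃ₗᵢ[ℂ] HilbertColim L) where
  toFun := colimOp ρ hρ
  map_one' := by
    refine LinearIsometryEquiv.ext fun x => ?_
    refine colim_induction L (isClosed_eq (LinearIsometryEquiv.continuous _) continuous_id)
      (fun n x => ?_) x
    rw [← map_one (ofUN n), colimOp_incl, map_one]
    rfl
  map_mul' g h := by
    refine LinearIsometryEquiv.ext fun x => ?_
    refine UniformSpace.Completion.induction_on x (isClosed_eq (LinearIsometryEquiv.continuous _)
      (LinearIsometryEquiv.continuous _)) fun x => ?_
    change colimOp ρ hρ (g * h) x = colimOp ρ hρ g (colimOp ρ hρ h x)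
    rw [colimOp_coe, colimOp_coe, colimOp_coe]
    congr 1
    obtain ⟨n, u, x, rfl, rfl⟩ := exists_incl₂ L h x
    obtain ⟨m, v, y, rfl, hy⟩ := exists_incl₂ L g (preIncl L n x)
    rw [← ofUN_embLE (le_max_left n m), ← ofUN_embLE (le_max_right n m), ← map_mul,
      ← preIncl_isomLE L (le_max_left n m), preRep_incl, preRep_incl, preRep_incl, map_mul]
    rfl

end Colimit

/-! ### The representations `T_{z,w}` -/

/-- The space `H = lim H_N` of the representation `T_{z,w}`, the inductive limit being taken with
respect to the embeddings `L_{z,w|N}`. -/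
abbrev Hzw (z w : ℂ) (h : -(1 / 2 : ℝ) < z.re + w.re) : Type := HilbertColim (Lemb z w h)

/-- The unitary representation `T_{z,w} = lim Reg_N` of `G = U(∞) × U(∞)` in `H`. -/
def Tzw (z w : ℂ) (h : -(1 / 2 : ℝ) < z.re + w.re) :
    Ginf →* (Hzw z w h ≃ₗᵢ[ℂ] Hzw z w h) :=
  MonoidHom.noncommCoprod
    (colimRep (L := Lemb z w h) (fun N => (Reg N).comp (MonoidHom.inl (UN N) (UN N)))
      (fun N g f => by simpa using Lemb_Reg z w h (g, 1) f))
    (colimRep (L := Lemb z w h) (fun N => (Reg N).comp (MonoidHom.inr (UN N) (UN N)))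
      (fun N g f => by simpa using Lemb_Reg z w h (1, g) f))
    (fun g₁ g₂ => by
      refine LinearIsometryEquiv.ext fun x => ?_
      refine colim_induction (Lemb z w h) (isClosed_eq (LinearIsometryEquiv.continuous _)
        (LinearIsometryEquiv.continuous _)) (fun n x => ?_) x
      obtain ⟨a, u, v, rfl, rfl⟩ := exists_ofUN₂ g₁ g₂
      rw [← ofUN_embLE (le_max_left a n) u, ← ofUN_embLE (le_max_left a n) v,
        ← incl_isomLE (Lemb z w h) (le_max_right a n) x]
      change colimOp _ _ _ (colimOp _ _ _ _) = colimOp _ _ _ (colimOp _ _ _ _)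
      rw [colimOp_incl, colimOp_incl, colimOp_incl, colimOp_incl]
      simp only [MonoidHom.comp_apply, MonoidHom.inl_apply, MonoidHom.inr_apply, ← Reg_mul_apply]
      simp)

/-- On `H_N ⊂ H`, the operators `T_{z,w}(g)` with `g ∈ G(N)` are given by `Reg_N`. -/
lemma Tzw_incl (z w : ℂ) (h : -(1 / 2 : ℝ) < z.re + w.re) (N : ℕ) (U₁ U₂ : UN N) (f : HN N) :
    Tzw z w h (ofUN N U₁, ofUN N U₂) (incl (Lemb z w h) N f) =
      incl (Lemb z w h) N (Reg N (U₁, U₂) f) := by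
  change colimOp _ _ _ (colimOp _ _ _ _) = _
  rw [colimOp_incl, colimOp_incl]
  simp only [MonoidHom.comp_apply, MonoidHom.inl_apply, MonoidHom.inr_apply, ← Reg_mul_apply]
  simp

/-- The vector `f'_{z,w|N} = f_{z,w|N} / ‖f_{z,w|N}‖` of `H_N` (zero by convention if `f_{z,w|N}`
is not square integrable). -/
def fzwNormalized (z w : ℂ) (N : ℕ) : HN N := by
  classical exact
    if hf : MemLp (fzw z w N) 2 (haarN N) then ((‖hf.toLp _‖⁻¹ : ℝ) : ℂ) • hf.toLp _ else 0

/-- `ξ` is the distinguished vector `ξ_{z,w} = lim f'_{z,w|N}` of `H`: for every `N ≥ 1` the function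
`f_{z,w|N}` is square integrable, and `ξ` is the image of `f'_{z,w|N} ∈ H_N` in `H`. -/
def IsDistinguishedVector (z w : ℂ) (h : -(1 / 2 : ℝ) < z.re + w.re) (ξ : Hzw z w h) : Prop :=
  ∀ N, 1 ≤ N → MemLp (fzw z w N) 2 (haarN N) ∧ ξ = incl (Lemb z w h) N (fzwNormalized z w N)

/-! ### The multiplier and the measures on the space of virtual unitary matrices -/

/-- The projective limit Borel structure on `𝔘`, generated by the projections `π_N`. -/
instance : MeasurableSpace VirtualUnitary :=
  inferInstanceAs (MeasurableSpace {x : ∀ N, UN N // ∀ N, proj N (x (N + 1)) = x N})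

/-- The multiplier `C_{z,w}(x, g)`: the stable value of `f_{z,w|N}(π_N(x.g)) / f_{z,w|N}(π_N(x))`
for large `N` (zero by convention if these ratios do not stabilize). -/
def Czw (z w : ℂ) (x : VirtualUnitary) (g : Ginf) : ℂ := by
  classical exact
    if h : ∃ c : ℂ, ∀ᶠ N in atTop, fzw z w N (piN N (act x g)) / fzw z w N (piN N x) = c
    then h.choose else 0

/-- The constant `∏_{k=1}^N Γ(k) Γ(k+s+s̄) / (Γ(k+s) Γ(k+s̄))`, which is real and positive for
`Re s > -1/2`. -/
def gammaConst (s : ℂ) (N : ℕ) : ℝ :=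
  (∏ k ∈ Finset.Icc 1 N, Complex.Gamma k * Complex.Gamma (k + s + conj s) /
    (Complex.Gamma (k + s) * Complex.Gamma (k + conj s))).re

/-- The measure `μ_N^{(s)}` on `U(N)` with density `gammaConst⁻¹ |det((1+U)^s)|²` with respect to
the normalized Haar measure. -/
def muN (s : ℂ) (N : ℕ) : Measure (UN N) :=
  (haarN N).withDensity fun U => ENNReal.ofReal ((gammaConst s N)⁻¹ * ‖fzw s 0 N U‖ ^ 2)

/-- `μ` is a projective limit of the measures `μ_N^{(s)}`. -/
def IsProjectiveLimitMeasure (s : ℂ) (μ : Measure VirtualUnitary) : Prop :=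
  ∀ N, μ.map (piN N) = muN s N

/-- The measure `μ^{(s)}` on `𝔘`, the projective limit of the measures `μ_N^{(s)}` (zero by
convention if there is no such limit). -/
def muS (s : ℂ) : Measure VirtualUnitary := by
  classical exact
    if h : ∃ μ : Measure VirtualUnitary, IsProjectiveLimitMeasure s μ then h.choose else 0

lemma re_add_re_of_eq {s z w : ℂ} (hs : -(1 / 2 : ℝ) < s.re) (h : z + conj w = s) :
    -(1 / 2 : ℝ) < z.re + w.re := by
  rw [← h] at hs
  simpa using hs

end VirtUnitary

end

open VirtUnitary
open MeasureTheory
open scoped ComplexConjugate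

noncomputable section

namespace VirtUnitary

/-! Everything factors along the projections. If `D` is the corner entry of a unitary `U`, the Schur
complement of the corner of `1 + U` is `1 + p(U)`, so `det(1 + U) = det(1 + p(U)) (1 + D)`. This
survives complex powers: when `-1` is not an eigenvalue, the numerical range of `1 + U` lies in the
open right half-plane, so the logarithm of the determinant can be continued along `1 + tU`, and the
sum over eigenvalues and the sum over iterated Schur complements give the same branch. Hence
`fzw_succ`: `f_{N+1}(U) = f_N(p(U)) v(D)`.

Under Haar measure `p(U)` remains Haar distributed after weighting by a normalized function of `D`,
so the squared norm of `f_N` is a product of mean squares of `(1 + D)^s`. Haar invariance gives the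
moments of `|D|²`; the mean square on `U(N+1)` is then the Gauss series `₂F₁(-s, -s̄; N+1; 1)`. Its
value (`meanSq_eq_gammaFactor`) follows from a contiguous relation in `N` together with the limit
`1` as `N → ∞`. The measures `μ_N^{(s)}` are therefore consistent probability measures; a Markov
chain built from conditional distributions realizes the limit (`exists_measure_of_consistent`), and
cylinder sets determine it.

When `z + w̄ = s`, the density of `μ_N^{(s)}` is `|f'_{z,w|N}|²`. Division by `f'_{z,w|N}` followed
by pullback along `π_N` thus embeds `H_N` isometrically into `L²(𝔘, μ^{(s)})`. The embeddings are
compatible with `L_{z,w|N}`, because `f'_{N+1} = f'_N ⊗ v'`, and they exhaust `L²`, because their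
images contain all indicators of cylinder sets. This identifies `H` with `L²` and sends `ξ_{z,w}` to
`1` (`theta`, `cylIsom_fzwUnit`).

For `g ∈ G(M)` and `N ≥ M` the corner entry of `x_{N+1}` is untouched by `g`, so the ratios defining
`C_{z,w}` are stable from `M` on, and transporting `T_{z,w}` through the identification yields
exactly the multiplier formula (`shiftIsom_cylIsom`, `transportedRep_apply`). The homomorphism
property, unitarity and strong continuity are inherited from `T_{z,w}`. Invariance of `1` under `K`
holds because `f_{z,w|N}` is a class function. -/

/-! ### Accretive matrices and a continuous logarithm of the determinant -/

/-- Matrices whose numerical range lies in the open right half-plane. -/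
def Accretive {n : ℕ} (X : Matrix (Fin n) (Fin n) ℂ) : Prop :=
  ∀ v : Fin n → ℂ, v ≠ 0 → 0 < (star v ⬝ᵥ X *ᵥ v).re

/-- The Schur complement of the lower right entry. -/
def schur {N : ℕ} (X : Matrix (Fin (N + 1)) (Fin (N + 1)) ℂ) : Matrix (Fin N) (Fin N) ℂ :=
  Matrix.of fun i j => X i.castSucc j.castSucc -
    X i.castSucc (Fin.last N) * (X (Fin.last N) (Fin.last N))⁻¹ * X (Fin.last N) j.castSucc

lemma Accretive.last_re_pos {N : ℕ} {X : Matrix (Fin (N + 1)) (Fin (N + 1)) ℂ} (h : Accretive X) :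
    0 < (X (Fin.last N) (Fin.last N)).re := by
  have := h (Pi.single (Fin.last N) 1) (by simp)
  simpa using this

lemma Accretive.last_ne_zero {N : ℕ} {X : Matrix (Fin (N + 1)) (Fin (N + 1)) ℂ}
    (h : Accretive X) : X (Fin.last N) (Fin.last N) ≠ 0 := fun h0 => by
  have := h.last_re_pos
  simp [h0] at this

/-- Append to `v` the last coordinate `y` that makes the last entry of `X u` vanish. The quadratic
form of `X` at the extended vector `u` then equals that of the Schur complement at `v`. -/
lemma Accretive.schur {N : ℕ} {X : Matrix (Fin (N + 1)) (Fin (N + 1)) ℂ} (h : Accretive X) :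
    Accretive (schur X) := by
  intro v hv
  have hd := h.last_ne_zero
  set d := X (Fin.last N) (Fin.last N) with hdd
  set y : ℂ := -(d⁻¹ * ∑ j : Fin N, X (Fin.last N) j.castSucc * v j) with hy
  set u : Fin (N + 1) → ℂ := Fin.snoc (α := fun _ => ℂ) v y with hu
  have hu0 : u ≠ 0 := by
    intro h0
    apply hv
    funext i
    have := congrFun h0 i.castSucc
    simpa [hu] using this
  have hl : (X *ᵥ u) (Fin.last N) = 0 := by
    simp only [Matrix.mulVec, dotProduct, Fin.sum_univ_castSucc, hu, Fin.snoc_castSucc,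
      Fin.snoc_last]
    rw [← hdd, hy]
    field_simp
    ring
  have hc : ∀ i : Fin N, (X *ᵥ u) i.castSucc = (VirtUnitary.schur X *ᵥ v) i := by
    intro i
    simp only [Matrix.mulVec, dotProduct, Fin.sum_univ_castSucc, hu, Fin.snoc_castSucc,
      Fin.snoc_last, VirtUnitary.schur, Matrix.of_apply, sub_mul, Finset.sum_sub_distrib]
    rw [hy, ← hdd, sub_eq_add_neg, mul_neg, Finset.mul_sum, Finset.mul_sum]
    congr 2
    exact Finset.sum_congr rfl fun k _ => by ring
  have := h u hu0
  rw [dotProduct, Fin.sum_univ_castSucc, hl, mul_zero, add_zero] at this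
  simp only [hc, Pi.star_apply] at this
  simpa only [hu, Fin.snoc_castSucc, dotProduct, Pi.star_apply] using this

lemma det_eq_mul_det_schur {N : ℕ} (X : Matrix (Fin (N + 1)) (Fin (N + 1)) ℂ)
    (h : X (Fin.last N) (Fin.last N) ≠ 0) :
    X.det = X (Fin.last N) (Fin.last N) * (schur X).det := by
  set e := (finSumFinEquiv : Fin N ⊕ Fin 1 ≃ Fin (N + 1))
  set D : Matrix (Fin 1) (Fin 1) ℂ := Matrix.of fun _ _ => X (Fin.last N) (Fin.last N) with hD
  set A : Matrix (Fin N) (Fin N) ℂ := Matrix.of fun i j => X i.castSucc j.castSucc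
  set B : Matrix (Fin N) (Fin 1) ℂ := Matrix.of fun i _ => X i.castSucc (Fin.last N)
  set C : Matrix (Fin 1) (Fin N) ℂ := Matrix.of fun _ j => X (Fin.last N) j.castSucc
  let _ : Invertible D := ⟨Matrix.of fun _ _ => (X (Fin.last N) (Fin.last N))⁻¹,
    by ext i j; simp [hD, Matrix.mul_apply, h, Matrix.one_apply, Subsingleton.elim i j],
    by ext i j; simp [hD, Matrix.mul_apply, h, Matrix.one_apply, Subsingleton.elim i j]⟩
  have h1 : X.submatrix e e = Matrix.fromBlocks A B C D := by
    ext i j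
    rcases i with i | i <;> rcases j with j | j <;> (try rw [Subsingleton.elim i 0]) <;>
      (try rw [Subsingleton.elim j 0]) <;> rfl
  rw [← Matrix.det_submatrix_equiv_self e X, h1, Matrix.det_fromBlocks₂₂]
  congr 1
  · simp [hD]
  · congr 1
    ext i j
    change A i j - (B * (Matrix.of fun _ _ => (X (Fin.last N) (Fin.last N))⁻¹ : Matrix (Fin 1) (Fin 1) ℂ) * C) i j = _
    simp [A, B, C, Matrix.mul_apply, schur]

lemma Accretive.one (n : ℕ) : Accretive (1 : Matrix (Fin n) (Fin n) ℂ) := by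
  intro v hv
  rw [Matrix.one_mulVec]
  open scoped ComplexOrder in
  exact (Complex.pos_iff.1 (Matrix.dotProduct_star_self_pos_iff.2 hv)).1

/-- `1 + tU` is the convex combination `(1 - t) · 1 + t (1 + U)` of accretive matrices. It supplies
the path for the continuation arguments. -/
lemma Accretive.one_add_smul {n : ℕ} {U : Matrix (Fin n) (Fin n) ℂ} (h : Accretive (1 + U))
    {t : ℝ} (h0 : 0 ≤ t) (h1 : t ≤ 1) : Accretive (1 + (t : ℂ) • U) := by
  intro v hv
  have e1 := h v hv
  have e2 := Accretive.one n v hv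
  simp only [Matrix.add_mulVec, Matrix.one_mulVec, dotProduct_add, Complex.add_re,
    Matrix.smul_mulVec, dotProduct_smul, smul_eq_mul, Complex.re_ofReal_mul] at *
  rcases h0.eq_or_lt with rfl | h0
  · simpa using e2
  · nlinarith [mul_pos h0 e1, mul_nonneg (sub_nonneg.2 h1) e2.le]

/-- A unitary matrix `U` without eigenvalue `-1` has `1 + U` accretive. -/
lemma accretive_one_add_of_det_ne_zero {n : ℕ} (U : UN n) (h : (1 + U.1).det ≠ 0) :
    Accretive (1 + U.1) := by
  intro v hv
  set X := 1 + U.1 with hX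
  have hw : X *ᵥ v ≠ 0 := fun h0 => h (Matrix.exists_mulVec_eq_zero_iff.1 ⟨v, hv, h0⟩)
  -- Unitarity turns `X*X` into `X + X*`, so `2 Re ⟨v, Xv⟩ = ‖Xv‖²`, which is positive because `X`
  -- is injective.
  have h1 : Xᴴ * X = X + Xᴴ := by
    have := Matrix.mem_unitaryGroup_iff'.1 U.2
    rw [Matrix.star_eq_conjTranspose] at this
    rw [hX, Matrix.conjTranspose_add, Matrix.conjTranspose_one, add_mul, mul_add, mul_add, this,
      one_mul, one_mul, mul_one]
    abel
  have h2 : star (X *ᵥ v) ⬝ᵥ (X *ᵥ v) = star v ⬝ᵥ X *ᵥ v + star (star v ⬝ᵥ X *ᵥ v) := by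
    rw [Matrix.star_mulVec, ← Matrix.dotProduct_mulVec, Matrix.mulVec_mulVec, h1,
      Matrix.add_mulVec, dotProduct_add, Matrix.star_dotProduct, star_star,
      Matrix.star_mulVec, ← Matrix.dotProduct_mulVec]
  have h3 : 0 < (star (X *ᵥ v) ⬝ᵥ (X *ᵥ v)).re := by
    open scoped ComplexOrder in
    exact (Complex.pos_iff.1 (Matrix.dotProduct_star_self_pos_iff.2 hw)).1
  rw [h2] at h3
  simp only [Complex.add_re, RCLike.star_def, Complex.conj_re] at h3
  linarith

/-- The logarithm of the determinant, defined through iterated Schur complements. -/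
def logDet : (N : ℕ) → Matrix (Fin N) (Fin N) ℂ → ℂ
  | 0, _ => 0
  | N + 1, X => logDet N (schur X) + Complex.log (X (Fin.last N) (Fin.last N))

lemma exp_logDet {N : ℕ} {X : Matrix (Fin N) (Fin N) ℂ} (h : Accretive X) :
    Complex.exp (logDet N X) = X.det := by
  induction N with
  | zero => simp [logDet]
  | succ N ih =>
    rw [logDet, Complex.exp_add, ih h.schur, Complex.exp_log h.last_ne_zero,
      det_eq_mul_det_schur X h.last_ne_zero, mul_comm]

/-- Accretivity keeps every corner entry met in the recursion in the right half-plane, where the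
principal logarithm is continuous. -/
lemma continuousOn_logDet {N : ℕ} {γ : ℝ → Matrix (Fin N) (Fin N) ℂ} {s : Set ℝ}
    (hγ : ∀ i j, ContinuousOn (fun t => γ t i j) s) (h : ∀ t ∈ s, Accretive (γ t)) :
    ContinuousOn (fun t => logDet N (γ t)) s := by
  induction N with
  | zero => exact continuousOn_const
  | succ N ih =>
    refine ContinuousOn.add (ih (γ := fun t => schur (γ t)) (fun i j => ?_)
      fun t ht => (h t ht).schur) ?_
    · exact (hγ _ _).sub (((hγ _ _).mul ((hγ _ _).inv₀ fun t ht => (h t ht).last_ne_zero)).mul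
        (hγ _ _))
    · exact (hγ _ _).clog fun t ht => Or.inl (h t ht).last_re_pos

lemma logDet_one (N : ℕ) : logDet N 1 = 0 := by
  induction N with
  | zero => rfl
  | succ N ih =>
    have : schur (1 : Matrix (Fin (N + 1)) (Fin (N + 1)) ℂ) = 1 := by
      ext i j
      simp [schur, Matrix.one_apply]
    rw [logDet, this, ih]
    simp

/-! ### Eigenvalues and the logarithm of the determinant -/

lemma det_one_add_smul_eq_prod_roots {n : ℕ} (A : Matrix (Fin n) (Fin n) ℂ) (t : ℂ) :
    (1 + t • A).det = (A.charpoly.roots.map fun u => 1 + t * u).prod := by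
  have hs := IsAlgClosed.splits A.charpoly
  by_cases ht : t = 0
  · simp [ht]
  -- For `t ≠ 0` the determinant is the characteristic polynomial at `-1/t`, up to the factor
  -- `(-t)^n`.
  have h1 : (1 + t • A) = (-t) • (Matrix.scalar (Fin n) (-t⁻¹) - A) := by
    ext i j
    simp only [Matrix.add_apply, Matrix.smul_apply, Matrix.sub_apply, Matrix.scalar_apply,
      Matrix.diagonal_apply, Matrix.one_apply, smul_eq_mul]
    split_ifs
    · field_simp
      ring
    · ring
  rw [h1, Matrix.det_smul, ← Matrix.eval_charpoly,
    hs.eval_eq_prod_roots_of_monic (Matrix.charpoly_monic A)]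
  have hcard : Multiset.card A.charpoly.roots = Fintype.card (Fin n) := by
    rw [← hs.natDegree_eq_card_roots, Matrix.charpoly_natDegree_eq_dim]
  rw [← hcard, ← Multiset.prod_replicate, ← Multiset.map_const', ← Multiset.prod_map_mul]
  congr 1
  refine Multiset.map_congr rfl fun u _ => ?_
  field_simp
  ring

lemma det_one_add_eq_prod_roots {n : ℕ} (A : Matrix (Fin n) (Fin n) ℂ) :
    (1 + A).det = (A.charpoly.roots.map fun u => 1 + u).prod := by
  simpa using det_one_add_smul_eq_prod_roots A 1

lemma neg_one_mem_roots_iff {n : ℕ} (A : Matrix (Fin n) (Fin n) ℂ) :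
    (-1 : ℂ) ∈ A.charpoly.roots ↔ (1 + A).det = 0 := by
  rw [det_one_add_eq_prod_roots, Multiset.prod_eq_zero_iff, Multiset.mem_map]
  constructor
  · exact fun h => ⟨-1, h, by ring⟩
  · rintro ⟨u, hu, h⟩
    rwa [← (show u = -1 by linear_combination h)]

/-- An eigenvector for `u` tests the accretivity of `1 + A`: the form there equals `(1 + u)‖v‖²`. -/
lemma Accretive.re_one_add_root_pos {n : ℕ} {A : Matrix (Fin n) (Fin n) ℂ}
    (h : Accretive (1 + A)) {u : ℂ} (hu : u ∈ A.charpoly.roots) : 0 < (1 + u).re := by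
  have h1 := Polynomial.isRoot_of_mem_roots hu
  rw [Polynomial.IsRoot, Matrix.eval_charpoly] at h1
  obtain ⟨v, hv, hv0⟩ := Matrix.exists_mulVec_eq_zero_iff.2 h1
  have h2 : A *ᵥ v = u • v := by
    rw [Matrix.sub_mulVec, sub_eq_zero] at hv0
    rw [← hv0]
    ext i
    simp [Matrix.scalar_apply, Matrix.mulVec_diagonal]
  have h3 := h v hv
  have h4 := Accretive.one n v hv
  open scoped ComplexOrder in
  have h5 := (Complex.pos_iff.1 (Matrix.dotProduct_star_self_pos_iff.2 hv)).2
  rw [Matrix.add_mulVec, h2, Matrix.one_mulVec, dotProduct_add, dotProduct_smul, smul_eq_mul] at h3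
  rw [Matrix.one_mulVec] at h4
  rw [Complex.add_re, Complex.mul_re, ← h5, mul_zero, sub_zero] at h3
  rw [Complex.add_re, Complex.one_re]
  by_contra hle
  push Not at hle
  nlinarith

lemma continuousOn_multiset_sum_map {s : Set ℝ} (m : Multiset ℂ) {F : ℂ → ℝ → ℂ}
    (h : ∀ u ∈ m, ContinuousOn (F u) s) : ContinuousOn (fun t => (m.map fun u => F u t).sum) s := by
  induction m using Multiset.induction_on with
  | empty => simpa using continuousOn_const
  | cons a m ih =>
    simp only [Multiset.map_cons, Multiset.sum_cons]
    exact (h a (by simp)).add (ih fun u hu => h u (by simp [hu]))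

/-- Two continuous logarithms on `[0,1]` which agree at `0` agree at `1`. -/
lemma eq_of_exp_eq_on_unitInterval {f g : ℝ → ℂ} (hf : ContinuousOn f (Set.Icc 0 1))
    (hg : ContinuousOn g (Set.Icc 0 1))
    (h : ∀ t ∈ Set.Icc (0 : ℝ) 1, Complex.exp (f t) = Complex.exp (g t)) (h0 : f 0 = g 0) :
    f 1 = g 1 := by
  -- `φ` is the winding difference of the two logarithms: continuous and integer valued on the
  -- interval, hence constant.
  set φ : ℝ → ℝ := fun t => ((f t - g t) / (2 * Real.pi * Complex.I)).re with hφ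
  have hpi : (2 * Real.pi * Complex.I : ℂ) ≠ 0 := Complex.two_pi_I_ne_zero
  have hint : ∀ t ∈ Set.Icc (0 : ℝ) 1, ∃ n : ℤ, f t = g t + n * (2 * Real.pi * Complex.I) :=
    fun t ht => Complex.exp_eq_exp_iff_exists_int.1 (h t ht)
  have hval : ∀ t (n : ℤ), f t = g t + n * (2 * Real.pi * Complex.I) → φ t = n := by
    intro t n hn
    simp only [hφ]
    rw [hn, add_sub_cancel_left, mul_div_cancel_right₀ _ hpi]
    simp
  have hφc : ContinuousOn φ (Set.Icc 0 1) :=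
    Complex.continuous_re.comp_continuousOn ((hf.sub hg).div_const _)
  have hmaps : Set.MapsTo φ (Set.Icc 0 1) (Set.range ((↑) : ℤ → ℝ)) := by
    intro t ht
    obtain ⟨n, hn⟩ := hint t ht
    exact ⟨n, (hval t n hn).symm⟩
  have hdisc : IsDiscrete (Set.range ((↑) : ℤ → ℝ)) := by
    have := Int.isClosedEmbedding_coe_real.isEmbedding.toHomeomorph.symm
    exact ⟨this.isEmbedding.discreteTopology⟩
  have hconst := isPreconnected_Icc.constant_of_mapsTo hdisc hφc hmaps
    (x := 0) (y := 1) (by simp) (by simp)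
  obtain ⟨n, hn⟩ := hint 1 (by simp)
  have h1 := hval 1 n hn
  have h2 := hval 0 0 (by simp [h0])
  rw [← hconst, h2] at h1
  have : n = 0 := by exact_mod_cast h1.symm
  simpa [this] using hn

/-- The sum of the principal logarithms of `1 + u` over the eigenvalues `u` of `A`. -/
lemma sum_log_one_add_roots {n : ℕ} {A : Matrix (Fin n) (Fin n) ℂ} (h : Accretive (1 + A)) :
    (A.charpoly.roots.map fun u => Complex.log (1 + u)).sum = logDet n (1 + A) := by
  have hre : ∀ t ∈ Set.Icc (0 : ℝ) 1, ∀ u ∈ A.charpoly.roots, 0 < (1 + (t : ℂ) * u).re := by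
    intro t ht u hu
    have := h.re_one_add_root_pos hu
    simp only [Complex.add_re, Complex.one_re, Complex.re_ofReal_mul] at *
    rcases ht.1.eq_or_lt with h0 | h0
    · simp [← h0]
    · nlinarith [mul_pos h0 this, ht.2]
  -- Both sides are continued along `1 + tA`. They are logarithms of the same determinant and vanish
  -- at `t = 0`.
  have key := eq_of_exp_eq_on_unitInterval
    (f := fun t => (A.charpoly.roots.map fun u => Complex.log (1 + (t : ℂ) * u)).sum)
    (g := fun t => logDet n (1 + (t : ℂ) • A)) ?_ ?_ ?_ ?_
  · simpa using key
  · refine continuousOn_multiset_sum_map _ fun u hu => ContinuousOn.clog ?_ ?_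
    · fun_prop
    · exact fun t ht => Or.inl (hre t ht u hu)
  · refine continuousOn_logDet (fun i j => ?_) fun t ht => h.one_add_smul ht.1 ht.2
    simp only [Matrix.add_apply, Matrix.smul_apply, smul_eq_mul]
    fun_prop
  · intro t ht
    rw [exp_logDet (h.one_add_smul ht.1 ht.2), det_one_add_smul_eq_prod_roots,
      Complex.exp_multiset_sum, Multiset.map_map]
    congr 1
    refine Multiset.map_congr rfl fun u hu => ?_
    refine Complex.exp_log fun h0 => ?_
    have := hre t ht u hu
    simp [h0] at this
  · simp [logDet_one]

/-! ### Multiplicativity of `f_{z,w|N}` along the projections -/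

/-- The right half-plane avoids the branch cut, so the principal logarithm commutes with
conjugation. -/
lemma cpow_mul_conj_cpow {x : ℂ} (hx : 0 < x.re) (z w : ℂ) :
    x ^ z * (conj x) ^ w = Complex.exp (z * Complex.log x + w * conj (Complex.log x)) := by
  have h0 : x ≠ 0 := fun h => by simp [h] at hx
  have harg : x.arg ≠ Real.pi := fun h => by
    have := Complex.arg_eq_pi_iff.1 h
    linarith [this.1]
  rw [Complex.cpow_def_of_ne_zero h0, Complex.cpow_def_of_ne_zero (by simpa using h0),
    Complex.log_conj _ harg, ← Complex.exp_add, mul_comm z, mul_comm w]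

/-- Replaces the product over eigenvalues by an expression in `logDet` alone, which, unlike the
spectrum, behaves well under the projection. -/
lemma fzw_eq_exp (z w : ℂ) {N : ℕ} (U : UN N) (h : (1 + U.1).det ≠ 0) :
    fzw z w N U = Complex.exp (z * logDet N (1 + U.1) + w * conj (logDet N (1 + U.1))) := by
  have hacc := accretive_one_add_of_det_ne_zero U h
  rw [fzw, if_neg (fun hm => h ((neg_one_mem_roots_iff _).1 hm)), ← sum_log_one_add_roots hacc]
  have : ∀ u ∈ U.1.charpoly.roots, (1 + u) ^ z * (1 + conj u) ^ w =
      Complex.exp (z * Complex.log (1 + u) + w * conj (Complex.log (1 + u))) := by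
    intro u hu
    rw [← cpow_mul_conj_cpow (hacc.re_one_add_root_pos hu)]
    simp
  rw [Multiset.map_congr rfl this, ← Function.comp_def Complex.exp
      (fun x => z * Complex.log (1 + x) + w * conj (Complex.log (1 + x))),
    ← Multiset.map_map Complex.exp, ← Complex.exp_multiset_sum, Multiset.sum_map_add, Multiset.sum_map_mul_left, Multiset.sum_map_mul_left]
  congr 3
  rw [map_multiset_sum, Multiset.map_map]
  rfl

lemma fzw_eq_zero_of_det (z w : ℂ) {N : ℕ} (U : UN N) (h : (1 + U.1).det = 0) :
    fzw z w N U = 0 := by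
  rw [fzw, if_pos ((neg_one_mem_roots_iff _).2 h)]

/-- This explains the formula for `p`: the projection is the Schur complement of the corner, shifted
by the identity. The case `D = -1` fits because the inverse of `0` is `0`. -/
lemma schur_one_add {N : ℕ} (U : UN (N + 1)) : schur (1 + U.1) = 1 + (proj N U).1 := by
  ext i j
  have : (proj N U).1 i j = _ := projMat_apply U.1 i j
  rw [Matrix.add_apply, this]
  simp only [schur, Matrix.of_apply, Matrix.add_apply, Matrix.one_apply,
    (Fin.castSucc_lt_last i).ne, (Fin.castSucc_lt_last j).ne', Fin.castSucc_inj, if_true, if_false,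
    zero_add]
  ring

lemma one_add_apply_last {N : ℕ} (U : UN (N + 1)) :
    (1 + U.1 : Matrix _ _ ℂ) (Fin.last N) (Fin.last N) = 1 + eps N U := by
  simp [eps]

lemma norm_eps_le (N : ℕ) (U : UN (N + 1)) : ‖eps N U‖ ≤ 1 := entry_norm_bound_of_unitary U.2 _ _

lemma re_one_add_pos {D : ℂ} (h : ‖D‖ ≤ 1) (hD : D ≠ -1) : 0 < (1 + D).re := by
  rw [Complex.add_re, Complex.one_re]
  have h1 := Complex.abs_re_le_norm D
  have h2 := Complex.sq_norm D
  rw [Complex.normSq_apply] at h2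
  by_contra hle
  push Not at hle
  have hre : D.re = -1 := le_antisymm (by linarith) (by linarith [neg_abs_le D.re])
  have him : D.im = 0 := by
    rw [hre] at h2
    have : D.im * D.im ≤ 0 := by nlinarith [norm_nonneg D]
    nlinarith [mul_self_nonneg D.im]
  exact hD (Complex.ext (by simp [hre]) (by simp [him]))

/-- If `1 + U` were invertible it would be accretive, and its corner entry `1 + D` could not vanish.
-/
lemma det_one_add_of_eps {N : ℕ} (U : UN (N + 1)) (h : eps N U = -1) : (1 + U.1).det = 0 := by
  by_contra h0
  have := (accretive_one_add_of_det_ne_zero U h0).last_ne_zero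
  rw [one_add_apply_last, h] at this
  simp at this

lemma vzw_eq_zero_iff (z w D : ℂ) : vzw z w D = 0 ↔ D = -1 := by
  refine ⟨fun h => ?_, fun h => by simp [vzw, h]⟩
  by_contra hne
  have h1 : 1 + D ≠ 0 := fun h => hne (by linear_combination h)
  have h2 : 1 + conj D ≠ 0 := fun h => h1 (by simpa using congrArg conj h)
  simp [vzw, hne, h1, h2, Complex.cpow_eq_zero_iff] at h

/-- `logDet` splits off the logarithm of the corner entry by definition. In the degenerate cases,
where `D = -1` or `-1` is an eigenvalue of `p(U)`, both sides are zero. -/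
lemma fzw_succ (z w : ℂ) {N : ℕ} (U : UN (N + 1)) :
    fzw z w (N + 1) U = fzw z w N (proj N U) * vzw z w (eps N U) := by
  by_cases hD : eps N U = -1
  · rw [fzw_eq_zero_of_det z w U (det_one_add_of_eps U hD), (vzw_eq_zero_iff z w _).2 hD, mul_zero]
  have hD' : 1 + eps N U ≠ 0 := fun h => hD (by linear_combination h)
  have hdet := det_eq_mul_det_schur (1 + U.1) (by rwa [one_add_apply_last])
  rw [schur_one_add, one_add_apply_last] at hdet
  by_cases h : (1 + (proj N U).1).det = 0
  · rw [fzw_eq_zero_of_det z w U (by rw [hdet, h, mul_zero]), fzw_eq_zero_of_det z w _ h, zero_mul]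
  · rw [fzw_eq_exp z w U (by rw [hdet]; exact mul_ne_zero hD' h), fzw_eq_exp z w _ h, vzw, if_neg hD,
      logDet, schur_one_add, one_add_apply_last]
    have := cpow_mul_conj_cpow (re_one_add_pos (norm_eps_le N U) hD) z w
    rw [map_add, map_one] at this
    rw [this, ← Complex.exp_add, map_add]
    congr 1
    ring

lemma fzw_zero (z w : ℂ) (U : UN 0) : fzw z w 0 U = 1 := by
  simp [fzw]

lemma measurable_fzw (z w : ℂ) (N : ℕ) : Measurable (fzw z w N) := by
  induction N with
  | zero => simpa only [funext (fzw_zero z w)] using measurable_const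
  | succ N ih =>
    rw [funext (fzw_succ z w (N := N))]
    exact (ih.comp (measurable_proj N)).mul ((measurable_vzw z w).comp (measurable_eps N))

/-- With `ℓ = log(1 + D)`, the real part of `zℓ + w ℓ̄` equals that of `(z + w̄)ℓ`. This is why only
`s = z + w̄` enters the measures. -/
lemma norm_vzw_eq (z w : ℂ) {D : ℂ} (h : ‖D‖ ≤ 1) :
    ‖vzw z w D‖ = ‖vzw (z + conj w) 0 D‖ := by
  by_cases hD : D = -1
  · simp [vzw, hD]
  have h1 := re_one_add_pos h hD
  have h2 := cpow_mul_conj_cpow h1 z w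
  have h3 := cpow_mul_conj_cpow h1 (z + conj w) 0
  rw [map_add, map_one] at h2 h3
  rw [vzw, if_neg hD, vzw, if_neg hD, h2, h3, Complex.norm_exp, Complex.norm_exp]
  congr 1
  simp only [Complex.add_re, Complex.mul_re, Complex.conj_re, Complex.conj_im, Complex.add_im,
    Complex.zero_re, Complex.zero_im]
  ring

lemma norm_fzw_eq (z w : ℂ) {N : ℕ} (U : UN N) :
    ‖fzw z w N U‖ = ‖fzw (z + conj w) 0 N U‖ := by
  induction N with
  | zero => simp [fzw_zero]
  | succ N ih =>
    rw [fzw_succ, fzw_succ, norm_mul, norm_mul, ih, norm_vzw_eq z w (norm_eps_le N U)]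

lemma fzw_conj (z w : ℂ) {N : ℕ} (U V : UN N) : fzw z w N (V⁻¹ * U * V) = fzw z w N U := by
  have : (V⁻¹ * U * V).1.charpoly = U.1.charpoly := by
    change ((V⁻¹).1 * U.1 * V.1).charpoly = _
    rw [Matrix.charpoly_mul_comm, ← mul_assoc]
    have h : V.1 * (V⁻¹).1 = 1 := congrArg Subtype.val (mul_inv_cancel V)
    rw [h, one_mul]
  rw [fzw, fzw, this]

/-! ### Moments of a matrix entry under the Haar measure -/

/-- The entry `U_{ij}` as a function on the unitary group. -/
def entry {n : ℕ} (i j : Fin n) (U : UN n) : ℂ := U.1 i j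

@[fun_prop]
lemma continuous_entry {N : ℕ} (i j : Fin N) : Continuous (entry i j : UN N → ℂ) :=
  (continuous_apply j).comp ((continuous_apply i).comp (isClosedEmbedding_coe N).continuous)

lemma eps_eq_entry (N : ℕ) (U : UN (N + 1)) : eps N U = entry (Fin.last N) (Fin.last N) U := rfl

/-- The rotation by the angle `θ` in the coordinate plane `(p, q)`. -/
def planeRot {n : ℕ} {p q : Fin n} (h : p ≠ q) (θ : ℝ) : UN n :=
  ⟨1 + (Real.sin θ : ℂ) • (Matrix.single p q 1 - Matrix.single q p 1) +
      ((Real.cos θ : ℂ) - 1) • (Matrix.single p p 1 + Matrix.single q q 1), by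
    rw [Matrix.mem_unitaryGroup_iff]
    set K : Matrix (Fin n) (Fin n) ℂ := Matrix.single p q 1 - Matrix.single q p 1 with hK
    set P : Matrix (Fin n) (Fin n) ℂ := Matrix.single p p 1 + Matrix.single q q 1 with hP
    have hKs : star K = -K := by
      simp [hK, Matrix.star_eq_conjTranspose]
    have hPs : star P = P := by
      simp [hP, Matrix.star_eq_conjTranspose]
    have hKK : K * K = -P := by
      simp [hK, hP, mul_sub, sub_mul, Matrix.single_mul_single_of_ne, h, h.symm]
      abel
    have hKP : K * P = K := by
      simp [hK, hP, mul_add, sub_mul, Matrix.single_mul_single_of_ne, h, h.symm]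
      try abel
    have hPK : P * K = K := by
      simp [hK, hP, add_mul, mul_sub, Matrix.single_mul_single_of_ne, h, h.symm]
      try abel
    have hPP : P * P = P := by
      simp [hP, mul_add, add_mul, Matrix.single_mul_single_of_ne, h, h.symm]
    have hsc : ((Real.sin θ : ℂ)) ^ 2 + (Real.cos θ : ℂ) ^ 2 = 1 := by
      exact_mod_cast Real.sin_sq_add_cos_sq θ
    set s : ℂ := (Real.sin θ : ℂ) with hs
    set c : ℂ := (Real.cos θ : ℂ) with hc
    have hss : star s = s := Complex.conj_ofReal _
    have hcs : star c = c := Complex.conj_ofReal _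
    simp only [star_add, star_one, star_smul, star_sub, hKs, hPs, hss, hcs, mul_add, add_mul,
      one_mul, mul_one, smul_mul_smul_comm, mul_neg, smul_neg, hKK, hKP, hPK, hPP]
    have e : (s * s + (c - 1) * (c - 1) + (c - 1) + (c - 1)) • P = 0 := by
      rw [show s * s + (c - 1) * (c - 1) + (c - 1) + (c - 1) = 0 by linear_combination hsc,
        zero_smul]
    rw [add_smul, add_smul, add_smul] at e
    rw [mul_comm s (c - 1), ← sub_eq_zero, ← e]
    abel⟩

lemma mul_planeRot_apply_snd {n : ℕ} {p q : Fin n} (h : p ≠ q) (θ : ℝ) (U : UN n) (i : Fin n) :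
    entry i q (U * planeRot h θ) = Real.cos θ * entry i q U + Real.sin θ * entry i p U := by
  change (U.1 * (_ : Matrix (Fin n) (Fin n) ℂ)) i q = _
  simp [entry, planeRot, Matrix.mul_add, Matrix.mul_sub, Matrix.mul_single_apply_of_ne _ _ _ _ _ h.symm]
  ring

lemma mul_planeRot_apply_fst {n : ℕ} {p q : Fin n} (h : p ≠ q) (θ : ℝ) (U : UN n) (i : Fin n) :
    entry i p (U * planeRot h θ) = Real.cos θ * entry i p U - Real.sin θ * entry i q U := by
  change (U.1 * (_ : Matrix (Fin n) (Fin n) ℂ)) i p = _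
  simp [entry, planeRot, Matrix.mul_add, Matrix.mul_sub, Matrix.mul_single_apply_of_ne _ _ _ _ _ h]
  ring

/-- The diagonal unitary matrix with entry `i` at `p` and `1` elsewhere. -/
def diagI {n : ℕ} (p : Fin n) : UN n :=
  ⟨Matrix.diagonal fun j => if j = p then Complex.I else 1, by
    rw [Matrix.mem_unitaryGroup_iff, Matrix.star_eq_conjTranspose,
      Matrix.diagonal_conjTranspose, Matrix.diagonal_mul_diagonal, ← Matrix.diagonal_one]
    congr 1
    funext j
    by_cases hj : j = p <;> simp [hj]⟩

lemma mul_diagI_apply_same {n : ℕ} (p : Fin n) (U : UN n) (i : Fin n) :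
    entry i p (U * diagI p) = entry i p U * Complex.I := by
  change (U.1 * (_ : Matrix (Fin n) (Fin n) ℂ)) i p = _
  simp [entry, diagI]

lemma mul_diagI_apply_of_ne {n : ℕ} {p q : Fin n} (h : p ≠ q) (U : UN n) (i : Fin n) :
    entry i q (U * diagI p) = entry i q U := by
  change (U.1 * (_ : Matrix (Fin n) (Fin n) ℂ)) i q = _
  simp [entry, diagI, h.symm]

lemma integrable_haarN_of_continuous {E : Type*} [NormedAddCommGroup E]
    [SecondCountableTopology E] {N : ℕ} {f : UN N → E} (hf : Continuous f) :
    Integrable f (haarN N) :=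
  hf.integrable_of_hasCompactSupport (HasCompactSupport.of_compactSpace f)

/-- Haar invariance under infinitesimal rotations, applied to `a^{k+1} ā^k b̄`, where `a`, `b` are
two entries of the same row. -/
lemma integral_rotation_identity {n : ℕ} {p q : Fin n} (h : p ≠ q) (i : Fin n) (k : ℕ) :
    ∫ U, ((k + 1 : ℂ) * (entry i q U ^ k * entry i p U * conj (entry i q U) ^ k * conj (entry i p U)) +
      k * (entry i q U ^ (k + 1) * conj (entry i q U) ^ (k - 1) * conj (entry i p U) ^ 2) -
      entry i q U ^ (k + 1) * conj (entry i q U) ^ (k + 1)) ∂(haarN n) = 0 := by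
  set Φ : UN n → ℂ := fun U => entry i q U ^ (k + 1) * conj (entry i q U) ^ k * conj (entry i p U) with hΦ
  -- `Ψ` is the derivative of `Φ` along the rotation. At `k = 0` the truncated exponent `k - 1` is
  -- harmless, since its term carries the coefficient `k`.
  set Ψ : UN n → ℂ := fun U =>
    (k + 1 : ℂ) * (entry i q U ^ k * entry i p U * conj (entry i q U) ^ k * conj (entry i p U)) +
      k * (entry i q U ^ (k + 1) * conj (entry i q U) ^ (k - 1) * conj (entry i p U) ^ 2) -
      entry i q U ^ (k + 1) * conj (entry i q U) ^ (k + 1) with hΨ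
  have hΦc : Continuous Φ := by fun_prop
  have hΨc : Continuous Ψ := by fun_prop
  obtain ⟨C, hC⟩ := isCompact_univ.exists_bound_of_continuousOn hΨc.continuousOn
  have key := hasDerivAt_integral_of_dominated_loc_of_deriv_le (μ := haarN n)
    (F := fun (θ : ℝ) U => Φ (U * planeRot h θ)) (F' := fun θ U => Ψ (U * planeRot h θ))
    (bound := fun _ => C) (x₀ := (0 : ℝ)) (s := Set.univ) univ_mem
    (Eventually.of_forall fun θ =>
      (hΦc.comp (continuous_mul_const _)).aestronglyMeasurable)
    (integrable_haarN_of_continuous (hΦc.comp (continuous_mul_const _)))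
    (hΨc.comp (continuous_mul_const _)).aestronglyMeasurable
    (Eventually.of_forall fun U θ _ => hC _ (Set.mem_univ _)) (integrable_const _)
    (Eventually.of_forall fun U θ _ => by
      simp only [hΦ, hΨ, mul_planeRot_apply_fst, mul_planeRot_apply_snd, map_add, map_sub, map_mul,
        Complex.conj_ofReal]
      have hc : HasDerivAt (fun θ : ℝ => (Real.cos θ : ℂ)) (-Real.sin θ : ℂ) θ := by
        simpa using (Real.hasDerivAt_cos θ).ofReal_comp
      have hs : HasDerivAt (fun θ : ℝ => (Real.sin θ : ℂ)) (Real.cos θ : ℂ) θ :=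
        (Real.hasDerivAt_sin θ).ofReal_comp
      have hA := (hc.mul_const (entry i q U)).add (hs.mul_const (entry i p U))
      have hA' := (hc.mul_const (conj (entry i q U))).add (hs.mul_const (conj (entry i p U)))
      have hB' := (hc.mul_const (conj (entry i p U))).sub (hs.mul_const (conj (entry i q U)))
      refine (((hA.pow (k + 1)).mul (hA'.pow k)).mul hB').congr_deriv ?_
      simp only [Nat.add_sub_cancel, Nat.cast_add, Nat.cast_one, Pi.add_apply, Pi.mul_apply, Pi.pow_apply, Pi.sub_apply]
      ring)
  -- By right invariance the integral does not depend on `θ`, so its derivative, the integral of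
  -- `Ψ`, is zero.
  have hconst : ∀ θ : ℝ, ∫ U, Φ (U * planeRot h θ) ∂(haarN n) = ∫ U, Φ U ∂(haarN n) :=
    fun θ => integral_mul_right_eq_self Φ _
  have h2 := key.2
  simp only [hconst] at h2
  have h3 := h2.unique (hasDerivAt_const (0 : ℝ) _)
  rwa [integral_mul_right_eq_self Ψ] at h3

/-- Multiplying column `p` by `i` preserves Haar measure and changes the sign of the integrand. -/
lemma integral_pow_mul_conj_sq_eq_zero {n : ℕ} {p q : Fin n} (h : p ≠ q) (i : Fin n) (k l : ℕ) :
    ∫ U, (entry i q U ^ k * conj (entry i q U) ^ l * conj (entry i p U) ^ 2) ∂(haarN n) = 0 := by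
  have h1 := integral_mul_right_eq_self (μ := haarN n)
    (fun U => entry i q U ^ k * conj (entry i q U) ^ l * conj (entry i p U) ^ 2) (diagI p)
  simp only [mul_diagI_apply_same, mul_diagI_apply_of_ne h, map_mul, mul_pow, Complex.conj_I,
    neg_sq, Complex.I_sq, mul_neg, mul_one, integral_neg] at h1
  exact self_eq_neg.1 h1.symm

/-- The moments `E |D|^{2k}` of the lower right entry `D` of a Haar distributed matrix. -/
def moment (N k : ℕ) : ℝ := ∫ U, ‖eps N U‖ ^ (2 * k) ∂(haarN (N + 1))

@[fun_prop]
lemma continuous_eps (N : ℕ) : Continuous (eps N) := continuous_entry _ _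

lemma pow_mul_conj_pow (a : ℂ) (k : ℕ) : a ^ k * conj a ^ k = ((‖a‖ ^ (2 * k) : ℝ) : ℂ) := by
  rw [← mul_pow, Complex.mul_conj', pow_mul]
  push_cast
  ring

/-- The rotation identity with its middle term removed by the sign symmetry above. -/
lemma integral_norm_pow_mul_sq (N k : ℕ) (j : Fin N) :
    (k + 1 : ℝ) * ∫ U, ‖eps N U‖ ^ (2 * k) * ‖entry (Fin.last N) j.castSucc U‖ ^ 2 ∂(haarN (N + 1)) =
      moment N (k + 1) := by
  have hpq : j.castSucc ≠ Fin.last N := (Fin.castSucc_lt_last j).ne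
  have h1 := integral_rotation_identity hpq (Fin.last N) k
  rw [integral_sub, integral_add, integral_const_mul, integral_const_mul,
    integral_pow_mul_conj_sq_eq_zero hpq, mul_zero, add_zero, sub_eq_zero] at h1
  · have e1 : ∀ U : UN (N + 1), entry (Fin.last N) (Fin.last N) U ^ k * entry (Fin.last N) j.castSucc U *
        conj (entry (Fin.last N) (Fin.last N) U) ^ k * conj (entry (Fin.last N) j.castSucc U) =
        ((‖eps N U‖ ^ (2 * k) * ‖entry (Fin.last N) j.castSucc U‖ ^ 2 : ℝ) : ℂ) := by
      intro U
      rw [Complex.ofReal_mul, eps_eq_entry, ← pow_mul_conj_pow, Complex.ofReal_pow, ← Complex.mul_conj']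
      ring
    simp only [e1, pow_mul_conj_pow] at h1
    rw [integral_complex_ofReal, integral_complex_ofReal] at h1
    exact_mod_cast h1
  all_goals
    refine integrable_haarN_of_continuous ?_
    fun_prop

/-- The last row has norm one. Inserting the sum of its squared moduli into `E|D|^{2k}` gives one
term `E|D|^{2k+2}` from `D` and `N` terms equal to `E|D|^{2k+2}/(k+1)` from the other entries. -/
lemma moment_succ (N k : ℕ) :
    moment N (k + 1) * (N + 1 + k) = moment N k * (k + 1) := by
  have hrow : ∀ U : UN (N + 1), ‖eps N U‖ ^ 2 + ∑ j : Fin N, ‖entry (Fin.last N) j.castSucc U‖ ^ 2 = 1 := by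
    intro U
    have h1 := congrFun (congrFun (Matrix.mem_unitaryGroup_iff.1 U.2) (Fin.last N)) (Fin.last N)
    simp only [Matrix.mul_apply, Fin.sum_univ_castSucc, Matrix.star_apply, RCLike.star_def,
      Matrix.one_apply_eq, Complex.mul_conj'] at h1
    rw [add_comm, eps_eq_entry]
    simp only [entry]
    exact_mod_cast h1
  have hci : ∀ j : Fin N, Integrable (fun U : UN (N + 1) =>
      ‖eps N U‖ ^ (2 * k) * ‖entry (Fin.last N) j.castSucc U‖ ^ 2) (haarN (N + 1)) := by
    intro j
    refine integrable_haarN_of_continuous ?_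
    fun_prop
  have hce : Integrable (fun U : UN (N + 1) => ‖eps N U‖ ^ (2 * (k + 1))) (haarN (N + 1)) := by
    refine integrable_haarN_of_continuous ?_
    fun_prop
  have h2 : moment N k = moment N (k + 1) + ∑ j : Fin N, ∫ U, ‖eps N U‖ ^ (2 * k) *
      ‖entry (Fin.last N) j.castSucc U‖ ^ 2 ∂(haarN (N + 1)) := by
    rw [moment, moment, ← integral_finsetSum _ fun j _ => hci j, ← integral_add hce
      (integrable_finsetSum _ fun j _ => hci j)]
    refine integral_congr_ae (Eventually.of_forall fun U => ?_)
    beta_reduce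
    rw [← Finset.mul_sum, mul_add 2 k 1, pow_add, mul_one, ← mul_add, hrow, mul_one]
  have h3 : (k + 1 : ℝ) * moment N k = (k + 1) * moment N (k + 1) + N * moment N (k + 1) := by
    conv_lhs => rw [h2]
    rw [mul_add, Finset.mul_sum, Finset.sum_congr rfl fun j _ => integral_norm_pow_mul_sq N k j]
    simp
  linarith

lemma moment_zero (N : ℕ) : moment N 0 = 1 := by simp [moment]

lemma moment_nonneg (N k : ℕ) : 0 ≤ moment N k := integral_nonneg fun _ => by positivity

/-- For `j ≠ k` the scalar rotation by `π/(j - k)` multiplies the integrand by `-1`. -/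
lemma integral_eps_pow_mul_conj_pow (N j k : ℕ) :
    ∫ U, eps N U ^ j * conj (eps N U) ^ k ∂(haarN (N + 1)) = if j = k then (moment N k : ℂ) else 0 := by
  split_ifs with h
  · subst h
    simp only [pow_mul_conj_pow, moment]
    exact integral_complex_ofReal
  · have hd : (j : ℝ) - k ≠ 0 := sub_ne_zero.2 (by exact_mod_cast h)
    set θ : ℝ := Real.pi / (j - k) with hθ
    have h1 := integral_mul_left_eq_self (μ := haarN (N + 1))
      (fun U => eps N U ^ j * conj (eps N U) ^ k) (rot (N + 1) θ)
    have e : ∀ U : UN (N + 1), (Complex.exp (θ * Complex.I) * eps N U) ^ j *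
        conj (Complex.exp (θ * Complex.I) * eps N U) ^ k =
        -(eps N U ^ j * conj (eps N U) ^ k) := by
      intro U
      have e1 : Complex.exp (θ * Complex.I) ^ j * conj (Complex.exp (θ * Complex.I)) ^ k = -1 := by
        rw [← Complex.exp_conj, ← Complex.exp_nat_mul, ← Complex.exp_nat_mul, ← Complex.exp_add,
          ← Complex.exp_pi_mul_I, map_mul, Complex.conj_I, Complex.conj_ofReal]
        congr 1
        have : (θ : ℂ) * (j - k) = Real.pi := by
          have : θ * (j - k) = Real.pi := div_mul_cancel₀ _ hd
          exact_mod_cast this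
        linear_combination Complex.I * this
      rw [map_mul, mul_pow, mul_pow]
      linear_combination (eps N U ^ j * conj (eps N U) ^ k) * e1
    simp only [eps_rot_mul, e, integral_neg] at h1
    exact self_eq_neg.1 h1.symm

/-! ### The mean square of `(1 + D)^s` -/

lemma hasSum_choose_mul_pow (s : ℂ) {x : ℂ} (hx : ‖x‖ < 1) :
    HasSum (fun k => Ring.choose s k * x ^ k) ((1 + x) ^ s) := by
  have h := (Complex.one_add_cpow_hasFPowerSeriesOnBall_zero (a := s)).hasSum (y := x) (by
    rw [← ENNReal.ofReal_one, Metric.eball_ofReal]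
    simpa using hx)
  simpa [binomialSeries, mul_comm] using h

lemma summable_norm_choose_mul_pow (s : ℂ) {r : ℝ} (h0 : 0 ≤ r) (h1 : r < 1) :
    Summable fun k => ‖Ring.choose s k‖ * r ^ k := by
  have h : ((r.toNNReal : NNReal) : ℝ≥0∞) < (binomialSeries ℂ s).radius := by
    refine lt_of_lt_of_le ?_ (Complex.one_add_cpow_hasFPowerSeriesOnBall_zero (a := s)).r_le
    exact_mod_cast Real.toNNReal_lt_one.2 h1
  have := (binomialSeries ℂ s).summable_norm_mul_pow h
  simpa [binomialSeries, FormalMultilinearSeries.ofScalars_norm, h0] using this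

/-- The terms of the series for the mean square of `(1 + D)^s`. -/
def sqTerm (s : ℂ) (N k : ℕ) : ℝ := ‖Ring.choose s k‖ ^ 2 * moment N k

lemma sqTerm_nonneg (s : ℂ) (N k : ℕ) : 0 ≤ sqTerm s N k :=
  mul_nonneg (by positivity) (moment_nonneg N k)

lemma hasSum_mul_conj {f : ℕ → ℂ} {a : ℂ} (hf : HasSum f a) (hn : Summable fun k => ‖f k‖) :
    HasSum (fun p : ℕ × ℕ => f p.1 * conj (f p.2)) (a * conj a) := by
  have hn' : Summable fun k => ‖conj (f k)‖ := by
    simpa only [Complex.norm_conj] using hn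
  have hs := summable_mul_of_summable_norm hn hn'
  have hc : HasSum (fun k => conj (f k)) (conj a) := hf.map (starRingEnd ℂ) Complex.continuous_conj
  exact HasSum.mul (f := f) (g := fun k => conj (f k)) hf hc hs

/-- Parseval's identity: expand `|g|²` into a double series and integrate termwise; only the
diagonal survives. Absolute summability at radius `r` justifies the interchange. -/
lemma hasSum_integral_norm_sq_powerSeries (N : ℕ) {r : ℝ} (h0 : 0 ≤ r) {b : ℕ → ℂ}
    (hsum : Summable fun k => ‖b k‖ * r ^ k) {g : UN (N + 1) → ℂ}
    (hg : ∀ U, HasSum (fun k => b k * (r * eps N U) ^ k) (g U)) :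
    HasSum (fun k => ‖b k‖ ^ 2 * moment N k * r ^ (2 * k)) (∫ U, ‖g U‖ ^ 2 ∂(haarN (N + 1))) := by
  have hr : ∀ U : UN (N + 1), ‖(r : ℂ) * eps N U‖ ≤ r := fun U => by
    rw [norm_mul, Complex.norm_real, Real.norm_of_nonneg h0]
    exact mul_le_of_le_one_right h0 (norm_eps_le N U)
  have hterm : ∀ (k : ℕ) (U : UN (N + 1)), ‖b k * (r * eps N U) ^ k‖ ≤ ‖b k‖ * r ^ k := by
    intro k U
    rw [norm_mul, norm_pow]
    exact mul_le_mul_of_nonneg_left (pow_le_pow_left₀ (norm_nonneg _) (hr U) k) (norm_nonneg _)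
  have key : HasSum (fun p : ℕ × ℕ => ∫ U, (b p.1 * (r * eps N U) ^ p.1) *
      conj (b p.2 * (r * eps N U) ^ p.2) ∂(haarN (N + 1)))
      (∫ U, g U * conj (g U) ∂(haarN (N + 1))) := by
    refine hasSum_integral_of_dominated_convergence
      (fun p _ => (‖b p.1‖ * r ^ p.1) * (‖b p.2‖ * r ^ p.2)) (fun p => ?_)
      (fun p => Eventually.of_forall fun U => ?_) (Eventually.of_forall fun U => ?_)
      (integrable_const _) (Eventually.of_forall fun U => ?_)
    · have : Continuous fun U : UN (N + 1) => (b p.1 * (r * eps N U) ^ p.1) *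
          conj (b p.2 * (r * eps N U) ^ p.2) := by fun_prop
      exact this.aestronglyMeasurable
    · rw [norm_mul, Complex.norm_conj]
      exact mul_le_mul (hterm _ _) (hterm _ _) (norm_nonneg _) (by positivity)
    · exact hsum.mul_of_nonneg hsum (fun k => by positivity) (fun k => by positivity)
    · have hn : Summable fun k => ‖b k * (r * eps N U) ^ k‖ :=
        hsum.of_nonneg_of_le (fun _ => norm_nonneg _) fun k => hterm k U
      convert! hasSum_mul_conj (hg U) hn
  have hint : ∀ p : ℕ × ℕ, ∫ U, (b p.1 * (r * eps N U) ^ p.1) *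
      conj (b p.2 * (r * eps N U) ^ p.2) ∂(haarN (N + 1)) =
      if p.1 = p.2 then ((‖b p.1‖ ^ 2 * moment N p.1 * r ^ (2 * p.1) : ℝ) : ℂ) else 0 := by
    rintro ⟨j, k⟩
    have e : ∀ U : UN (N + 1), (b j * (r * eps N U) ^ j) * conj (b k * (r * eps N U) ^ k) =
        (b j * conj (b k) * (r : ℂ) ^ (j + k)) * (eps N U ^ j * conj (eps N U) ^ k) := by
      intro U
      simp only [map_mul, map_pow, Complex.conj_ofReal]
      ring
    simp only [e]
    rw [integral_const_mul, integral_eps_pow_mul_conj_pow]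
    split_ifs with h
    · subst h
      rw [Complex.mul_conj']
      push_cast
      rw [← two_mul]
      ring
    · rw [mul_zero]
  simp only [hint, Complex.mul_conj'] at key
  have hinj : Function.Injective fun k : ℕ => (k, k) := fun a b h => (Prod.ext_iff.1 h).1
  have key2 := (hinj.hasSum_iff (by
    rintro ⟨j, k⟩ hjk
    refine if_neg fun h => hjk ⟨j, ?_⟩
    simp only at h
    simp [h])).2 key
  simp only [Function.comp_def, if_true, ← Complex.ofReal_pow] at key2
  rw [integral_complex_ofReal] at key2
  exact Complex.hasSum_ofReal.1 key2

lemma hasSum_integral_norm_sq (s : ℂ) (N : ℕ) {r : ℝ} (h0 : 0 ≤ r) (h1 : r < 1) :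
    HasSum (fun k => sqTerm s N k * r ^ (2 * k))
      (∫ U, ‖(1 + r * eps N U) ^ s‖ ^ 2 ∂(haarN (N + 1))) :=
  hasSum_integral_norm_sq_powerSeries N h0 (summable_norm_choose_mul_pow s h0 h1) fun U =>
    hasSum_choose_mul_pow s (by
      rw [norm_mul, Complex.norm_real, Real.norm_of_nonneg h0]
      exact (mul_le_of_le_one_right h0 (norm_eps_le N U)).trans_lt h1)

/-- By rotation invariance the sets `D = -e^{iθ}` all have the same measure. They are disjoint and
uncountably many, so in a probability space this measure is zero. -/
lemma ae_eps_ne (N : ℕ) : ∀ᵐ U ∂(haarN (N + 1)), eps N U ≠ -1 := by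
  have hm : ∀ D : ℂ, MeasurableSet {U : UN (N + 1) | eps N U = D} :=
    fun D => measurable_eps N (measurableSet_singleton D)
  have hrot : ∀ θ : ℝ, haarN (N + 1) {U | eps N U = -Complex.exp (θ * Complex.I)} =
      haarN (N + 1) {U | eps N U = -1} := by
    intro θ
    rw [← measure_preimage_mul (haarN (N + 1)) (rot (N + 1) θ)]
    congr 1
    ext U
    simp only [Set.mem_preimage, Set.mem_ofPred_eq, eps_rot_mul, neg_eq_neg_one_mul
      (Complex.exp _)]
    rw [mul_comm]
    exact mul_left_inj' (Complex.exp_ne_zero _)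
  have hcount := Measure.countable_meas_pos_of_disjoint_iUnion (μ := haarN (N + 1))
    (As := fun θ : Set.Ioc (-Real.pi) Real.pi =>
      {U : UN (N + 1) | eps N U = -Complex.exp ((θ : ℝ) * Complex.I)})
    (fun θ => hm _) (fun θ φ hne => Set.disjoint_left.2 fun U h1 h2 => hne (by
      have h3 : Complex.exp ((θ : ℝ) * Complex.I) = Complex.exp ((φ : ℝ) * Complex.I) :=
        neg_injective (h1.symm.trans h2)
      have h4 := congrArg Complex.arg h3
      rw [Complex.arg_exp_mul_I, Complex.arg_exp_mul_I,
        (toIocMod_eq_self _).2 (by simp [two_mul]), (toIocMod_eq_self _).2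
        (by simp [two_mul])] at h4
      exact Subtype.ext h4))
  simp only [hrot] at hcount
  rw [ae_iff]
  simp only [ne_eq, not_not]
  by_contra h0
  have hpos : 0 < haarN (N + 1) {U | eps N U = -1} := pos_iff_ne_zero.2 h0
  simp only [hpos, Set.ofPred_true] at hcount
  have : (Set.Ioc (-Real.pi) Real.pi).Countable := Set.countable_univ_iff.1 hcount |>.to_set
  exact (Cardinal.Real.Ioc_countable_iff.1 this).not_gt (by linarith [Real.pi_pos])

lemma norm_cpow_le (x c : ℂ) (hx : x ≠ 0) :
    ‖x ^ c‖ ≤ Real.exp (Real.pi * |c.im|) * ‖x‖ ^ c.re := by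
  rw [Complex.norm_cpow_of_ne_zero hx, div_eq_mul_inv, ← Real.exp_neg, mul_comm]
  refine mul_le_mul_of_nonneg_right (Real.exp_le_exp.2 ?_) (by positivity)
  calc -(x.arg * c.im) ≤ |x.arg * c.im| := neg_le_abs _
    _ = |x.arg| * |c.im| := abs_mul _ _
    _ ≤ Real.pi * |c.im| := mul_le_mul_of_nonneg_right (Complex.abs_arg_le_pi x) (abs_nonneg _)

lemma vzw_zero_right {s D : ℂ} (hD : D ≠ -1) : vzw s 0 D = (1 + D) ^ s := by
  simp [vzw, hD]

lemma integrable_norm_vzw_sq (N : ℕ) {z w : ℂ} (h : -(1 / 2 : ℝ) < z.re + w.re) :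
    Integrable (fun U => ‖vzw z w (eps N U)‖ ^ 2) (haarN (N + 1)) := by
  have hm : Measurable fun U => ‖vzw z w (eps N U)‖ ^ 2 :=
    ((measurable_vzw z w).comp (measurable_eps N)).norm.pow_const 2
  refine ⟨hm.aestronglyMeasurable, ?_⟩
  rw [hasFiniteIntegral_iff_enorm]
  refine lt_of_le_of_ne le_top ?_
  simpa only [enorm_pow, enorm_norm] using lintegral_vzw_ne_top N h

/-- The mean square of `(1 + D)^s`. -/
def meanSq (s : ℂ) (N : ℕ) : ℝ := ∫ U, ‖vzw s 0 (eps N U)‖ ^ 2 ∂(haarN (N + 1))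

/-- From `1 + D = (1 + rD) + (1 - r)D` and `1 - r ≤ |1 + rD|`. It controls negative powers of `|1 +
rD|` uniformly as `r → 1`. -/
lemma norm_one_add_mul_le {D : ℂ} (hD : ‖D‖ ≤ 1) {r : ℝ} (h0 : 0 ≤ r) (h1 : r < 1) :
    ‖1 + D‖ ≤ 2 * ‖1 + r * D‖ := by
  have e1 : 1 - r ≤ ‖1 + r * D‖ := by
    have h := norm_sub_norm_le (1 : ℂ) (-(r * D))
    rw [norm_one, norm_neg, norm_mul, Complex.norm_real, Real.norm_of_nonneg h0, sub_neg_eq_add] at h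
    nlinarith
  have e2 : 1 + D = (1 + r * D) + ((1 - r : ℝ) : ℂ) * D := by push_cast; ring
  rw [e2]
  refine (norm_add_le _ _).trans ?_
  rw [norm_mul, Complex.norm_real, Real.norm_of_nonneg (by linarith)]
  nlinarith

lemma tendsto_integral_norm_sq {s : ℂ} (hs : -(1 / 2 : ℝ) < s.re) (N : ℕ) :
    Tendsto (fun r : ℝ => ∫ U, ‖(1 + r * eps N U) ^ s‖ ^ 2 ∂(haarN (N + 1))) (𝓝[<] 1)
      (𝓝 (meanSq s N)) := by
  set K := Real.exp (Real.pi * |s.im|) with hK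
  have hr01 : ∀ᶠ r : ℝ in 𝓝[<] 1, 0 ≤ r ∧ r < 1 := by
    filter_upwards [Ioo_mem_nhdsLT (show (0 : ℝ) < 1 by norm_num)] with r hr
    exact ⟨hr.1.le, hr.2⟩
  have hre : -(1 / 2 : ℝ) < ((s.re : ℂ)).re + (0 : ℂ).re := by simpa using hs
  -- The exponential `K` bounds the effect of `Im s`, and `2^|Re s|` absorbs the bounds `|1 + rD| ≤
  -- 2` for `Re s ≥ 0` and `|1 + D| ≤ 2|1 + rD|` for `Re s ≤ 0`. The majorant is integrable because
  -- `Re s > -1/2`.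
  refine tendsto_integral_filter_of_dominated_convergence
    (fun U => (K * 2 ^ |s.re|) ^ 2 * (1 + ‖vzw (s.re : ℂ) 0 (eps N U)‖ ^ 2)) ?_ ?_ ?_ ?_
  · refine Eventually.of_forall fun r => Measurable.aestronglyMeasurable ?_
    exact ((((measurable_eps N).const_mul (r : ℂ)).const_add 1).pow_const s).norm.pow_const 2
  · filter_upwards [hr01] with r hr
    filter_upwards [ae_eps_ne N] with U hU
    have hD := norm_eps_le N U
    set D := eps N U
    have hne : 1 + D ≠ 0 := fun h => hU (by linear_combination h)
    have hle := norm_one_add_mul_le hD hr.1 hr.2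
    have hpos : 0 < ‖1 + D‖ := norm_pos_iff.2 hne
    have hpos' : 0 < ‖1 + r * D‖ := by linarith
    have h2 : ‖1 + r * D‖ ≤ 2 := by
      refine (norm_add_le _ _).trans ?_
      rw [norm_one, norm_mul, Complex.norm_real, Real.norm_of_nonneg hr.1]
      nlinarith [hr.2, norm_nonneg D]
    have hv : ‖vzw (s.re : ℂ) 0 D‖ = ‖1 + D‖ ^ s.re := by
      rw [vzw_zero_right hU, Complex.norm_cpow_real]
    have hb : ‖1 + r * D‖ ^ s.re ≤ 2 ^ |s.re| * max 1 (‖vzw (s.re : ℂ) 0 D‖) := by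
      rw [hv]
      rcases le_total 0 s.re with h | h
      · rw [abs_of_nonneg h]
        calc ‖1 + r * D‖ ^ s.re ≤ 2 ^ s.re * 1 := by
              rw [mul_one]; exact Real.rpow_le_rpow hpos'.le h2 h
          _ ≤ _ := by gcongr; exact le_max_left _ _
      · rw [abs_of_nonpos h]
        calc ‖1 + r * D‖ ^ s.re ≤ (‖1 + D‖ / 2) ^ s.re :=
              Real.rpow_le_rpow_of_nonpos (by positivity) (by linarith) h
          _ = 2 ^ (-s.re) * ‖1 + D‖ ^ s.re := by
              rw [Real.div_rpow hpos.le (by norm_num), Real.rpow_neg (by norm_num)]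
              ring
          _ ≤ _ := by gcongr; exact le_max_right _ _
    rw [Real.norm_of_nonneg (by positivity)]
    calc ‖(1 + r * D) ^ s‖ ^ 2 ≤ (K * (2 ^ |s.re| * max 1 (‖vzw (s.re : ℂ) 0 D‖))) ^ 2 := by
          refine pow_le_pow_left₀ (norm_nonneg _) ?_ 2
          refine (norm_cpow_le _ s (norm_pos_iff.1 hpos')).trans ?_
          gcongr
      _ = (K * 2 ^ |s.re|) ^ 2 * (max 1 (‖vzw (s.re : ℂ) 0 D‖)) ^ 2 := by ring
      _ ≤ _ := by
          gcongr
          rcases max_cases 1 (‖vzw (s.re : ℂ) 0 D‖) with h | h <;> rw [h.1] <;>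
            nlinarith [sq_nonneg (‖vzw (s.re : ℂ) 0 D‖)]
  · exact ((integrable_const 1).add (integrable_norm_vzw_sq N hre)).const_mul _
  · filter_upwards [ae_eps_ne N] with U hU
    rw [vzw_zero_right hU]
    have hslit : 1 + eps N U ∈ Complex.slitPlane :=
      Or.inl (re_one_add_pos (norm_eps_le N U) hU)
    have hc : ContinuousAt (fun r : ℝ => ‖(1 + r * eps N U) ^ s‖ ^ 2) 1 := by
      refine ContinuousAt.pow (ContinuousAt.norm ?_) 2
      refine ContinuousAt.cpow (by fun_prop) continuousAt_const ?_
      simpa using hslit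
    have := hc.tendsto
    simp only [Complex.ofReal_one, one_mul] at this
    exact this.mono_left nhdsWithin_le_nhds

/-- Each finite partial sum is the limit, as `r → 1`, of partial sums bounded by the integral at
radius `r`, hence is at most `meanSq`. This bypasses asymptotics of binomial coefficients. -/
lemma summable_sqTerm {s : ℂ} (hs : -(1 / 2 : ℝ) < s.re) (N : ℕ) : Summable (sqTerm s N) := by
  refine summable_of_sum_le (c := meanSq s N) (fun k => sqTerm_nonneg s N k) fun T => ?_
  have hcont : Continuous fun r : ℝ => ∑ k ∈ T, sqTerm s N k * r ^ (2 * k) := by fun_prop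
  have h1 : Tendsto (fun r : ℝ => ∑ k ∈ T, sqTerm s N k * r ^ (2 * k)) (𝓝[<] 1)
      (𝓝 (∑ k ∈ T, sqTerm s N k)) := by
    have := (hcont.tendsto 1).mono_left (nhdsWithin_le_nhds (s := Set.Iio 1))
    simpa using this
  refine le_of_tendsto_of_tendsto h1 (tendsto_integral_norm_sq hs N) ?_
  filter_upwards [Ioo_mem_nhdsLT (show (0 : ℝ) < 1 by norm_num)] with r hr
  exact sum_le_hasSum T (fun k _ => mul_nonneg (sqTerm_nonneg s N k) (pow_nonneg hr.1.le _))
    (hasSum_integral_norm_sq s N hr.1.le hr.2)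

lemma tsum_sqTerm {s : ℂ} (hs : -(1 / 2 : ℝ) < s.re) (N : ℕ) :
    ∑' k, sqTerm s N k = meanSq s N := by
  have h1 : Tendsto (fun r : ℝ => ∑' k, sqTerm s N k * r ^ (2 * k)) (𝓝[<] 1)
      (𝓝 (∑' k, sqTerm s N k)) := by
    refine tendsto_tsum_of_dominated_convergence (summable_sqTerm hs N) (fun k => ?_) ?_
    · have hcont : Continuous fun r : ℝ => sqTerm s N k * r ^ (2 * k) := by fun_prop
      have := (hcont.tendsto 1).mono_left (nhdsWithin_le_nhds (s := Set.Iio 1))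
      simpa using this
    · filter_upwards [Ioo_mem_nhdsLT (show (0 : ℝ) < 1 by norm_num)] with r hr k
      rw [Real.norm_of_nonneg (mul_nonneg (sqTerm_nonneg s N k) (pow_nonneg hr.1.le _))]
      exact mul_le_of_le_one_right (sqTerm_nonneg s N k) (pow_le_one₀ hr.1.le hr.2.le)
  refine tendsto_nhds_unique h1 ((tendsto_integral_norm_sq hs N).congr' ?_)
  filter_upwards [Ioo_mem_nhdsLT (show (0 : ℝ) < 1 by norm_num)] with r hr
  exact (hasSum_integral_norm_sq s N hr.1.le hr.2).tsum_eq.symm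

/-! ### Recurrences for the series and Gauss's summation -/

lemma choose_succ_mul (s : ℂ) (k : ℕ) :
    ((k : ℂ) + 1) * Ring.choose s (k + 1) = Ring.choose s k * (s - k) := by
  have := Ring.choose_smul_choose s (Nat.le_succ k)
  simpa [Nat.choose_succ_self_right, nsmul_eq_mul] using this

lemma sqTerm_succ_mul (s : ℂ) (N k : ℕ) :
    sqTerm s N (k + 1) * ((k + 1) * (N + 1 + k)) = sqTerm s N k * ‖s - k‖ ^ 2 := by
  have h1 := congrArg (fun x => ‖x‖ ^ 2) (choose_succ_mul s k)
  simp only [norm_mul] at h1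
  rw [show ‖(k : ℂ) + 1‖ = k + 1 by exact_mod_cast Complex.norm_natCast (k + 1)] at h1
  have h2 := moment_succ N k
  have hk : (k + 1 : ℝ) ≠ 0 := by positivity
  rw [sqTerm, sqTerm]
  refine mul_left_cancel₀ hk ?_
  linear_combination (moment N k) * (k + 1) * h1 + (k + 1) ^ 2 * ‖Ring.choose s (k + 1)‖ ^ 2 * h2

lemma moment_succ_left (N k : ℕ) :
    moment (N + 1) k * (N + 1 + k) = moment N k * (N + 1) := by
  induction k with
  | zero => simp [moment_zero]
  | succ k ih =>
    have h1 := moment_succ (N + 1) k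
    have h2 := moment_succ N k
    have hk : (N + 1 + k : ℝ) ≠ 0 := by positivity
    push_cast at *
    refine mul_left_cancel₀ hk ?_
    linear_combination (N + 1 + k : ℝ) * h1 + (k + 1 : ℝ) * ih - (N + 1 : ℝ) * h2

lemma sqTerm_succ_left (s : ℂ) (N k : ℕ) :
    sqTerm s (N + 1) k * (N + 1 + k) = sqTerm s N k * (N + 1) := by
  rw [sqTerm, sqTerm, mul_assoc, moment_succ_left, mul_assoc]

/-- The contiguous relation behind Gauss's summation theorem. -/
lemma sqTerm_contiguous (s : ℂ) (N k : ℕ) :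
    (N + 1) * (N + 1 + 2 * s.re) * sqTerm s N k + (N + 1) * ((k + 1) * sqTerm s N (k + 1)) =
      ‖(N + 1 : ℂ) + s‖ ^ 2 * sqTerm s (N + 1) k + (N + 1) * (k * sqTerm s N k) := by
  have h1 := sqTerm_succ_mul s N k
  have h2 := sqTerm_succ_left s N k
  have hk : (N + 1 + k : ℝ) ≠ 0 := by positivity
  have e1 : ‖s - k‖ ^ 2 = (s.re - k) ^ 2 + s.im ^ 2 := by
    rw [Complex.sq_norm, Complex.normSq_apply]; simp; ring
  have e2 : ‖(N + 1 : ℂ) + s‖ ^ 2 = (N + 1 + s.re) ^ 2 + s.im ^ 2 := by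
    rw [Complex.sq_norm, Complex.normSq_apply]; simp; ring
  rw [e1] at h1
  rw [e2]
  refine mul_left_cancel₀ hk ?_
  linear_combination (N + 1 : ℝ) * h1 - ((N + 1 + s.re) ^ 2 + s.im ^ 2) * h2

/-- A positive limit `L` would force `a k ≥ L/(2k)` eventually, against the divergence of the
harmonic series. -/
lemma tendsto_zero_of_summable_of_tendsto_mul {a : ℕ → ℝ} (ha : Summable a) (h0 : ∀ k, 0 ≤ a k)
    {L : ℝ} (h : Tendsto (fun k : ℕ => k * a k) atTop (𝓝 L)) : L = 0 := by
  by_contra hL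
  have hL0 : 0 ≤ L := ge_of_tendsto' h fun k => mul_nonneg k.cast_nonneg (h0 k)
  have hLp : 0 < L := lt_of_le_of_ne hL0 (Ne.symm hL)
  refine Real.not_summable_one_div_natCast ?_
  refine Summable.of_norm_bounded_eventually_nat (ha.mul_left (2 / L)) ?_
  filter_upwards [h.eventually (lt_mem_nhds (show L / 2 < L by linarith)),
    eventually_gt_atTop 0] with k hk hk0
  have hk0' : (0 : ℝ) < k := by exact_mod_cast hk0
  rw [Real.norm_of_nonneg (by positivity), div_le_iff₀ hk0']
  calc (1 : ℝ) = 2 / L * (L / 2) := by field_simp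
    _ ≤ 2 / L * (k * a k) := by gcongr
    _ = _ := by ring

/-- Summing the contiguous relation over `k < K` telescopes to the boundary term `(N+1) K · sqTerm s
N K`. It converges because the two partial sums do, and summability forces its limit to be zero. -/
lemma meanSq_succ {s : ℂ} (hs : -(1 / 2 : ℝ) < s.re) (N : ℕ) :
    (N + 1) * (N + 1 + 2 * s.re) * meanSq s N = ‖(N + 1 : ℂ) + s‖ ^ 2 * meanSq s (N + 1) := by
  have hsum : ∀ K : ℕ, (N + 1) * (N + 1 + 2 * s.re) * ∑ k ∈ Finset.range K, sqTerm s N k +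
      (N + 1) * (K * sqTerm s N K) =
      ‖(N + 1 : ℂ) + s‖ ^ 2 * ∑ k ∈ Finset.range K, sqTerm s (N + 1) k := by
    intro K
    induction K with
    | zero => simp
    | succ K ih =>
      rw [Finset.sum_range_succ, Finset.sum_range_succ]
      have := sqTerm_contiguous s N K
      push_cast
      linear_combination ih + this
  have t1 := (summable_sqTerm hs N).hasSum.tendsto_sum_nat
  have t2 := (summable_sqTerm hs (N + 1)).hasSum.tendsto_sum_nat
  rw [tsum_sqTerm hs] at t1 t2
  have hN : (N + 1 : ℝ) ≠ 0 := by positivity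
  have t3 : Tendsto (fun K : ℕ => K * sqTerm s N K) atTop (𝓝 ((N + 1 : ℝ)⁻¹ *
      (‖(N + 1 : ℂ) + s‖ ^ 2 * meanSq s (N + 1) - (N + 1) * (N + 1 + 2 * s.re) * meanSq s N))) := by
    refine (((t2.const_mul _).sub (t1.const_mul _)).const_mul _).congr fun K => ?_
    rw [← hsum K, add_sub_cancel_left, inv_mul_cancel_left₀ hN]
  have := tendsto_zero_of_summable_of_tendsto_mul (summable_sqTerm hs N) (sqTerm_nonneg s N) t3
  have h4 := (mul_eq_zero.1 this).resolve_left (inv_ne_zero hN)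
  linarith

lemma moment_antitone_left (k : ℕ) : Antitone fun N => moment N k := by
  refine antitone_nat_of_succ_le fun N => ?_
  have h1 := moment_succ_left N k
  have h2 := moment_nonneg (N + 1) k
  have hN : (0 : ℝ) < N + 1 := by positivity
  have hk : (0 : ℝ) ≤ k := k.cast_nonneg
  by_contra hlt
  push Not at hlt
  nlinarith [mul_nonneg h2 hk]

lemma moment_le (N k : ℕ) : moment N (k + 1) ≤ 1 / (N + 1) := by
  induction k with
  | zero =>
    have := moment_succ N 0
    rw [moment_zero] at this
    rw [le_div_iff₀ (by positivity)]
    simp at this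
    simp [this]
  | succ k ih =>
    refine le_trans ?_ ih
    have h1 := moment_succ N (k + 1)
    have h2 := moment_nonneg N (k + 2)
    have hN : (0 : ℝ) ≤ N := N.cast_nonneg
    have hk : (0 : ℝ) ≤ k := k.cast_nonneg
    push_cast at h1
    by_contra hlt
    push Not at hlt
    nlinarith [mul_nonneg h2 hN]

/-- Moments decrease in `N`, so the summable series at `N = 0` dominates. Every moment with `k ≥ 1`
tends to zero, which leaves only the term `k = 0`. -/
lemma tendsto_meanSq {s : ℂ} (hs : -(1 / 2 : ℝ) < s.re) :
    Tendsto (meanSq s) atTop (𝓝 1) := by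
  have h1 : Tendsto (fun N => ∑' k, sqTerm s N k) atTop (𝓝 (∑' k : ℕ, if k = 0 then (1 : ℝ) else 0)) := by
    refine tendsto_tsum_of_dominated_convergence (summable_sqTerm hs 0) (fun k => ?_)
      (Eventually.of_forall fun N k => ?_)
    · cases k with
      | zero => simp [sqTerm, moment_zero]
      | succ k =>
        simp only [Nat.add_eq_zero_iff, one_ne_zero, and_false, if_false, sqTerm]
        have : Tendsto (fun N => moment N (k + 1)) atTop (𝓝 0) :=
          squeeze_zero (fun N => moment_nonneg N _) (fun N => moment_le N k)
            tendsto_one_div_add_atTop_nhds_zero_nat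
        simpa using this.const_mul (‖Ring.choose s (k + 1)‖ ^ 2)
    · rw [Real.norm_of_nonneg (sqTerm_nonneg s N k), sqTerm, sqTerm]
      gcongr
      exact moment_antitone_left k (Nat.zero_le N)
  simpa only [tsum_sqTerm hs, tsum_ite_eq] using h1

/-! ### Evaluation by Gamma functions -/

/-- The `n`-th factor of the normalization constant. -/
def gammaFactor (s : ℂ) (n : ℕ) : ℂ :=
  Complex.Gamma n * Complex.Gamma (n + s + conj s) /
    (Complex.Gamma (n + s) * Complex.Gamma (n + conj s))

lemma Gamma_ne_zero_of_re {s : ℂ} {n : ℕ} (h : -(n : ℝ) < s.re) : Complex.Gamma (n + s) ≠ 0 :=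
  Complex.Gamma_ne_zero_of_re_pos (by simp; linarith)

lemma gammaFactor_ne_zero {s : ℂ} (hs : -(1 / 2 : ℝ) < s.re) (n : ℕ) :
    gammaFactor s (n + 1) ≠ 0 := by
  have hn : (0 : ℝ) ≤ n := n.cast_nonneg
  refine div_ne_zero (mul_ne_zero ?_ ?_) (mul_ne_zero ?_ ?_) <;>
    refine Complex.Gamma_ne_zero_of_re_pos ?_ <;> simp <;> linarith

/-- The functional equation of `Γ` gives the same two-term recurrence in `N` as `meanSq_succ`. -/
lemma gammaFactor_succ {s : ℂ} (hs : -(1 / 2 : ℝ) < s.re) (n : ℕ) :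
    ((n : ℂ) + 1) * (n + 1 + 2 * s.re) * gammaFactor s (n + 1) =
      (‖(n + 1 : ℂ) + s‖ ^ 2 : ℝ) * gammaFactor s (n + 2) := by
  have hn : (0 : ℝ) ≤ n := n.cast_nonneg
  have key : ∀ c : ℂ, -1 < c.re → Complex.Gamma ((n + 2 : ℕ) + c) =
      ((n : ℂ) + 1 + c) * Complex.Gamma ((n + 1 : ℕ) + c) ∧
      Complex.Gamma ((n + 1 : ℕ) + c) ≠ 0 ∧ (n : ℂ) + 1 + c ≠ 0 := by
    intro c hc
    have h0 : (n : ℂ) + 1 + c ≠ 0 := fun h => by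
      have := congrArg Complex.re h
      simp at this
      linarith
    refine ⟨?_, Gamma_ne_zero_of_re (by push_cast; linarith), h0⟩
    rw [show ((n + 2 : ℕ) : ℂ) + c = ((n : ℂ) + 1 + c) + 1 by push_cast; ring,
      Complex.Gamma_add_one _ h0]
    push_cast
    rfl
  obtain ⟨a1, a2, a3⟩ := key s (by linarith)
  obtain ⟨b1, b2, b3⟩ := key (conj s) (by simp; linarith)
  obtain ⟨c1, c2, c3⟩ := key (s + conj s) (by simp; linarith)
  obtain ⟨d1, d2, d3⟩ := key 0 (by simp)
  rw [add_zero, add_zero, add_zero] at d1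
  rw [← add_assoc, ← add_assoc, ← add_assoc] at c1
  have e1 : ((‖(n + 1 : ℂ) + s‖ ^ 2 : ℝ) : ℂ) = (n + 1 + s) * (n + 1 + conj s) := by
    rw [Complex.ofReal_pow, ← Complex.mul_conj']
    simp
  have e2 : (n : ℂ) + 1 + 2 * s.re = n + 1 + s + conj s := by
    rw [add_assoc _ s, Complex.add_conj]
    push_cast
    ring
  rw [e1, e2, gammaFactor, gammaFactor, a1, b1, c1, d1]
  field_simp

lemma Gamma_add_nat_eq (c : ℂ) (hc : 0 < c.re) (n : ℕ) :
    Complex.Gamma (c + n) = (∏ j ∈ Finset.range n, (c + j)) * Complex.Gamma c := by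
  induction n with
  | zero => simp
  | succ n ih =>
    have h0 : c + n ≠ 0 := fun h => by
      have := congrArg Complex.re h
      have hn : (0 : ℝ) ≤ n := n.cast_nonneg
      simp at this
      linarith
    rw [Nat.cast_succ, ← add_assoc, Complex.Gamma_add_one _ h0, ih, Finset.prod_range_succ]
    ring

/-- Euler's limit formula for `Γ(1 + c)`, combined with the product expression of `Γ(1 + c + (n +
1))`. -/
lemma tendsto_Gamma_ratio {c : ℂ} (hc : -1 < c.re) :
    Tendsto (fun n : ℕ => Complex.Gamma ((n + 2 : ℕ) + c) / ((n : ℂ) ^ (1 + c) * n.factorial))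
      atTop (𝓝 1) := by
  have hre : 0 < (1 + c).re := by simp; linarith
  have h0 := Complex.Gamma_ne_zero_of_re_pos hre
  have h1 := (tendsto_const_nhds (x := Complex.Gamma (1 + c))).div
    (Complex.GammaSeq_tendsto_Gamma (1 + c)) h0
  rw [div_self h0] at h1
  refine h1.congr fun n => ?_
  rw [show ((n + 2 : ℕ) : ℂ) + c = (1 + c) + (n + 1 : ℕ) by push_cast; ring,
    Gamma_add_nat_eq _ hre]
  simp only [Pi.div_apply, Complex.GammaSeq]
  rw [div_div_eq_mul_div, mul_comm]

/-- Four instances of the ratio limit, at `0`, `s + s̄`, `s` and `s̄`. The powers of `n` cancel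
because the exponents of numerator and denominator have the same sum. -/
lemma tendsto_gammaFactor {s : ℂ} (hs : -(1 / 2 : ℝ) < s.re) :
    Tendsto (fun n => gammaFactor s (n + 2)) atTop (𝓝 1) := by
  have h := ((tendsto_Gamma_ratio (c := 0) (by simp)).mul
    (tendsto_Gamma_ratio (c := s + conj s) (by simp; linarith))).div
    ((tendsto_Gamma_ratio (c := s) (by linarith)).mul
    (tendsto_Gamma_ratio (c := conj s) (by simp; linarith))) (by simp)
  simp only [mul_one, div_one] at h
  refine h.congr' ?_
  filter_upwards [eventually_gt_atTop 0] with n hn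
  have hn0 : (n : ℂ) ≠ 0 := by exact_mod_cast hn.ne'
  have hf : ((n.factorial : ℕ) : ℂ) ≠ 0 := by exact_mod_cast n.factorial_ne_zero
  have hp : (n : ℂ) ^ (1 + (0 : ℂ)) * (n : ℂ) ^ (1 + (s + conj s)) =
      (n : ℂ) ^ (1 + s) * (n : ℂ) ^ (1 + conj s) := by
    rw [← Complex.cpow_add _ _ hn0, ← Complex.cpow_add _ _ hn0]
    congr 1
    ring
  have hp1 : (n : ℂ) ^ (1 + s) ≠ 0 := by simp [Complex.cpow_eq_zero_iff, hn0]
  have hp2 : (n : ℂ) ^ (1 + conj s) ≠ 0 := by simp [Complex.cpow_eq_zero_iff, hn0]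
  simp only [Pi.div_apply]
  rw [gammaFactor, div_mul_div_comm, div_mul_div_comm, mul_mul_mul_comm, hp,
    mul_mul_mul_comm (_ ^ (1 + s)), div_div_div_cancel_right₀ (by positivity), add_zero, ← add_assoc]

/-- The two sides satisfy the same recurrence, so their quotient is constant in `N`. Both tend to
`1`, so the constant is `1`. -/
lemma meanSq_eq_gammaFactor {s : ℂ} (hs : -(1 / 2 : ℝ) < s.re) (N : ℕ) :
    (meanSq s N : ℂ) = gammaFactor s (N + 1) := by
  have hstep : ∀ N : ℕ, (meanSq s (N + 1) : ℂ) / gammaFactor s (N + 1 + 1) =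
      meanSq s N / gammaFactor s (N + 1) := by
    intro N
    have hN : (0 : ℝ) ≤ N := N.cast_nonneg
    have h1 := meanSq_succ hs N
    have h2 := gammaFactor_succ hs N
    have h1' : ((N : ℂ) + 1) * (N + 1 + 2 * s.re) * meanSq s N =
        (‖(N + 1 : ℂ) + s‖ ^ 2 : ℝ) * meanSq s (N + 1) := by exact_mod_cast h1
    have hne : ((‖(N + 1 : ℂ) + s‖ ^ 2 : ℝ) : ℂ) ≠ 0 := by
      have : (N + 1 : ℂ) + s ≠ 0 := fun h => by
        have := congrArg Complex.re h
        simp at this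
        linarith
      simpa using this
    rw [div_eq_div_iff (gammaFactor_ne_zero hs _) (gammaFactor_ne_zero hs _)]
    refine mul_left_cancel₀ hne ?_
    linear_combination (-gammaFactor s (N + 1)) * h1' + (meanSq s N : ℂ) * h2
  have hconst : ∀ N : ℕ, (meanSq s N : ℂ) / gammaFactor s (N + 1) =
      meanSq s 0 / gammaFactor s 1 := by
    intro N
    induction N with
    | zero => rfl
    | succ N ih => rw [hstep, ih]
  have hlim : Tendsto (fun N : ℕ => (meanSq s (N + 1) : ℂ) / gammaFactor s (N + 2)) atTop
      (𝓝 (1 / 1)) := by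
    refine Tendsto.div ?_ (tendsto_gammaFactor hs) one_ne_zero
    have := (Complex.continuous_ofReal.tendsto 1).comp
      ((tendsto_add_atTop_iff_nat 1).2 (tendsto_meanSq hs))
    simpa [Function.comp_def] using this
  simp only [hconst (_ + 1)] at hlim
  have h1 := tendsto_nhds_unique hlim tendsto_const_nhds
  rw [div_one] at h1
  have h2 := (hconst N).trans h1.symm
  rwa [div_eq_one_iff_eq (gammaFactor_ne_zero hs N)] at h2

/-! ### Projective limits of probability measures along a sequence of maps -/

/-- A consistent sequence of probability measures on standard Borel spaces is realized by a measure
on the space of sequences, concentrated on the projective limit. -/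
theorem exists_measure_of_consistent {X : ℕ → Type} [∀ n, MeasurableSpace (X n)]
    [∀ n, StandardBorelSpace (X n)] [∀ n, Nonempty (X n)] (p : ∀ n, X (n + 1) → X n)
    (hp : ∀ n, Measurable (p n)) (μ : ∀ n, Measure (X n)) [∀ n, IsProbabilityMeasure (μ n)]
    (hμ : ∀ n, (μ (n + 1)).map (p n) = μ n) :
    ∃ P : Measure (Π n, X n), (∀ n, P.map (fun x => x n) = μ n) ∧
      ∀ᵐ x ∂P, ∀ n, p n (x (n + 1)) = x n := by
  let ev : ∀ n, (Π i : Finset.Iic n, X i) → X n := fun n h => h ⟨n, by simp⟩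
  have hev : ∀ n, Measurable (ev n) := fun n => measurable_pi_apply _
  let cd : ∀ n, ProbabilityTheory.Kernel (X n) (X (n + 1)) :=
    fun n => ProbabilityTheory.condDistrib id (p n) (μ (n + 1))
  -- The transition to level `n + 1` is the conditional law of a `μ (n + 1)`-point given its
  -- projection. It sees the past only through the current coordinate.
  let κ : ∀ n, ProbabilityTheory.Kernel (Π i : Finset.Iic n, X i) (X (n + 1)) :=
    fun n => (cd n).comap (ev n) (hev n)
  have hκ : ∀ n, ProbabilityTheory.IsMarkovKernel (κ n) := fun n =>
    ProbabilityTheory.Kernel.IsMarkovKernel.comap _ (hev n)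
  set P := ProbabilityTheory.Kernel.trajMeasure (μ 0) κ with hP
  -- Two consecutive coordinates are distributed as `(p y, y)` with `y` of law `μ (n + 1)`. This
  -- gives both the next marginal and the almost sure relation `p x_{n+1} = x_n`.
  have hpair : ∀ n, P.map (fun x => x n) = μ n →
      P.map (fun x => (x n, x (n + 1))) = (μ (n + 1)).map fun y => (p n y, y) := by
    intro n hn
    have h1 : P.map (fun x => (x n, x (n + 1))) =
        ((P.map (Preorder.frestrictLe n)).compProd (κ n)).map (Prod.map (ev n) id) := by
      rw [hP, ProbabilityTheory.Kernel.map_frestrictLe_trajMeasure_compProd_eq_map_trajMeasure,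
        Measure.map_map ((hev n).prodMap measurable_id) (by fun_prop)]
      rfl
    have h2 : (μ (n + 1)).map (fun y => (p n y, y)) = (μ n).compProd (cd n) := by
      rw [← hμ n]
      exact (ProbabilityTheory.compProd_map_condDistrib measurable_id.aemeasurable).symm
    have h3 : (P.map (Preorder.frestrictLe n)).map (ev n) = μ n := by
      rw [Measure.map_map (hev n) (by fun_prop), ← hn]
      rfl
    rw [h1, h2]
    ext E hE
    rw [Measure.map_apply ((hev n).prodMap measurable_id) hE,
      Measure.compProd_apply (((hev n).prodMap measurable_id) hE), Measure.compProd_apply hE, ← h3,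
      lintegral_map (ProbabilityTheory.Kernel.measurable_kernel_prodMk_left hE) (hev n)]
    rfl
  have hmarg : ∀ n, P.map (fun x => x n) = μ n := by
    intro n
    induction n with
    | zero =>
      let e : X 0 → (Π i : Finset.Iic 0, X i) :=
        (MeasurableEquiv.piUnique (fun i : Finset.Iic 0 => X i)).symm
      have he : Measurable e := MeasurableEquiv.measurable _
      have h1 : P.map (Preorder.frestrictLe 0) = (μ 0).map e := by
        rw [hP, ProbabilityTheory.Kernel.trajMeasure, Measure.map_comp _ _ (by fun_prop),
          ProbabilityTheory.Kernel.traj_map_frestrictLe,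
          ProbabilityTheory.Kernel.partialTraj_self, Measure.id_comp]
        rfl
      have h2 : P.map (fun x => x 0) = (P.map (Preorder.frestrictLe 0)).map (ev 0) := by
        rw [Measure.map_map (hev 0) (by fun_prop)]
        rfl
      rw [h2, h1, Measure.map_map (hev 0) he]
      exact Measure.map_id
    | succ n ih =>
      have h1 := congrArg (fun ν => ν.map Prod.snd) (hpair n ih)
      rw [Measure.map_map measurable_snd (by fun_prop),
        Measure.map_map (f := fun y => (p n y, y)) measurable_snd ((hp n).prodMk measurable_id)] at h1
      refine Eq.trans ?_ (h1.trans ?_)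
      · rfl
      · exact Measure.map_id
  refine ⟨P, hmarg, ae_all_iff.2 fun n => ?_⟩
  have hD : MeasurableSet {q : X n × X (n + 1) | p n q.2 = q.1} :=
    measurableSet_eq_fun ((hp n).comp measurable_snd) measurable_fst
  have h1 : ∀ᵐ q ∂(P.map fun x => (x n, x (n + 1))), p n q.2 = q.1 := by
    rw [hpair n (hmarg n), ae_map_iff (f := fun y => (p n y, y)) ((hp n).prodMk measurable_id).aemeasurable hD]
    exact Eventually.of_forall fun y => rfl
  exact ae_of_ae_map (by fun_prop) h1

instance (N : ℕ) : PolishSpace (UN N) := (isClosedEmbedding_coe N).polishSpace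

lemma measurable_piN (N : ℕ) : Measurable (piN N) :=
  (measurable_pi_apply N).comp measurable_subtype_coe

/-- Every consistent sequence of probability measures on the groups `U(N)` has a projective limit on
the space of virtual unitary matrices. -/
theorem exists_measure_virtualUnitary (μ : ∀ N, Measure (UN N)) [∀ N, IsProbabilityMeasure (μ N)]
    (hμ : ∀ N, (μ (N + 1)).map (proj N) = μ N) :
    ∃ P : Measure VirtualUnitary, ∀ N, P.map (piN N) = μ N := by
  obtain ⟨P, h1, h2⟩ := exists_measure_of_consistent proj measurable_proj μ hμ
  have hS : MeasurableSet {x : ∀ N, UN N | ∀ N, proj N (x (N + 1)) = x N} := by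
    rw [Set.ofPred_forall]
    exact MeasurableSet.iInter fun N => measurableSet_eq_fun
      ((measurable_proj N).comp (measurable_pi_apply _)) (measurable_pi_apply _)
  have h3 := map_comap_subtype_coe hS P
  -- Since `P` gives full mass to the consistent sequences, restriction to the subtype loses
  -- nothing.
  rw [Measure.restrict_eq_self_of_ae_mem (s := {x : ∀ N, UN N | ∀ N, proj N (x (N + 1)) = x N}) h2]
    at h3
  refine ⟨P.comap Subtype.val, fun N => ?_⟩
  rw [← h1 N]
  conv_rhs => rw [← h3]
  rw [Measure.map_map (measurable_pi_apply N) measurable_subtype_coe]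
  rfl

/-! ### Cylinder sets and uniqueness of measures -/

lemma piN_eq_projLE {N M : ℕ} (h : N ≤ M) : piN N = projLE h ∘ piN M :=
  funext fun x => (projLE_piN h x).symm

lemma measurable_projLE {N M : ℕ} (h : N ≤ M) : Measurable (projLE h) := by
  induction M, h using Nat.le_induction with
  | base => simpa using measurable_id
  | succ M h ih =>
    rw [projLE_succ h]
    exact ih.comp (measurable_proj M)

/-- The cylinder sets. -/
def cylinders : Set (Set VirtualUnitary) :=
  {A | ∃ (N : ℕ) (S : Set (UN N)), MeasurableSet S ∧ A = piN N ⁻¹' S}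

lemma isPiSystem_cylinders : IsPiSystem cylinders := by
  rintro _ ⟨N, S, hS, rfl⟩ _ ⟨M, T, hT, rfl⟩ _
  refine ⟨max N M, projLE (le_max_left N M) ⁻¹' S ∩ projLE (le_max_right N M) ⁻¹' T,
    (measurable_projLE _ hS).inter (measurable_projLE _ hT), ?_⟩
  rw [piN_eq_projLE (le_max_left N M), piN_eq_projLE (le_max_right N M)]
  rfl

lemma generateFrom_cylinders :
    (inferInstance : MeasurableSpace VirtualUnitary) = MeasurableSpace.generateFrom cylinders := by
  refine le_antisymm ?_ (MeasurableSpace.generateFrom_le ?_)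
  · change MeasurableSpace.comap Subtype.val MeasurableSpace.pi ≤ _
    rw [MeasurableSpace.pi, MeasurableSpace.comap_iSup]
    refine iSup_le fun N => ?_
    rw [MeasurableSpace.comap_comp]
    rintro _ ⟨S, hS, rfl⟩
    exact MeasurableSpace.measurableSet_generateFrom ⟨N, S, hS, rfl⟩
  · rintro _ ⟨N, S, hS, rfl⟩
    exact measurable_piN N hS

/-- A finite measure on the space of virtual unitary matrices is determined by its images in `U(N)`
for large `N`. -/
theorem ext_of_map_piN {μ ν : Measure VirtualUnitary} [IsFiniteMeasure μ] (M : ℕ)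
    (h : ∀ N, M ≤ N → μ.map (piN N) = ν.map (piN N)) : μ = ν := by
  refine ext_of_generate_finite cylinders generateFrom_cylinders isPiSystem_cylinders ?_ ?_
  · rintro _ ⟨N, S, hS, rfl⟩
    have hT := measurable_projLE (le_max_left N M) hS
    have := congrArg (fun m => m (projLE (le_max_left N M) ⁻¹' S)) (h _ (le_max_right N M))
    rwa [Measure.map_apply (measurable_piN _) hT, Measure.map_apply (measurable_piN _) hT,
      ← Set.preimage_comp, ← piN_eq_projLE] at this
  · have := congrArg (fun m => m Set.univ) (h M le_rfl)
    rwa [Measure.map_apply (measurable_piN _) MeasurableSet.univ,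
      Measure.map_apply (measurable_piN _) MeasurableSet.univ, Set.preimage_univ] at this

/-! ### The measures `μ_N^{(s)}` -/

lemma meanSq_pos {s : ℂ} (hs : -(1 / 2 : ℝ) < s.re) (N : ℕ) : 0 < meanSq s N := by
  refine lt_of_le_of_ne (integral_nonneg fun _ => by positivity) fun h => ?_
  have := meanSq_eq_gammaFactor hs N
  rw [← h, Complex.ofReal_zero] at this
  exact gammaFactor_ne_zero hs N this.symm

lemma gammaConst_eq_prod {s : ℂ} (hs : -(1 / 2 : ℝ) < s.re) (N : ℕ) :
    gammaConst s N = ∏ k ∈ Finset.range N, meanSq s k := by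
  have h : ∏ k ∈ Finset.Icc 1 N, Complex.Gamma k * Complex.Gamma (k + s + conj s) /
      (Complex.Gamma (k + s) * Complex.Gamma (k + conj s)) =
      ((∏ k ∈ Finset.range N, meanSq s k : ℝ) : ℂ) := by
    rw [Complex.ofReal_prod, Finset.range_eq_Ico, Finset.prod_congr rfl
      fun k _ => meanSq_eq_gammaFactor hs k, Finset.prod_Ico_add' (gammaFactor s) 0 N 1]
    rfl
  rw [gammaConst, h, Complex.ofReal_re]

lemma gammaConst_zero (s : ℂ) : gammaConst s 0 = 1 := by simp [gammaConst]

lemma gammaConst_succ {s : ℂ} (hs : -(1 / 2 : ℝ) < s.re) (N : ℕ) :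
    gammaConst s (N + 1) = gammaConst s N * meanSq s N := by
  rw [gammaConst_eq_prod hs, gammaConst_eq_prod hs, Finset.prod_range_succ]

lemma gammaConst_pos {s : ℂ} (hs : -(1 / 2 : ℝ) < s.re) (N : ℕ) : 0 < gammaConst s N := by
  rw [gammaConst_eq_prod hs]
  exact Finset.prod_pos fun k _ => meanSq_pos hs k

lemma lintegral_vzw {s : ℂ} (hs : -(1 / 2 : ℝ) < s.re) (N : ℕ) :
    ∫⁻ U, ‖vzw s 0 (eps N U)‖ₑ ^ 2 ∂(haarN (N + 1)) = ENNReal.ofReal (meanSq s N) := by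
  rw [meanSq, ofReal_integral_eq_lintegral_ofReal
    (integrable_norm_vzw_sq N (by simpa using hs)) (Eventually.of_forall fun _ => by positivity)]
  refine lintegral_congr fun U => ?_
  rw [ENNReal.ofReal_pow (norm_nonneg _), ofReal_norm]

/-- Integration over `U(N+1)` of products of a function of `p(U)` and `|v(U_{N+1,N+1})|²`. -/
lemma lintegral_proj_mul_vzw {s : ℂ} (hs : -(1 / 2 : ℝ) < s.re) {N : ℕ} {h : UN N → ℝ≥0∞}
    (hh : Measurable h) :
    ∫⁻ U, h (proj N U) * ‖vzw s 0 (eps N U)‖ₑ ^ 2 ∂(haarN (N + 1)) =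
      ENNReal.ofReal (meanSq s N) * ∫⁻ U, h U ∂(haarN N) := by
  set c := ENNReal.ofReal (meanSq s N) with hc
  have hc0 : c ≠ 0 := by simpa [hc] using meanSq_pos hs N
  have hct : c ≠ ∞ := ENNReal.ofReal_ne_top
  have hv : Measurable fun D => ‖vzw s 0 D‖ₑ ^ 2 := (measurable_vzw s 0).enorm.pow_const 2
  have hg : Measurable fun D => c⁻¹ * ‖vzw s 0 D‖ₑ ^ 2 := hv.const_mul _
  have h1 : ∫⁻ U, c⁻¹ * ‖vzw s 0 (eps N U)‖ₑ ^ 2 ∂(haarN (N + 1)) = 1 := by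
    rw [lintegral_const_mul (f := fun U => ‖vzw s 0 (eps N U)‖ₑ ^ 2) _
      (hv.comp (measurable_eps N)), lintegral_vzw hs, ENNReal.inv_mul_cancel hc0 hct]
  -- The image under `p` of Haar measure weighted by a normalized function of `D` is again Haar: in
  -- effect `p(U)` and `D` are independent.
  have h2 := map_proj_withDensity N hg h1
  rw [← h2, lintegral_map hh (measurable_proj N), lintegral_withDensity_eq_lintegral_mul _
    (f := fun U => c⁻¹ * ‖vzw s 0 (eps N U)‖ₑ ^ 2) (hg.comp (measurable_eps N))
    (g := fun U => h (proj N U)) (hh.comp (measurable_proj N)),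
    ← lintegral_const_mul (f := (fun U => c⁻¹ * ‖vzw s 0 (eps N U)‖ₑ ^ 2) * fun U => h (proj N U)) _
      (((hg.comp (measurable_eps N))).mul (hh.comp (measurable_proj N)))]
  refine lintegral_congr fun U => ?_
  simp only [Pi.mul_apply]
  rw [← mul_assoc, ← mul_assoc, ENNReal.mul_inv_cancel hc0 hct, one_mul, mul_comm]

/-- The density of `μ_N^{(s)}`. -/
def muDens (s : ℂ) (N : ℕ) (U : UN N) : ℝ≥0∞ :=
  ENNReal.ofReal ((gammaConst s N)⁻¹ * ‖fzw s 0 N U‖ ^ 2)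

lemma muN_eq (s : ℂ) (N : ℕ) : muN s N = (haarN N).withDensity (muDens s N) := rfl

lemma measurable_muDens (s : ℂ) (N : ℕ) : Measurable (muDens s N) :=
  (((measurable_fzw s 0 N).norm.pow_const 2).const_mul _).ennreal_ofReal

lemma muDens_succ {s : ℂ} (hs : -(1 / 2 : ℝ) < s.re) {N : ℕ} (U : UN (N + 1)) :
    muDens s (N + 1) U = muDens s N (proj N U) * ‖vzw s 0 (eps N U)‖ₑ ^ 2 *
      (ENNReal.ofReal (meanSq s N))⁻¹ := by
  have hm := meanSq_pos hs N
  have hg := gammaConst_pos hs N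
  rw [muDens, muDens, fzw_succ, gammaConst_succ hs, ← ofReal_norm, ← ENNReal.ofReal_pow
    (norm_nonneg _), ← ENNReal.ofReal_inv_of_pos hm, ← ENNReal.ofReal_mul (by positivity),
    ← ENNReal.ofReal_mul (by positivity)]
  congr 1
  rw [norm_mul, mul_inv]
  ring

/-- Integrating out the corner entry costs the factor `meanSq s N`, which is exactly the quotient of
consecutive normalization constants. This is where the Gamma evaluation is needed. -/
lemma muN_map_proj {s : ℂ} (hs : -(1 / 2 : ℝ) < s.re) (N : ℕ) :
    (muN s (N + 1)).map (proj N) = muN s N := by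
  have hc0 : ENNReal.ofReal (meanSq s N) ≠ 0 := by simpa using meanSq_pos hs N
  ext S hS
  have hm := measurable_proj N hS
  rw [Measure.map_apply (measurable_proj N) hS, muN_eq, muN_eq, withDensity_apply _ hm,
    withDensity_apply _ hS, ← lintegral_indicator hm, ← lintegral_indicator hS]
  have hmeas : Measurable (S.indicator (muDens s N)) := (measurable_muDens s N).indicator hS
  have key := lintegral_proj_mul_vzw hs hmeas
  have e : ∀ U : UN (N + 1), (proj N ⁻¹' S).indicator (muDens s (N + 1)) U =
      S.indicator (muDens s N) (proj N U) * ‖vzw s 0 (eps N U)‖ₑ ^ 2 *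
        (ENNReal.ofReal (meanSq s N))⁻¹ := by
    intro U
    by_cases hU : proj N U ∈ S
    · rw [Set.indicator_of_mem (by exact hU), Set.indicator_of_mem hU, muDens_succ hs]
    · rw [Set.indicator_of_notMem (by exact hU), Set.indicator_of_notMem hU, zero_mul, zero_mul]
  simp only [e]
  rw [lintegral_mul_const (f := fun U => S.indicator (muDens s N) (proj N U) *
    ‖vzw s 0 (eps N U)‖ₑ ^ 2) _ ((hmeas.comp (measurable_proj N)).mul
    (((measurable_vzw s 0).comp (measurable_eps N)).enorm.pow_const 2)), key, mul_comm,
    ← mul_assoc, ENNReal.inv_mul_cancel hc0 ENNReal.ofReal_ne_top, one_mul]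

lemma isProbabilityMeasure_muN {s : ℂ} (hs : -(1 / 2 : ℝ) < s.re) (N : ℕ) :
    IsProbabilityMeasure (muN s N) := by
  induction N with
  | zero =>
    have : muN s 0 = haarN 0 := by
      rw [muN_eq, show muDens s 0 = 1 from funext fun U => by
        simp [muDens, gammaConst_zero, fzw_zero], withDensity_one]
    rw [this]
    infer_instance
  | succ N ih =>
    refine ⟨?_⟩
    rw [← Set.preimage_univ (f := proj N), ← Measure.map_apply (measurable_proj N)
      MeasurableSet.univ, muN_map_proj hs, measure_univ]

/-! ### The measure `μ^{(s)}` -/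

lemma map_piN_muS {s : ℂ} (hs : -(1 / 2 : ℝ) < s.re) : IsProjectiveLimitMeasure s (muS s) := by
  have := isProbabilityMeasure_muN hs
  have h : ∃ μ : Measure VirtualUnitary, IsProjectiveLimitMeasure s μ :=
    exists_measure_virtualUnitary (muN s) (muN_map_proj hs)
  rw [muS, dif_pos h]
  exact h.choose_spec

lemma isProbabilityMeasure_of_isProjectiveLimit {s : ℂ} (hs : -(1 / 2 : ℝ) < s.re)
    {μ : Measure VirtualUnitary} (h : IsProjectiveLimitMeasure s μ) : IsProbabilityMeasure μ := by
  have := isProbabilityMeasure_muN hs 0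
  refine ⟨?_⟩
  rw [← Set.preimage_univ (f := piN 0), ← Measure.map_apply (measurable_piN 0)
    MeasurableSet.univ, h, measure_univ]

lemma eq_muS {s : ℂ} (hs : -(1 / 2 : ℝ) < s.re) {μ : Measure VirtualUnitary}
    (h : IsProjectiveLimitMeasure s μ) : μ = muS s := by
  have := isProbabilityMeasure_of_isProjectiveLimit hs h
  exact ext_of_map_piN 0 fun N _ => (h N).trans (map_piN_muS hs N).symm

/-! ### Normalized functions and cylinder functions -/

lemma enorm_sq_eq (x : ℂ) : ‖x‖ₑ ^ 2 = ENNReal.ofReal (‖x‖ ^ 2) := by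
  rw [← ofReal_norm, ENNReal.ofReal_pow (norm_nonneg _)]

lemma eLpNorm_two {α : Type*} [MeasurableSpace α] (f : α → ℂ) (μ : Measure α) :
    eLpNorm f 2 μ = (∫⁻ x, ‖f x‖ₑ ^ 2 ∂μ) ^ (1 / 2 : ℝ) := by
  rw [eLpNorm_eq_lintegral_rpow_enorm_toReal two_ne_zero ENNReal.ofNat_ne_top]
  simp only [ENNReal.toReal_ofNat, ENNReal.rpow_ofNat]

/-- The function `f_{z,w|N}` divided by the square root of `gammaConst s N`. -/
def fzwUnit (s z w : ℂ) (N : ℕ) (U : UN N) : ℂ :=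
  fzw z w N U / ((Real.sqrt (gammaConst s N) : ℝ) : ℂ)

lemma measurable_fzwUnit (s z w : ℂ) (N : ℕ) : Measurable (fzwUnit s z w N) :=
  (measurable_fzw z w N).div_const _

/-- By induction along the factorization: the corner factor vanishes only at `D = -1`, a null event.
Every later division by `f_{z,w|N}` rests on this. -/
lemma ae_fzw_ne_zero (z w : ℂ) (N : ℕ) : ∀ᵐ U ∂haarN N, fzw z w N U ≠ 0 := by
  induction N with
  | zero => exact Eventually.of_forall fun U => by simp [fzw_zero]
  | succ N ih =>
    filter_upwards [(measurePreserving_proj N).quasiMeasurePreserving.ae ih, ae_eps_ne N]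
      with U h1 h2
    rw [fzw_succ]
    exact mul_ne_zero h1 (mt (vzw_eq_zero_iff z w _).1 h2)

section Fixed

variable {s z w : ℂ}

lemma sqrt_gammaConst_ne_zero (hs : -(1 / 2 : ℝ) < s.re) (N : ℕ) :
    ((Real.sqrt (gammaConst s N) : ℝ) : ℂ) ≠ 0 :=
  Complex.ofReal_ne_zero.2 (Real.sqrt_pos.2 (gammaConst_pos hs N)).ne'

lemma fzwUnit_eq_zero_iff (hs : -(1 / 2 : ℝ) < s.re) {N : ℕ} (U : UN N) :
    fzwUnit s z w N U = 0 ↔ fzw z w N U = 0 := by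
  simp [fzwUnit, sqrt_gammaConst_ne_zero hs N]

lemma ae_fzwUnit_ne_zero (z w : ℂ) (hs : -(1 / 2 : ℝ) < s.re) (N : ℕ) :
    ∀ᵐ U ∂haarN N, fzwUnit s z w N U ≠ 0 := by
  filter_upwards [ae_fzw_ne_zero z w N] with U hU
  exact mt (fzwUnit_eq_zero_iff hs U).1 hU

/-- Because `|f_{z,w|N}|` depends on `z + w̄` only, one measure serves every pair with the same `s`.
-/
lemma enorm_fzwUnit_sq (hs : -(1 / 2 : ℝ) < s.re) (hzw : z + conj w = s) {N : ℕ} (U : UN N) :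
    ‖fzwUnit s z w N U‖ₑ ^ 2 = muDens s N U := by
  rw [enorm_sq_eq, muDens, fzwUnit, norm_div, norm_fzw_eq, hzw, Complex.norm_real,
    Real.norm_of_nonneg (Real.sqrt_nonneg _), div_pow, Real.sq_sqrt (gammaConst_pos hs N).le,
    div_eq_inv_mul]

lemma vNorm_eq (hs : -(1 / 2 : ℝ) < s.re) (hzw : z + conj w = s) (N : ℕ) :
    vNorm z w N = Real.sqrt (meanSq s N) := by
  have hm : Measurable fun D => ‖vzw z w D‖ₑ ^ 2 := (measurable_vzw z w).enorm.pow_const 2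
  have h1 : ∫⁻ U, ‖vzw z w (eps N U)‖ₑ ^ 2 ∂(haarN (N + 1)) = ENNReal.ofReal (meanSq s N) := by
    rw [← lintegral_vzw hs]
    refine lintegral_congr fun U => ?_
    rw [enorm_sq_eq, norm_vzw_eq z w (norm_eps_le N U), hzw, ← enorm_sq_eq]
  rw [vNorm, eLpNorm_two, nuN, lintegral_map hm (measurable_eps N), h1, Real.sqrt_eq_rpow,
    ← ENNReal.toReal_rpow, ENNReal.toReal_ofReal (meanSq_pos hs N).le]

/-- The factorization of `f_{z,w|N}` with both factors normalized: `‖v_{z,w}‖²` is the quotient of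
consecutive constants. -/
lemma fzwUnit_succ (hs : -(1 / 2 : ℝ) < s.re) (hzw : z + conj w = s) {N : ℕ} (U : UN (N + 1)) :
    fzwUnit s z w (N + 1) U = tensorFun z w N (fzwUnit s z w N) U := by
  rw [tensorFun, fzwUnit, fzwUnit, vzwNormalized, fzw_succ, vNorm_eq hs hzw, gammaConst_succ hs,
    Real.sqrt_mul (gammaConst_pos hs N).le, Complex.ofReal_mul, div_mul_div_comm]

lemma map_piN_absolutelyContinuous (hs : -(1 / 2 : ℝ) < s.re) (N : ℕ) :
    (muS s).map (piN N) ≪ haarN N := by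
  rw [map_piN_muS hs N]
  exact withDensity_absolutelyContinuous _ _

lemma quasiMeasurePreserving_piN (hs : -(1 / 2 : ℝ) < s.re) (N : ℕ) :
    Measure.QuasiMeasurePreserving (piN N) (muS s) (haarN N) :=
  ⟨measurable_piN N, map_piN_absolutelyContinuous hs N⟩

lemma ae_fzw_piN_ne_zero (hs : -(1 / 2 : ℝ) < s.re) (z w : ℂ) (N : ℕ) :
    ∀ᵐ x ∂muS s, fzw z w N (piN N x) ≠ 0 :=
  (quasiMeasurePreserving_piN hs N).ae (ae_fzw_ne_zero z w N)

/-- The function on `𝔘` attached to a function on `U(N)`: its quotient by the normalized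
`f_{z,w|N}`, pulled back along `π_N`. -/
def cylFun (s z w : ℂ) (N : ℕ) (f : UN N → ℂ) (x : VirtualUnitary) : ℂ :=
  f (piN N x) / fzwUnit s z w N (piN N x)

lemma cylFun_ae (hs : -(1 / 2 : ℝ) < s.re) {N : ℕ} {f g : UN N → ℂ} (h : f =ᵐ[haarN N] g) :
    cylFun s z w N f =ᵐ[muS s] cylFun s z w N g := by
  filter_upwards [(quasiMeasurePreserving_piN hs N).ae h] with x hx
  simp [cylFun, hx]

lemma lintegral_comp_piN (hs : -(1 / 2 : ℝ) < s.re) {N : ℕ} {h : UN N → ℝ≥0∞}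
    (hh : Measurable h) :
    ∫⁻ x, h (piN N x) ∂muS s = ∫⁻ U, muDens s N U * h U ∂haarN N := by
  rw [← lintegral_map hh (measurable_piN N), map_piN_muS hs N, muN_eq,
    lintegral_withDensity_eq_lintegral_mul _ (measurable_muDens s N) hh]
  rfl

/-- The squared modulus of the divisor cancels the density of `μ_N^{(s)}`. -/
lemma eLpNorm_cylFun (hs : -(1 / 2 : ℝ) < s.re) (hzw : z + conj w = s) {N : ℕ} {f : UN N → ℂ}
    (hf : AEStronglyMeasurable f (haarN N)) :
    eLpNorm (cylFun s z w N f) 2 (muS s) = eLpNorm f 2 (haarN N) := by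
  obtain ⟨f', hf', he⟩ := hf
  rw [eLpNorm_congr_ae he, eLpNorm_congr_ae (cylFun_ae hs he), eLpNorm_two, eLpNorm_two]
  congr 1
  have hm : Measurable fun U => ‖f' U / fzwUnit s z w N U‖ₑ ^ 2 :=
    (hf'.measurable.div (measurable_fzwUnit s z w N)).enorm.pow_const 2
  refine (lintegral_comp_piN hs hm).trans (lintegral_congr_ae ?_)
  filter_upwards [ae_fzwUnit_ne_zero z w hs N] with U hU
  rw [← enorm_fzwUnit_sq hs hzw, ← mul_pow, ← enorm_mul, mul_div_cancel₀ _ hU]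

lemma memLp_cylFun (hs : -(1 / 2 : ℝ) < s.re) (hzw : z + conj w = s) {N : ℕ} {f : UN N → ℂ}
    (hf : MemLp f 2 (haarN N)) : MemLp (cylFun s z w N f) 2 (muS s) := by
  refine ⟨?_, ?_⟩
  · have h1 : AEStronglyMeasurable (fun U => f U / fzwUnit s z w N U) (haarN N) :=
      (hf.1.aemeasurable.div (measurable_fzwUnit s z w N).aemeasurable).aestronglyMeasurable
    exact h1.comp_quasiMeasurePreserving (quasiMeasurePreserving_piN hs N)
  · rw [eLpNorm_cylFun hs hzw hf.1]
    exact hf.2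

/-- The isometric embedding of `H_N` into `L²(𝔘, μ^{(s)})` attached to `f_{z,w|N}`. -/
def cylIsom (hs : -(1 / 2 : ℝ) < s.re) (hzw : z + conj w = s) (N : ℕ) :
    HN N →ₗᵢ[ℂ] Lp ℂ 2 (muS s) where
  toFun f := (memLp_cylFun hs hzw (Lp.memLp f)).toLp _
  map_add' f g := by
    rw [← MemLp.toLp_add]
    refine MemLp.toLp_congr _ _ ?_
    refine (cylFun_ae hs (Lp.coeFn_add f g)).trans (Eventually.of_forall fun x => ?_)
    simp [cylFun, add_div]
  map_smul' c f := by
    rw [RingHom.id_apply, ← MemLp.toLp_const_smul]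
    refine MemLp.toLp_congr _ _ ?_
    refine (cylFun_ae hs (Lp.coeFn_smul c f)).trans (Eventually.of_forall fun x => ?_)
    simp [cylFun, mul_div_assoc]
  norm_map' f := by
    change ‖(memLp_cylFun hs hzw (Lp.memLp f)).toLp _‖ = ‖f‖
    rw [Lp.norm_toLp, eLpNorm_cylFun hs hzw (Lp.aestronglyMeasurable f), Lp.norm_def]

lemma coeFn_cylIsom (hs : -(1 / 2 : ℝ) < s.re) (hzw : z + conj w = s) {N : ℕ} (f : HN N) :
    cylIsom hs hzw N f =ᵐ[muS s] cylFun s z w N f :=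
  MemLp.coeFn_toLp (memLp_cylFun hs hzw (Lp.memLp f))

lemma cylIsom_toLp (hs : -(1 / 2 : ℝ) < s.re) (hzw : z + conj w = s) {N : ℕ} {f : UN N → ℂ}
    (hf : MemLp f 2 (haarN N)) :
    cylIsom hs hzw N (hf.toLp f) =ᵐ[muS s] cylFun s z w N f :=
  (coeFn_cylIsom hs hzw _).trans (cylFun_ae hs hf.coeFn_toLp)

/-- Both the function `f ⊗ v'` and the divisor at level `N + 1` carry the factor `v'(D)`, which
cancels where it is nonzero. -/
lemma cylIsom_Lemb (hs : -(1 / 2 : ℝ) < s.re) (hzw : z + conj w = s) {N : ℕ} (f : HN N) :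
    cylIsom hs hzw (N + 1) (Lemb z w (re_add_re_of_eq hs hzw) N f) = cylIsom hs hzw N f := by
  refine Lp.ext ?_
  filter_upwards [coeFn_cylIsom hs hzw (Lemb z w (re_add_re_of_eq hs hzw) N f),
    cylFun_ae (z := z) (w := w) hs (coeFn_Lemb z w (re_add_re_of_eq hs hzw) f),
    coeFn_cylIsom hs hzw f, (quasiMeasurePreserving_piN hs (N + 1)).ae
      (ae_fzwUnit_ne_zero z w hs (N + 1))] with x e1 e2 e3 hne
  have hx : proj N (piN (N + 1) x) = piN N x := x.2 N
  rw [e1, e2, e3, cylFun, cylFun]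
  rw [fzwUnit_succ hs hzw] at hne ⊢
  simp only [tensorFun, hx] at hne ⊢
  exact mul_div_mul_right _ _ (right_ne_zero_of_mul hne)

end Fixed

/-! ### Hilbert spaces exhausted by compatible isometries -/

section Colimit

variable {E : ℕ → Type} [∀ n, NormedAddCommGroup (E n)] [∀ n, InnerProductSpace ℂ (E n)]
  {L : ∀ n, E n →ₗᵢ[ℂ] E (n + 1)}
  {F : Type*} [NormedAddCommGroup F] [InnerProductSpace ℂ F]

lemma compat_isomLE {J : ∀ n, E n →ₗᵢ[ℂ] F} (hJ : ∀ n x, J (n + 1) (L n x) = J n x) {n m : ℕ}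
    (h : n ≤ m) (x : E n) : J m (isomLE L h x) = J n x := by
  induction m, h using Nat.le_induction with
  | base => simp [isomLE_self]
  | succ m h ih =>
    rw [isomLE_succ L h, ← ih]
    exact hJ m _

/-- The map from the algebraic inductive limit defined by a compatible family of isometries. -/
def preDescFun {J : ∀ n, E n →ₗᵢ[ℂ] F} (hJ : ∀ n x, J (n + 1) (L n x) = J n x)
    (x : PreColim L) : F :=
  DirectLimit.lift (fun _ _ h => isomLE L h) (fun n x => J n x)
    (fun _ _ h x => (compat_isomLE hJ h x).symm) x

lemma preDescFun_incl {J : ∀ n, E n →ₗᵢ[ℂ] F} (hJ : ∀ n x, J (n + 1) (L n x) = J n x)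
    (n : ℕ) (x : E n) : preDescFun hJ (preIncl L n x) = J n x :=
  DirectLimit.lift_def (fun _ _ h => isomLE L h) _ _ ⟨n, x⟩

/-- The linear map from the algebraic inductive limit defined by a compatible family of
isometries. -/
def preDesc {J : ∀ n, E n →ₗᵢ[ℂ] F} (hJ : ∀ n x, J (n + 1) (L n x) = J n x) :
    PreColim L →ₗ[ℂ] F where
  toFun := preDescFun hJ
  map_add' := preColim_ind₂ L fun n x y => by
    rw [← preIncl_add, preDescFun_incl, preDescFun_incl, preDescFun_incl, map_add]
  map_smul' c := preColim_ind L fun n x => by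
    rw [← preIncl_smul, preDescFun_incl, preDescFun_incl, map_smul, RingHom.id_apply]

lemma preDesc_incl {J : ∀ n, E n →ₗᵢ[ℂ] F} (hJ : ∀ n x, J (n + 1) (L n x) = J n x)
    (n : ℕ) (x : E n) : preDesc hJ (preIncl L n x) = J n x := preDescFun_incl hJ n x

lemma norm_preDesc {J : ∀ n, E n →ₗᵢ[ℂ] F} (hJ : ∀ n x, J (n + 1) (L n x) = J n x)
    (x : PreColim L) : ‖preDesc hJ (LinearEquiv.refl ℂ (PreColim L) x)‖ =
      ‖(UniformSpace.Completion.toComplₗᵢ (𝕜 := ℂ) (E := PreColim L)).toLinearMap x‖ := by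
  revert x
  refine preColim_ind L fun n x => ?_
  change ‖preDesc hJ (preIncl L n x)‖ = ‖((preIncl L n x : PreColim L) : HilbertColim L)‖
  rw [preDesc_incl, UniformSpace.Completion.norm_coe, norm_preIncl, LinearIsometry.norm_map]

variable [CompleteSpace F]

lemma denseRange_preDesc {J : ∀ n, E n →ₗᵢ[ℂ] F} (hJ : ∀ n x, J (n + 1) (L n x) = J n x)
    (hd : ∀ y : F, (∀ n x, inner ℂ (J n x) y = 0) → y = 0) : DenseRange (preDesc hJ) := by
  have h1 : Dense ((LinearMap.range (preDesc hJ) : Submodule ℂ F) : Set F) := by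
    rw [Submodule.dense_iff_topologicalClosure_eq_top, Submodule.topologicalClosure_eq_top_iff,
      Submodule.eq_bot_iff]
    intro y hy
    refine hd y fun n x => ?_
    exact hy _ ⟨preIncl L n x, preDesc_incl hJ n x⟩
  rwa [LinearMap.coe_range] at h1

/-- A Hilbert space exhausted by a compatible family of isometric embeddings is the inductive
limit. -/
def colimEquiv {J : ∀ n, E n →ₗᵢ[ℂ] F} (hJ : ∀ n x, J (n + 1) (L n x) = J n x)
    (hd : ∀ y : F, (∀ n x, inner ℂ (J n x) y = 0) → y = 0) : HilbertColim L ≃ₗᵢ[ℂ] F :=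
  (LinearEquiv.refl ℂ (PreColim L)).extendOfIsometry
    (UniformSpace.Completion.toComplₗᵢ (𝕜 := ℂ) (E := PreColim L)).toLinearMap (preDesc hJ)
    UniformSpace.Completion.denseRange_coe (denseRange_preDesc hJ hd) (norm_preDesc hJ)

lemma colimEquiv_incl {J : ∀ n, E n →ₗᵢ[ℂ] F} (hJ : ∀ n x, J (n + 1) (L n x) = J n x)
    (hd : ∀ y : F, (∀ n x, inner ℂ (J n x) y = 0) → y = 0) (n : ℕ) (x : E n) :
    colimEquiv hJ hd (incl L n x) = J n x :=
  (LinearEquiv.extendOfIsometry_eq _ _ _ _ _ (norm_preDesc hJ) (preIncl L n x)).trans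
    (preDesc_incl hJ n x)

end Colimit

/-! ### Totality of cylinder functions and the unitary equivalence -/

section Fixed

variable {s z w : ℂ}

lemma lintegral_fzwUnit_sq (hs : -(1 / 2 : ℝ) < s.re) (hzw : z + conj w = s) (N : ℕ) :
    ∫⁻ U, ‖fzwUnit s z w N U‖ₑ ^ 2 ∂haarN N = 1 := by
  have := isProbabilityMeasure_muN hs N
  simp only [enorm_fzwUnit_sq hs hzw]
  rw [← measure_univ (μ := muN s N), muN_eq, withDensity_apply _ MeasurableSet.univ,
    Measure.restrict_univ]

lemma memLp_fzwUnit (hs : -(1 / 2 : ℝ) < s.re) (hzw : z + conj w = s) (N : ℕ) :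
    MemLp (fzwUnit s z w N) 2 (haarN N) := by
  refine ⟨(measurable_fzwUnit s z w N).aestronglyMeasurable, ?_⟩
  rw [eLpNorm_two, lintegral_fzwUnit_sq hs hzw]
  simp

/-- A π-λ argument. The whole space is itself a cylinder set, which handles complements. -/
lemma integral_eq_zero_of_cylinders {μ : Measure VirtualUnitary} {f : VirtualUnitary → ℂ}
    (hf : Integrable f μ) (h : ∀ A ∈ cylinders, ∫ x in A, f x ∂μ = 0) {A : Set VirtualUnitary}
    (hA : MeasurableSet A) : ∫ x in A, f x ∂μ = 0 := by
  have huniv : ∫ x, f x ∂μ = 0 := by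
    rw [← setIntegral_univ]
    exact h _ ⟨0, Set.univ, MeasurableSet.univ, Set.preimage_univ.symm⟩
  induction A, hA using MeasurableSpace.induction_on_inter generateFrom_cylinders
    isPiSystem_cylinders with
  | empty => simp
  | basic A hA => exact h A hA
  | compl A hA ih =>
    have := integral_add_compl hA hf
    rwa [ih, huniv, zero_add] at this
  | iUnion g hd hg ih =>
    rw [integral_iUnion hg hd hf.integrableOn]
    simp [ih]

/-- The embedding sends `1_S f'_{z,w|N}` to the indicator of the cylinder over `S`. A vector
orthogonal to all images therefore has zero integral over every cylinder, hence over every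
measurable set. -/
lemma eq_zero_of_inner_cylIsom (hs : -(1 / 2 : ℝ) < s.re) (hzw : z + conj w = s)
    (F : Lp ℂ 2 (muS s)) (hF : ∀ N f, inner ℂ (cylIsom hs hzw N f) F = 0) : F = 0 := by
  have := isProbabilityMeasure_of_isProjectiveLimit hs (map_piN_muS hs)
  have hint : Integrable F (muS s) := (Lp.memLp F).integrable one_le_two
  have hcyl : ∀ A ∈ cylinders, ∫ x in A, F x ∂muS s = 0 := by
    rintro _ ⟨N, S, hS, rfl⟩
    have hm : MemLp (S.indicator (fzwUnit s z w N)) 2 (haarN N) :=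
      (memLp_fzwUnit hs hzw N).indicator hS
    have h1 := hF N (hm.toLp _)
    rw [L2.inner_def] at h1
    rw [← h1, ← integral_indicator (measurable_piN N hS)]
    refine integral_congr_ae ?_
    filter_upwards [cylIsom_toLp hs hzw hm, (quasiMeasurePreserving_piN hs N).ae
      (ae_fzwUnit_ne_zero z w hs N)] with x e1 e2
    rw [e1, cylFun]
    by_cases hx : piN N x ∈ S
    · rw [Set.indicator_of_mem (by exact hx), Set.indicator_of_mem hx, div_self e2]
      simp
    · rw [Set.indicator_of_notMem (by exact hx), Set.indicator_of_notMem hx]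
      simp
  rw [Lp.eq_zero_iff_ae_eq_zero]
  exact hint.ae_eq_zero_of_forall_setIntegral_eq_zero
    fun A hA _ => integral_eq_zero_of_cylinders hint hcyl hA

/-- The unitary equivalence between the space of `T_{z,w}` and `L²(𝔘, μ^{(s)})`. -/
def theta (hs : -(1 / 2 : ℝ) < s.re) (hzw : z + conj w = s) :
    Hzw z w (re_add_re_of_eq hs hzw) ≃ₗᵢ[ℂ] Lp ℂ 2 (muS s) :=
  colimEquiv (fun _ f => cylIsom_Lemb hs hzw f) (eq_zero_of_inner_cylIsom hs hzw)

lemma theta_incl (hs : -(1 / 2 : ℝ) < s.re) (hzw : z + conj w = s) (N : ℕ) (f : HN N) :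
    theta hs hzw (incl (Lemb z w (re_add_re_of_eq hs hzw)) N f) = cylIsom hs hzw N f :=
  colimEquiv_incl _ _ N f

end Fixed

/-! ### The action of `G` on the space of virtual unitary matrices -/

lemma measurable_of_piN {α : Type*} [MeasurableSpace α] {f : α → VirtualUnitary}
    (h : ∀ N, Measurable fun a => piN N (f a)) : Measurable f := by
  have h' : ∀ A ∈ cylinders, MeasurableSet (f ⁻¹' A) := by
    rintro _ ⟨N, S, hS, rfl⟩
    exact h N hS
  have := measurable_generateFrom h'
  rwa [← generateFrom_cylinders] at this

lemma measurable_act (g : Ginf) : Measurable fun x => act x g := by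
  obtain ⟨M, u, v, h1, h2⟩ := exists_ofUN₂ g.1 g.2
  obtain rfl : g = (ofUN M u, ofUN M v) := Prod.ext h1 h2
  refine measurable_of_piN fun N => ?_
  have h : ∀ x, piN N (act x (ofUN M u, ofUN M v)) = projLE (le_max_left N M)
      ((embLE (le_max_right N M) v)⁻¹ * piN (max N M) x * embLE (le_max_right N M) u) := by
    intro x
    rw [← piN_act (le_max_right N M), projLE_piN]
  simp only [h]
  exact (measurable_projLE _).comp (((measurable_piN _).const_mul _).mul_const _)

/-- The ratio `f_{z,w|N}(π_N(x.g)) / f_{z,w|N}(π_N(x))`. -/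
def ratio (z w : ℂ) (g : Ginf) (N : ℕ) (x : VirtualUnitary) : ℂ :=
  fzw z w N (piN N (act x g)) / fzw z w N (piN N x)

lemma measurable_ratio (z w : ℂ) (g : Ginf) (N : ℕ) : Measurable (ratio z w g N) :=
  ((measurable_fzw z w N).comp ((measurable_piN N).comp (measurable_act g))).div
    ((measurable_fzw z w N).comp (measurable_piN N))

lemma eps_piN_act {M N : ℕ} (h : M ≤ N) (u v : UN M) (x : VirtualUnitary) :
    eps N (piN (N + 1) (act x (ofUN M u, ofUN M v))) = eps N (piN (N + 1) x) := by
  rw [piN_act (Nat.le_succ_of_le h), embLE_succ h, MonoidHom.comp_apply, MonoidHom.comp_apply,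
    eps_mul_emb, ← map_inv, eps_emb_mul]

/-- Numerator and denominator acquire the same factor `v(D)`, since `g ∈ G(M)` with `M ≤ N` fixes
the corner entry at level `N + 1`. -/
lemma ratio_succ (z w : ℂ) {M N : ℕ} (h : M ≤ N) (u v : UN M) {x : VirtualUnitary}
    (hx : fzw z w (N + 1) (piN (N + 1) x) ≠ 0) :
    ratio z w (ofUN M u, ofUN M v) (N + 1) x = ratio z w (ofUN M u, ofUN M v) N x := by
  have e : ∀ y : VirtualUnitary, proj N (piN (N + 1) y) = piN N y := fun y => y.2 N
  rw [fzw_succ] at hx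
  rw [ratio, ratio, fzw_succ, fzw_succ, eps_piN_act h, e, e]
  exact mul_div_mul_right _ _ (right_ne_zero_of_mul hx)

/-- The ratios are constant from level `M` on, so the chosen stable value can be read off at any
such level. -/
lemma Czw_eq_ratio (z w : ℂ) {M : ℕ} (u v : UN M) {x : VirtualUnitary}
    (hx : ∀ N, fzw z w N (piN N x) ≠ 0) {N : ℕ} (h : M ≤ N) :
    Czw z w x (ofUN M u, ofUN M v) = ratio z w (ofUN M u, ofUN M v) N x := by
  have hc : ∀ K, M ≤ K →
      ratio z w (ofUN M u, ofUN M v) K x = ratio z w (ofUN M u, ofUN M v) M x := by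
    intro K hK
    induction K, hK using Nat.le_induction with
    | base => rfl
    | succ K hK ih => rw [ratio_succ z w hK u v (hx _), ih]
  have hex : ∃ c : ℂ, ∀ᶠ N in atTop, fzw z w N (piN N (act x (ofUN M u, ofUN M v))) /
      fzw z w N (piN N x) = c :=
    ⟨ratio z w (ofUN M u, ofUN M v) M x, eventually_atTop.2 ⟨M, fun K hK => hc K hK⟩⟩
  rw [Czw, dif_pos hex]
  obtain ⟨K, hK1, hK2⟩ := (hex.choose_spec.and (eventually_ge_atTop M)).exists
  rw [← hK1, hc N h]
  exact hc K hK2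

/-! ### Change of variables under the action -/

section Fixed

variable {s z w : ℂ}

lemma ae_Czw_eq_ratio (hs : -(1 / 2 : ℝ) < s.re) (z w : ℂ) {M : ℕ} (u v : UN M) {N : ℕ}
    (h : M ≤ N) : (fun x => Czw z w x (ofUN M u, ofUN M v)) =ᵐ[muS s]
      ratio z w (ofUN M u, ofUN M v) N := by
  filter_upwards [ae_all_iff.2 (ae_fzw_piN_ne_zero hs z w)] with x hx
  exact Czw_eq_ratio z w u v hx h

lemma ae_fzw_piN_act_ne_zero (hs : -(1 / 2 : ℝ) < s.re) (z w : ℂ) {M : ℕ} (u v : UN M) {N : ℕ}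
    (h : M ≤ N) : ∀ᵐ x ∂muS s, fzw z w N (piN N (act x (ofUN M u, ofUN M v))) ≠ 0 := by
  have := (quasiMeasurePreserving_piN hs N).ae ((measurePreserving_biregular
    (embLE h u, embLE h v)).quasiMeasurePreserving.ae (ae_fzw_ne_zero z w N))
  filter_upwards [this] with x hx
  rwa [piN_act h]

lemma ratio_eq (z w : ℂ) {M N : ℕ} (h : M ≤ N) (u v : UN M) (x : VirtualUnitary) :
    ratio z w (ofUN M u, ofUN M v) N x =
      fzw z w N ((embLE h v)⁻¹ * piN N x * embLE h u) / fzw z w N (piN N x) := by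
  rw [ratio, piN_act h]

lemma div_fzwUnit (hs : -(1 / 2 : ℝ) < s.re) {N : ℕ} (U V : UN N) :
    fzw z w N U / fzw z w N V = fzwUnit s z w N U / fzwUnit s z w N V := by
  rw [fzwUnit, fzwUnit, div_div_div_cancel_right₀ (sqrt_gammaConst_ne_zero hs N)]

/-- The density `|f'(U)|²` cancels the denominator of the ratio. What remains is a function of the
translated matrix, and Haar measure is invariant under two-sided translations. -/
lemma lintegral_ratio (hs : -(1 / 2 : ℝ) < s.re) (hzw : z + conj w = s) {M N : ℕ} (h : M ≤ N)
    (u v : UN M) {k : UN N → ℝ≥0∞} (hk : Measurable k) :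
    ∫⁻ x, k (piN N (act x (ofUN M u, ofUN M v))) * ‖ratio z w (ofUN M u, ofUN M v) N x‖ₑ ^ 2
      ∂muS s = ∫⁻ U, k U ∂muN s N := by
  have hb := measurePreserving_biregular (embLE h u, embLE h v)
  have hm : Measurable fun U : UN N => k ((embLE h v)⁻¹ * U * embLE h u) *
      ‖fzw z w N ((embLE h v)⁻¹ * U * embLE h u) / fzw z w N U‖ₑ ^ 2 :=
    (hk.comp hb.measurable).mul ((((measurable_fzw z w N).comp hb.measurable).div
      (measurable_fzw z w N)).enorm.pow_const 2)
  simp only [piN_act h, ratio_eq z w h]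
  rw [lintegral_comp_piN hs (h := fun U : UN N => k ((embLE h v)⁻¹ * U * embLE h u) *
      ‖fzw z w N ((embLE h v)⁻¹ * U * embLE h u) / fzw z w N U‖ₑ ^ 2) hm, muN_eq,
    lintegral_withDensity_eq_lintegral_mul _ (measurable_muDens s N) hk,
    ← hb.lintegral_comp ((measurable_muDens s N).mul hk)]
  refine lintegral_congr_ae ?_
  filter_upwards [ae_fzwUnit_ne_zero z w hs N] with U hU
  rw [Pi.mul_apply, div_fzwUnit hs, ← enorm_fzwUnit_sq hs hzw, ← enorm_fzwUnit_sq hs hzw,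
    mul_left_comm, ← mul_pow, ← enorm_mul, mul_div_cancel₀ _ hU, mul_comm]

lemma map_act_withDensity (hs : -(1 / 2 : ℝ) < s.re) (hzw : z + conj w = s) {M : ℕ} (u v : UN M) :
    ((muS s).withDensity fun x => ‖ratio z w (ofUN M u, ofUN M v) M x‖ₑ ^ 2).map
      (fun x => act x (ofUN M u, ofUN M v)) = muS s := by
  have := isProbabilityMeasure_of_isProjectiveLimit hs (map_piN_muS hs)
  refine (ext_of_map_piN M fun N hN => ?_).symm
  -- The density may be taken at level `N` instead of `M`, so that it depends on the same coordinate
  -- as the test set.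
  have hdens : (muS s).withDensity (fun x => ‖ratio z w (ofUN M u, ofUN M v) M x‖ₑ ^ 2) =
      (muS s).withDensity (fun x => ‖ratio z w (ofUN M u, ofUN M v) N x‖ₑ ^ 2) := by
    refine withDensity_congr_ae ?_
    filter_upwards [ae_Czw_eq_ratio hs z w u v le_rfl, ae_Czw_eq_ratio hs z w u v hN] with x e1 e2
    rw [← e1, ← e2]
  rw [hdens, map_piN_muS hs N, Measure.map_map (measurable_piN N) (measurable_act _)]
  ext S hS
  have hS' : MeasurableSet ((piN N ∘ fun x => act x (ofUN M u, ofUN M v)) ⁻¹' S) :=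
    ((measurable_piN N).comp (measurable_act _)) hS
  rw [Measure.map_apply ((measurable_piN N).comp (measurable_act _)) hS,
    withDensity_apply _ hS', ← lintegral_indicator hS', ← lintegral_indicator_one hS,
    ← lintegral_ratio hs hzw hN u v (measurable_one.indicator hS)]
  refine lintegral_congr fun x => ?_
  by_cases hx : piN N (act x (ofUN M u, ofUN M v)) ∈ S
  · rw [Set.indicator_of_mem hx, Set.indicator_of_mem (by exact hx), Pi.one_apply, one_mul]
  · rw [Set.indicator_of_notMem hx, Set.indicator_of_notMem (by exact hx), zero_mul]

/-- The density in `map_act_withDensity` is almost everywhere nonzero, so `μ^{(s)}` is absolutely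
continuous with respect to the weighted measure. This makes the multiplier formula independent of
representatives. -/
lemma quasiMeasurePreserving_act (hs : -(1 / 2 : ℝ) < s.re) (g : Ginf) :
    Measure.QuasiMeasurePreserving (fun x => act x g) (muS s) (muS s) := by
  obtain ⟨M, u, v, h1, h2⟩ := exists_ofUN₂ g.1 g.2
  obtain rfl : g = (ofUN M u, ofUN M v) := Prod.ext h1 h2
  -- The statement does not involve `z` and `w`, so the pair `(s, 0)` is used.
  have hzw : s + conj (0 : ℂ) = s := by simp
  refine ⟨measurable_act _, ?_⟩
  conv_rhs => rw [← map_act_withDensity hs hzw u v]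
  refine Measure.AbsolutelyContinuous.map ?_ (measurable_act _)
  refine withDensity_absolutelyContinuous'
    ((measurable_ratio s 0 _ M).enorm.pow_const 2).aemeasurable ?_
  filter_upwards [ae_fzw_piN_act_ne_zero hs s 0 u v le_rfl, ae_fzw_piN_ne_zero hs s 0 M] with x h1 h2
  simp [ratio, h1, h2]

/-! ### The multiplier operators and their identification with `T_{z,w}` -/

/-- The function `x ↦ f(x.g) C_{z,w}(x, g)`. -/
def shiftFun (z w : ℂ) (g : Ginf) (f : VirtualUnitary → ℂ) (x : VirtualUnitary) : ℂ :=
  f (act x g) * Czw z w x g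

lemma shiftFun_ae (hs : -(1 / 2 : ℝ) < s.re) (z w : ℂ) (g : Ginf) {f f' : VirtualUnitary → ℂ}
    (h : f =ᵐ[muS s] f') : shiftFun z w g f =ᵐ[muS s] shiftFun z w g f' := by
  filter_upwards [(quasiMeasurePreserving_act hs g).ae h] with x hx
  simp [shiftFun, hx]

lemma aestronglyMeasurable_shiftFun (hs : -(1 / 2 : ℝ) < s.re) (z w : ℂ) (g : Ginf)
    {f : VirtualUnitary → ℂ} (hf : AEStronglyMeasurable f (muS s)) :
    AEStronglyMeasurable (shiftFun z w g f) (muS s) := by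
  obtain ⟨M, u, v, h1, h2⟩ := exists_ofUN₂ g.1 g.2
  obtain rfl : g = (ofUN M u, ofUN M v) := Prod.ext h1 h2
  exact (hf.comp_quasiMeasurePreserving (quasiMeasurePreserving_act hs _)).mul
    ⟨_, (measurable_ratio z w _ M).stronglyMeasurable, ae_Czw_eq_ratio hs z w u v le_rfl⟩

lemma eLpNorm_shiftFun (hs : -(1 / 2 : ℝ) < s.re) (hzw : z + conj w = s) (g : Ginf)
    {f : VirtualUnitary → ℂ} (hf : AEStronglyMeasurable f (muS s)) :
    eLpNorm (shiftFun z w g f) 2 (muS s) = eLpNorm f 2 (muS s) := by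
  obtain ⟨M, u, v, h1, h2⟩ := exists_ofUN₂ g.1 g.2
  obtain rfl : g = (ofUN M u, ofUN M v) := Prod.ext h1 h2
  obtain ⟨f', hf', he⟩ := hf
  rw [eLpNorm_congr_ae he, eLpNorm_congr_ae (shiftFun_ae hs z w _ he), eLpNorm_two, eLpNorm_two]
  congr 1
  have hm : Measurable fun x => ‖f' x‖ₑ ^ 2 := hf'.measurable.enorm.pow_const 2
  conv_rhs => rw [← map_act_withDensity hs hzw u v]
  rw [lintegral_map hm (measurable_act _), lintegral_withDensity_eq_lintegral_mul _
    (f := fun x => ‖ratio z w (ofUN M u, ofUN M v) M x‖ₑ ^ 2)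
    ((measurable_ratio z w _ M).enorm.pow_const 2)
    (g := fun x => ‖f' (act x (ofUN M u, ofUN M v))‖ₑ ^ 2) (hm.comp (measurable_act _))]
  refine lintegral_congr_ae ?_
  filter_upwards [ae_Czw_eq_ratio hs z w u v le_rfl] with x hx
  rw [shiftFun, hx, enorm_mul, mul_pow, mul_comm]
  rfl

lemma memLp_shiftFun (hs : -(1 / 2 : ℝ) < s.re) (hzw : z + conj w = s) (g : Ginf)
    {f : VirtualUnitary → ℂ} (hf : MemLp f 2 (muS s)) : MemLp (shiftFun z w g f) 2 (muS s) := by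
  refine ⟨aestronglyMeasurable_shiftFun hs z w g hf.1, ?_⟩
  rw [eLpNorm_shiftFun hs hzw g hf.1]
  exact hf.2

/-- The isometry `f ↦ f(x.g) C_{z,w}(x, g)` of `L²(𝔘, μ^{(s)})`. -/
def shiftIsom (hs : -(1 / 2 : ℝ) < s.re) (hzw : z + conj w = s) (g : Ginf) :
    Lp ℂ 2 (muS s) →ₗᵢ[ℂ] Lp ℂ 2 (muS s) where
  toFun f := (memLp_shiftFun hs hzw g (Lp.memLp f)).toLp _
  map_add' f f' := by
    rw [← MemLp.toLp_add]
    refine MemLp.toLp_congr _ _ ?_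
    refine (shiftFun_ae hs z w g (Lp.coeFn_add f f')).trans (Eventually.of_forall fun x => ?_)
    simp [shiftFun, add_mul]
  map_smul' c f := by
    rw [RingHom.id_apply, ← MemLp.toLp_const_smul]
    refine MemLp.toLp_congr _ _ ?_
    refine (shiftFun_ae hs z w g (Lp.coeFn_smul c f)).trans (Eventually.of_forall fun x => ?_)
    simp [shiftFun, mul_assoc]
  norm_map' f := by
    change ‖(memLp_shiftFun hs hzw g (Lp.memLp f)).toLp _‖ = ‖f‖
    rw [Lp.norm_toLp, eLpNorm_shiftFun hs hzw g (Lp.aestronglyMeasurable f), Lp.norm_def]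

lemma coeFn_shiftIsom (hs : -(1 / 2 : ℝ) < s.re) (hzw : z + conj w = s) (g : Ginf)
    (f : Lp ℂ 2 (muS s)) : shiftIsom hs hzw g f =ᵐ[muS s] shiftFun z w g f :=
  MemLp.coeFn_toLp (memLp_shiftFun hs hzw g (Lp.memLp f))

/-- The factor `f'(x.g)` in the denominator of the shifted cylinder function cancels the numerator
of `C_{z,w}`, leaving the translate of `f` over `f'(x)`. -/
lemma shiftIsom_cylIsom (hs : -(1 / 2 : ℝ) < s.re) (hzw : z + conj w = s) {N : ℕ} (u v : UN N)
    (f : HN N) : shiftIsom hs hzw (ofUN N u, ofUN N v) (cylIsom hs hzw N f) =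
      cylIsom hs hzw N (Reg N (u, v) f) := by
  refine Lp.ext ?_
  filter_upwards [coeFn_shiftIsom hs hzw (ofUN N u, ofUN N v) (cylIsom hs hzw N f),
    shiftFun_ae hs z w (ofUN N u, ofUN N v) (coeFn_cylIsom hs hzw f),
    coeFn_cylIsom hs hzw (Reg N (u, v) f), cylFun_ae (z := z) (w := w) hs (coeFn_Reg (u, v) f),
    ae_Czw_eq_ratio hs z w u v le_rfl, ae_fzw_piN_act_ne_zero hs z w u v le_rfl]
    with x e1 e2 e3 e4 e5 hne
  have hpi := piN_act le_rfl u v x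
  simp only [embLE_self, MonoidHom.id_apply] at hpi
  rw [e1, e2, e3, e4, shiftFun, e5, cylFun, cylFun, ratio, div_fzwUnit hs,
    div_mul_div_cancel₀ (mt (fzwUnit_eq_zero_iff hs _).1 hne), hpi]

/-- By density it suffices to treat vectors of some `H_n`. There `g` and the vector are moved to a
common level. -/
lemma shiftIsom_theta (hs : -(1 / 2 : ℝ) < s.re) (hzw : z + conj w = s) (g : Ginf)
    (v : Hzw z w (re_add_re_of_eq hs hzw)) :
    shiftIsom hs hzw g (theta hs hzw v) =
      theta hs hzw (Tzw z w (re_add_re_of_eq hs hzw) g v) := by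
  refine colim_induction (Lemb z w (re_add_re_of_eq hs hzw)) (isClosed_eq
    ((LinearIsometry.continuous _).comp (LinearIsometryEquiv.continuous _))
    ((LinearIsometryEquiv.continuous _).comp (LinearIsometryEquiv.continuous _)))
    (fun n x => ?_) v
  obtain ⟨M, u, v, h1, h2⟩ := exists_ofUN₂ g.1 g.2
  obtain rfl : g = (ofUN M u, ofUN M v) := Prod.ext h1 h2
  simp only [Function.comp_apply]
  rw [← ofUN_embLE (le_max_left M n) u, ← ofUN_embLE (le_max_left M n) v,
    ← incl_isomLE _ (le_max_right M n) x, Tzw_incl, theta_incl, theta_incl, shiftIsom_cylIsom]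

/-- The representation `T_{z,w}` transported to `L²(𝔘, μ^{(s)})`. -/
def transportedRep (hs : -(1 / 2 : ℝ) < s.re) (hzw : z + conj w = s) :
    Ginf →* (Lp ℂ 2 (muS s) ≃ₗᵢ[ℂ] Lp ℂ 2 (muS s)) where
  toFun g := ((theta hs hzw).symm.trans (Tzw z w (re_add_re_of_eq hs hzw) g)).trans (theta hs hzw)
  map_one' := LinearIsometryEquiv.ext fun F => by
    rw [map_one]
    exact (theta hs hzw).apply_symm_apply F
  map_mul' g h := LinearIsometryEquiv.ext fun F => by
    change theta hs hzw (Tzw z w _ (g * h) ((theta hs hzw).symm F)) =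
      theta hs hzw (Tzw z w _ g ((theta hs hzw).symm (theta hs hzw (Tzw z w _ h
        ((theta hs hzw).symm F)))))
    rw [map_mul, LinearIsometryEquiv.symm_apply_apply]
    rfl

lemma theta_symm_transportedRep (hs : -(1 / 2 : ℝ) < s.re) (hzw : z + conj w = s) (g : Ginf)
    (F : Lp ℂ 2 (muS s)) : (theta hs hzw).symm (transportedRep hs hzw g F) =
      Tzw z w (re_add_re_of_eq hs hzw) g ((theta hs hzw).symm F) :=
  (theta hs hzw).symm_apply_apply _

/-- Group law and invertibility come from `T_{z,w}`, so after this identification neither a cocycle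
identity for `C_{z,w}` nor surjectivity of the multiplier operators has to be proved separately. -/
lemma transportedRep_apply (hs : -(1 / 2 : ℝ) < s.re) (hzw : z + conj w = s) (g : Ginf)
    (F : Lp ℂ 2 (muS s)) : transportedRep hs hzw g F = shiftIsom hs hzw g F := by
  conv_rhs => rw [← (theta hs hzw).apply_symm_apply F, shiftIsom_theta]
  rfl

lemma transportedRep_ae (hs : -(1 / 2 : ℝ) < s.re) (hzw : z + conj w = s) (g : Ginf)
    {F : Lp ℂ 2 (muS s)} {f : VirtualUnitary → ℂ} (hf : F =ᵐ[muS s] f) :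
    transportedRep hs hzw g F =ᵐ[muS s] fun x => f (act x g) * Czw z w x g := by
  rw [transportedRep_apply]
  exact (coeFn_shiftIsom hs hzw g F).trans (shiftFun_ae hs z w g hf)

/-! ### The distinguished vector -/

/-- The constant function `1` in `L²(𝔘, μ^{(s)})`. -/
def oneVec (hs : -(1 / 2 : ℝ) < s.re) : Lp ℂ 2 (muS s) :=
  have := isProbabilityMeasure_of_isProjectiveLimit hs (map_piN_muS hs)
  (memLp_const (1 : ℂ)).toLp _

lemma coeFn_oneVec (hs : -(1 / 2 : ℝ) < s.re) : oneVec hs =ᵐ[muS s] fun _ => (1 : ℂ) :=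
  have := isProbabilityMeasure_of_isProjectiveLimit hs (map_piN_muS hs)
  (memLp_const (1 : ℂ)).coeFn_toLp

lemma norm_oneVec (hs : -(1 / 2 : ℝ) < s.re) : ‖oneVec hs‖ = 1 := by
  have := isProbabilityMeasure_of_isProjectiveLimit hs (map_piN_muS hs)
  rw [oneVec, Lp.norm_toLp, eLpNorm_two]
  simp

/-- On the diagonal `g` acts by conjugation and `f_{z,w|N}` is a class function, so the multiplier
is almost everywhere `1`. -/
lemma transportedRep_diag_oneVec (hs : -(1 / 2 : ℝ) < s.re) (hzw : z + conj w = s) (U : Uinf) :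
    transportedRep hs hzw (U, U) (oneVec hs) = oneVec hs := by
  obtain ⟨M, u, -, rfl, -⟩ := exists_ofUN₂ U U
  refine Lp.ext ?_
  filter_upwards [transportedRep_ae hs hzw (ofUN M u, ofUN M u) (coeFn_oneVec hs), coeFn_oneVec hs,
    ae_Czw_eq_ratio hs z w u u le_rfl, ae_fzw_piN_ne_zero hs z w M] with x e1 e2 e3 hne
  rw [e1, e2, e3, ratio_eq z w le_rfl, fzw_conj, div_self hne, one_mul]

lemma cylIsom_fzwUnit (hs : -(1 / 2 : ℝ) < s.re) (hzw : z + conj w = s) (N : ℕ) :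
    cylIsom hs hzw N ((memLp_fzwUnit hs hzw N).toLp _) = oneVec hs := by
  refine Lp.ext ?_
  filter_upwards [cylIsom_toLp hs hzw (memLp_fzwUnit hs hzw N), coeFn_oneVec hs,
    (quasiMeasurePreserving_piN hs N).ae (ae_fzwUnit_ne_zero z w hs N)] with x e1 e2 hne
  rw [e1, e2, cylFun, div_self hne]

lemma fzw_eq_smul_fzwUnit (hs : -(1 / 2 : ℝ) < s.re) (z w : ℂ) (N : ℕ) :
    fzw z w N = ((Real.sqrt (gammaConst s N) : ℝ) : ℂ) • fzwUnit s z w N := by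
  funext U
  rw [Pi.smul_apply, smul_eq_mul, fzwUnit, mul_div_cancel₀ _ (sqrt_gammaConst_ne_zero hs N)]

lemma memLp_fzw (hs : -(1 / 2 : ℝ) < s.re) (hzw : z + conj w = s) (N : ℕ) :
    MemLp (fzw z w N) 2 (haarN N) := by
  rw [fzw_eq_smul_fzwUnit hs]
  exact (memLp_fzwUnit hs hzw N).const_smul _

lemma norm_toLp_fzwUnit (hs : -(1 / 2 : ℝ) < s.re) (hzw : z + conj w = s) (N : ℕ) :
    ‖(memLp_fzwUnit hs hzw N).toLp _‖ = 1 := by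
  rw [Lp.norm_toLp, eLpNorm_two, lintegral_fzwUnit_sq hs hzw]
  simp

lemma fzwNormalized_eq (hs : -(1 / 2 : ℝ) < s.re) (hzw : z + conj w = s) (N : ℕ) :
    fzwNormalized z w N = (memLp_fzwUnit hs hzw N).toLp _ := by
  have h1 : (memLp_fzw hs hzw N).toLp _ =
      ((Real.sqrt (gammaConst s N) : ℝ) : ℂ) • (memLp_fzwUnit hs hzw N).toLp _ := by
    rw [← MemLp.toLp_const_smul]
    exact MemLp.toLp_congr _ _ (Eventually.of_forall fun U => by rw [← fzw_eq_smul_fzwUnit hs])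
  have h2 := Real.sqrt_pos.2 (gammaConst_pos hs N)
  rw [fzwNormalized, dif_pos (memLp_fzw hs hzw N), h1, norm_smul, norm_toLp_fzwUnit hs hzw, mul_one,
    Complex.norm_real, Real.norm_of_nonneg h2.le, smul_smul, Complex.ofReal_inv,
    inv_mul_cancel₀ (Complex.ofReal_ne_zero.2 h2.ne'), one_smul]

lemma isDistinguishedVector_oneVec (hs : -(1 / 2 : ℝ) < s.re) (hzw : z + conj w = s) :
    IsDistinguishedVector z w (re_add_re_of_eq hs hzw) ((theta hs hzw).symm (oneVec hs)) := by
  refine fun N _ => ⟨memLp_fzw hs hzw N, ?_⟩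
  rw [LinearIsometryEquiv.symm_apply_eq, theta_incl, fzwNormalized_eq hs hzw, cylIsom_fzwUnit]

end Fixed

/-! ### Strong continuity -/

lemma continuous_emb (N : ℕ) : Continuous (emb N) := by
  refine (isClosedEmbedding_coe (N + 1)).isInducing.continuous_iff.2 ?_
  refine continuous_pi fun i => continuous_pi fun j => ?_
  change Continuous fun U : UN N => embMat U.1 i j
  refine Fin.lastCases ?_ (fun i => ?_) i <;> refine Fin.lastCases ?_ (fun j => ?_) j
  · simpa only [embMat_ll] using continuous_const
  · simpa only [embMat_lc] using continuous_const
  · simpa only [embMat_cl] using continuous_const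
  · simp only [embMat_cc]
    exact continuous_entry i j

lemma continuous_embLE {N M : ℕ} (h : N ≤ M) : Continuous (embLE h) := by
  induction M, h using Nat.le_induction with
  | base => simpa using continuous_id
  | succ M h ih =>
    rw [embLE_succ h]
    exact (continuous_emb M).comp ih

lemma continuous_uinf {X : Type*} [TopologicalSpace X] {f : Uinf → X}
    (h : ∀ N, Continuous fun U => f (ofUN N U)) : Continuous f :=
  continuous_iSup_dom.2 fun N => continuous_coinduced_dom.2 (h N)

instance (N : ℕ) : (haarN N).Regular := inferInstanceAs (Measure.haarMeasure ⊤).Regular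

lemma continuous_Reg {N : ℕ} (f : HN N) : Continuous fun g => Reg N g f := by
  have hc : Continuous fun p : (UN N × UN N) × UN N => p.1.2⁻¹ * p.2 * p.1.1 := by fun_prop
  exact (continuous_const (y := f)).compMeasurePreservingLp
    (g := (ContinuousMap.curry ⟨_, hc⟩ : C(UN N × UN N, C(UN N, UN N)))) (ContinuousMap.continuous _)
    measurePreserving_biregular ENNReal.ofNat_ne_top

section Isometries

variable {X Y H : Type*} [TopologicalSpace X] [TopologicalSpace Y] [NormedAddCommGroup H]
  [NormedSpace ℂ H]

/-- Orbit maps of nearby vectors are uniformly close, and a uniform limit of continuous maps is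
continuous. -/
lemma isClosed_continuous_orbit (A : X → H ≃ₗᵢ[ℂ] H) : IsClosed {v | Continuous fun x => A x v} := by
  refine isClosed_of_closure_subset fun v hv => ?_
  refine continuous_of_uniform_approx_of_continuous fun u hu => ?_
  obtain ⟨ε, hε, hu⟩ := Metric.mem_uniformity_dist.1 hu
  obtain ⟨v', hv', hd⟩ := Metric.mem_closure_iff.1 hv ε hε
  exact ⟨fun x => A x v', hv', fun x => hu (by rwa [LinearIsometryEquiv.dist_map])⟩

/-- Joint continuity follows from strong continuity, because isometries do not magnify the error in
the vector. -/
lemma continuous_isometry_apply {A : X → H ≃ₗᵢ[ℂ] H} (hA : ∀ v, Continuous fun x => A x v) {f : Y → H}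
    (hf : Continuous f) : Continuous fun p : X × Y => A p.1 (f p.2) := by
  refine continuous_iff_continuousAt.2 fun ⟨a, b⟩ => ?_
  rw [ContinuousAt, tendsto_iff_dist_tendsto_zero]
  have h1 : Tendsto (fun p : X × Y => dist (f p.2) (f b) + dist (A p.1 (f b)) (A a (f b)))
      (𝓝 (a, b)) (𝓝 0) := by
    have : Continuous fun p : X × Y => dist (f p.2) (f b) + dist (A p.1 (f b)) (A a (f b)) :=
      ((hf.comp continuous_snd).dist continuous_const).add
        (((hA (f b)).comp continuous_fst).dist continuous_const)
    simpa using this.tendsto (a, b)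
  refine squeeze_zero (fun _ => dist_nonneg) (fun p => ?_) h1
  refine (dist_triangle _ (A p.1 (f b)) _).trans_eq ?_
  rw [LinearIsometryEquiv.dist_map]

end Isometries

section Colimit

variable {E : ℕ → Type} [∀ n, NormedAddCommGroup (E n)] [∀ n, InnerProductSpace ℂ (E n)]
  {L : ∀ n, E n →ₗᵢ[ℂ] E (n + 1)}

/-- In the inductive limit topology continuity is tested on each `U(N)`. Vectors with continuous
orbit form a closed set, so those of some `E n` suffice. -/
lemma continuous_colimRep (ρ : ∀ n, UN n →* (E n ≃ₗᵢ[ℂ] E n))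
    (hρ : ∀ n g x, L n (ρ n g x) = ρ (n + 1) (emb n g) (L n x))
    (hc : ∀ n x, Continuous fun g => ρ n g x) (v : HilbertColim L) :
    Continuous fun g => colimRep ρ hρ g v := by
  refine continuous_uinf fun N => ?_
  refine colim_induction L (isClosed_continuous_orbit fun U => colimRep ρ hρ (ofUN N U))
    (fun n x => ?_) v
  have h : ∀ U, colimRep ρ hρ (ofUN N U) (incl L n x) = incl L (max N n)
      (ρ (max N n) (embLE (le_max_left N n) U) (isomLE L (le_max_right N n) x)) := by
    intro U
    rw [← colimOp_incl ρ hρ, ofUN_embLE, incl_isomLE]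
    rfl
  simp only [h]
  exact (LinearIsometry.continuous _).comp ((hc _ _).comp (continuous_embLE _))

end Colimit

/-- `T(g₁, g₂)` is the composite of the actions of the two factors, each strongly continuous on
`U(∞)`. Joint continuity thus holds for the product topology on `G`. -/
lemma continuous_Tzw (z w : ℂ) (h : -(1 / 2 : ℝ) < z.re + w.re) (v : Hzw z w h) :
    Continuous fun g => Tzw z w h g v := by
  refine continuous_isometry_apply (continuous_colimRep (L := Lemb z w h)
    (fun N => (Reg N).comp (MonoidHom.inl (UN N) (UN N))) _ fun n x => ?_)
    (continuous_colimRep (L := Lemb z w h)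
    (fun N => (Reg N).comp (MonoidHom.inr (UN N) (UN N))) _ (fun n x => ?_) v)
  · exact (continuous_Reg x).comp (continuous_id.prodMk continuous_const)
  · exact (continuous_Reg x).comp (continuous_const.prodMk continuous_id)

lemma continuous_transportedRep {s z w : ℂ} (hs : -(1 / 2 : ℝ) < s.re) (hzw : z + conj w = s)
    (F : Lp ℂ 2 (muS s)) : Continuous fun g => transportedRep hs hzw g F :=
  (theta hs hzw).continuous.comp (continuous_Tzw z w (re_add_re_of_eq hs hzw) _)

end VirtUnitary

end

theorem theorem4p11 (s z w : ℂ) (hs : -(1 / 2 : ℝ) < s.re) (hzw : z + conj w = s) :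
    -- the projective limit measure `μ^{(s)}` exists, is unique, and is a probability measure
    IsProjectiveLimitMeasure s (muS s) ∧
    (∀ μ : Measure VirtualUnitary, IsProjectiveLimitMeasure s μ → μ = muS s) ∧
    IsProbabilityMeasure (muS s) ∧
    -- the unitary representation given by the multiplier `C_{z,w}`
    ∃ T : Ginf →* (Lp ℂ 2 (muS s) ≃ₗᵢ[ℂ] Lp ℂ 2 (muS s)),
      (∀ (g : Ginf) (F : Lp ℂ 2 (muS s)) (f : VirtualUnitary → ℂ), F =ᵐ[muS s] f →
        T g F =ᵐ[muS s] fun x => f (act x g) * Czw z w x g) ∧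
      (∀ F : Lp ℂ 2 (muS s), Continuous fun g : Ginf => T g F) ∧
      -- the constant function `1` is a unit `K`-invariant vector
      ∃ one : Lp ℂ 2 (muS s), one =ᵐ[muS s] (fun _ => (1 : ℂ)) ∧ ‖one‖ = 1 ∧
        (∀ U : Uinf, T (U, U) one = one) ∧
        -- unitary equivalence with `T_{z,w}`, taking `1` to the distinguished vector
        ∃ Φ : Lp ℂ 2 (muS s) ≃ₗᵢ[ℂ] Hzw z w (re_add_re_of_eq hs hzw),
          (∀ (g : Ginf) (F : Lp ℂ 2 (muS s)),
            Φ (T g F) = Tzw z w (re_add_re_of_eq hs hzw) g (Φ F)) ∧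
          IsDistinguishedVector z w (re_add_re_of_eq hs hzw) (Φ one) := by
  exact ⟨map_piN_muS hs, fun _ => eq_muS hs,
    isProbabilityMeasure_of_isProjectiveLimit hs (map_piN_muS hs), transportedRep hs hzw,
    fun g _ _ => transportedRep_ae hs hzw g, continuous_transportedRep hs hzw, oneVec hs, coeFn_oneVec hs,
    norm_oneVec hs, transportedRep_diag_oneVec hs hzw, (theta hs hzw).symm, theta_symm_transportedRep hs hzw,
    isDistinguishedVector_oneVec hs hzw⟩
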